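/- Let $R$ be a complete discrete valuation ring of characteristic $0$ with maximal ideal $(\pi)$ and finite residue field $\mathbf F_q$ of characteristic $p$, and suppose that $R$ contains an element $\pi^*$ with $(\pi^*)^{p-1}=-p$. Let $R_d$ be the unramified extension of $R$ with residue field $\mathbf F_{q^d}$. For a finite set of variables $Z$, let $R[Z]^\dagger$ be the ring of power series $\sum_u a_uZ^u$, $a_u\in R$, with $\lim_{k\to\infty}\inf_{|u|>k}\operatorname{ord}_\pi(a_u)/|u|>0$. A Frobenius lifting on an $R$-algebra $B$ is an $R$-algebra endomorphism $\sigma$ with $\sigma(b)\equiv b^q \pmod{\pi B}$ for all $b\in B$. A $\sigma$-module over $B$ is a free $B$-module of finite rank with a $\sigma$-linear endomorphism. Let $\mu:R[X_1,\dots,X_n]^\dagger\to A$ be a surjective homomorphism of $R$-algebras with $A$ flat over $R$, let $X=\operatorname{Spec}(A/\pi A)$, and let $\sigma$ be a Frobenius lifting on $A$. (No smoothness or connectedness of $X$ is needed.) For $B=A$, $R[X_1,\dots,X_n]^\dagger$ or $R[X_1,\dots,X_n,Y_1,\dots,Y_s]^\dagger$ with a Frobenius lifting $\sigma$, each closed point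 $\bar x$ of $\operatorname{Spec}(B/\pi B)$, of degree $d$ over $\mathbf F_q$, has a Teichmüller lifting: a surjective $R$-algebra homomorphism $x:B\to R_d$ with $x\circ\sigma^d=x$ whose reduction $B/\pi B\to\mathbf F_{q^d}$ has kernel $\bar x$; it is unique up to replacing $x$ by $x\circ\sigma^i$. For a $\sigma$-module $(M,\phi)$ over $B$, write $\phi_x$ for the fibre of $\phi$ on $M\otimes_{B,x}R_d$; then $\phi_x^{jd}$ is $R_d$-linear for each integer $j\ge 0$. For $\sigma$-modules $\phi_1,\dots,\phi_m$ and integers $k_i\ge 0$ put $$L(\phi_1^{k_1}\otimes\cdots\otimes\phi_m^{k_m},T)=\prod_{\bar x}\det\bigl(I-\phi_{1,x}^{k_1\deg \bar x}\otimes\cdots\otimes\phi_{m,x}^{k_m\deg \bar x}\,T^{\deg \bar x}\bigr)^{-1},$$ the product being over the closed points of $\operatorname{Spec}(B/\pi B)$. Let $(M,\phi)$ and $(N,\psi)$ be $\sigma$-modules over $A$. Choose a Frobenius lifting $\sigma$ on $R[X]^\dagger=R[X_1,\dots,X_n]^\dagger$ with $\mu\circ\sigma=\sigma\circ\mu$.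 Choose bases of $M$ and $N$, and lift the matrices of $\phi$ and $\psi$ in these bases along $\mu$, entry by entry, to matrices over $R[X]^\dagger$; let $\phi_0,\psi_0$ be the $\sigma$-modules over $R[X]^\dagger$ with these Frobenius matrices. Let $f_1,\dots,f_s$ generate the ideal $\ker\mu$, and extend $\sigma$ from $R[X]^\dagger$ to a Frobenius lifting on $R[X,Y]^\dagger=R[X_1,\dots,X_n,Y_1,\dots,Y_s]^\dagger$ (for instance by $\sigma(Y_i)=Y_i^q$). Denote the extensions of $\phi_0,\psi_0$ to $R[X,Y]^\dagger$ by the same letters. Then the exponential series $$\Phi_{s,f}(X,Y)=\exp\Bigl(\pi^*\sum_{i=1}^sY_if_i(X)-\pi^*\sum_{i=1}^s\sigma(Y_i)\,\sigma(f_i(X))\Bigr)$$ (its partial sums converging $\pi$-adically in each coefficient) defines an element of $R[X,Y]^\dagger$. Regard it as the $\sigma$-module of rank one over $R[X,Y]^\dagger$ with $1\times1$ Frobenius matrix $\Phi_{s,f}$. Then $$L(\phi_0/X,T)=L\Bigl(\phi_0\otimes\Phi_{s,f}/\mathbf A^{n+s},\frac{1}{q^s}T\Bigr),$$ where the left side is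 the Euler product for $\phi_0$ over $\mathbf A^n$ restricted to the closed points of $\mathbf A^n$ lying on $X$; and, for each positive integer $k$, $$L(\psi\otimes\phi^k,T)=L\Bigl(\psi_0\otimes\phi_0^k\otimes\Phi_{s,f}/\mathbf A^{n+s},\frac{1}{q^s}T\Bigr).$$ -/

import Mathlib

open IsLocalRing
open scoped TensorProduct

noncomputable section

namespace SigmaMod

/-! ### Overconvergent power series -/

section Overconvergent

variable {R : Type*} [CommRing R] [IsLocalRing R] {ι : Type*}

/-- `lim_{k → ∞} inf_{|u| > k} ord_π(a_u) / |u| > 0`: for some `ε > 0` one has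
`ord_π(a_u) ≥ ε |u|` as soon as `|u|` is large enough. -/
def IsOverconvergent (a : MvPowerSeries ι R) : Prop :=
  ∃ ε : ℝ, 0 < ε ∧ ∃ k : ℕ, ∀ u : ι →₀ ℕ, k < u.degree →
    MvPowerSeries.coeff u a ∈ maximalIdeal R ^ ⌈ε * u.degree⌉₊

theorem isOverconvergent_monomial (v : ι →₀ ℕ) (r : R) :
    IsOverconvergent (MvPowerSeries.monomial v r) := by
  classical
  refine ⟨1, one_pos, v.degree, fun u hu => ?_⟩
  rw [MvPowerSeries.coeff_monomial, if_neg]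
  · exact Ideal.zero_mem _
  · rintro rfl; exact lt_irrefl _ hu

theorem IsOverconvergent.add {a b : MvPowerSeries ι R} (ha : IsOverconvergent a)
    (hb : IsOverconvergent b) : IsOverconvergent (a + b) := by
  obtain ⟨ε, hε, k, h⟩ := ha
  obtain ⟨δ, hδ, l, h'⟩ := hb
  refine ⟨min ε δ, lt_min hε hδ, max k l, fun u hu => ?_⟩
  rw [map_add]
  refine Ideal.add_mem _ (Ideal.pow_le_pow_right (Nat.ceil_mono ?_) (h u ?_))
    (Ideal.pow_le_pow_right (Nat.ceil_mono ?_) (h' u ?_))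
  · gcongr; exact min_le_left _ _
  · exact (le_max_left _ _).trans_lt hu
  · gcongr; exact min_le_right _ _
  · exact (le_max_right _ _).trans_lt hu

theorem IsOverconvergent.mul {a b : MvPowerSeries ι R} (ha : IsOverconvergent a)
    (hb : IsOverconvergent b) : IsOverconvergent (a * b) := by
  classical
  obtain ⟨ε, hε, k, h⟩ := ha
  obtain ⟨δ, hδ, l, h'⟩ := hb
  refine ⟨min ε δ / 2, half_pos (lt_min hε hδ), 2 * max k l, fun u hu => ?_⟩
  rw [MvPowerSeries.coeff_mul]
  refine Ideal.sum_mem _ fun vw hvw => ?_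
  rw [Finset.HasAntidiagonal.mem_antidiagonal] at hvw
  have hd : vw.1.degree + vw.2.degree = u.degree := by rw [← hvw, map_add]
  have hd' : (u.degree : ℝ) = vw.1.degree + vw.2.degree := by exact_mod_cast hd.symm
  have hm : 0 < min ε δ := lt_min hε hδ
  rcases le_total vw.2.degree vw.1.degree with hle | hle
  · have hle' : (vw.2.degree : ℝ) ≤ vw.1.degree := by exact_mod_cast hle
    refine Ideal.mul_mem_right _ _ (Ideal.pow_le_pow_right (Nat.ceil_mono ?_) (h vw.1 ?_))
    · calc min ε δ / 2 * (u.degree : ℝ) ≤ min ε δ * vw.1.degree := by rw [hd']; nlinarith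
        _ ≤ ε * vw.1.degree := by gcongr; exact min_le_left _ _
    · have := le_max_left k l; omega
  · have hle' : (vw.1.degree : ℝ) ≤ vw.2.degree := by exact_mod_cast hle
    refine Ideal.mul_mem_left _ _ (Ideal.pow_le_pow_right (Nat.ceil_mono ?_) (h' vw.2 ?_))
    · calc min ε δ / 2 * (u.degree : ℝ) ≤ min ε δ * vw.2.degree := by rw [hd']; nlinarith
        _ ≤ δ * vw.2.degree := by gcongr; exact min_le_right _ _
    · have := le_max_right k l; omega

/-- The ring `R[X_i : i ∈ ι]†` of overconvergent power series. -/
def Overconvergent (R : Type*) [CommRing R] [IsLocalRing R] (ι : Type*) :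
    Subalgebra R (MvPowerSeries ι R) where
  carrier := {a | IsOverconvergent a}
  mul_mem' := IsOverconvergent.mul
  add_mem' := IsOverconvergent.add
  algebraMap_mem' r := by
    rw [MvPowerSeries.algebraMap_apply]
    exact isOverconvergent_monomial 0 r

/-- The variable `X_i` as an overconvergent series. -/
def Overconvergent.X (i : ι) : Overconvergent R ι :=
  ⟨MvPowerSeries.X i, isOverconvergent_monomial _ 1⟩

theorem IsOverconvergent.rename {κ : Type*} (e : ι ↪ κ) {a : MvPowerSeries ι R}
    (ha : IsOverconvergent a) : IsOverconvergent (MvPowerSeries.rename e a) := by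
  obtain ⟨ε, hε, k, h⟩ := ha
  refine ⟨ε, hε, k, fun u hu => ?_⟩
  by_cases hr : u ∈ Set.range (Finsupp.embDomain e)
  · obtain ⟨v, rfl⟩ := hr
    have hdeg : (Finsupp.embDomain e v).degree = v.degree := by
      rw [Finsupp.embDomain_eq_mapDomain, Finsupp.degree_mapDomain]
    rw [MvPowerSeries.coeff_embDomain_rename]
    rw [hdeg] at hu ⊢
    exact h v hu
  · rw [MvPowerSeries.coeff_rename_eq_zero]
    · exact Ideal.zero_mem _
    · rintro ⟨v, rfl⟩
      exact hr ⟨v, Finsupp.embDomain_eq_mapDomain e v⟩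

/-- The inclusion of `R[X]†` into `R[X, Y]†`. -/
def inclX (R : Type*) [CommRing R] [IsLocalRing R] (ι κ : Type*) :
    Overconvergent R ι →ₐ[R] Overconvergent R (ι ⊕ κ) :=
  ((MvPowerSeries.rename (Function.Embedding.inl : ι ↪ ι ⊕ κ)).comp
    (Overconvergent R ι).val).codRestrict _ fun a => IsOverconvergent.rename _ a.2

end Overconvergent

/-! ### Exponentials -/

section Exp

variable {R : Type*} [CommRing R] [IsDomain R] [IsLocalRing R] {ι : Type*}

/-- `Φ = exp(c H) = ∑_m (c H)^m / m!`: for every monomial `X^u`, the coefficients of `X^u` in the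
partial sums of the exponential series, computed in the fraction field `K` of `R`, converge to
that of `Φ` for the `π`-adic topology of `K` (so there is at most one such `Φ` if `R` is a
discrete valuation ring). -/
def IsExp (c : R) (H Φ : MvPowerSeries ι R) : Prop :=
  ∀ (u : ι →₀ ℕ) (N : ℕ), ∃ m₀ : ℕ, ∀ m ≥ m₀, ∃ r ∈ maximalIdeal R ^ N,
    algebraMap R (FractionRing R) (MvPowerSeries.coeff u Φ)
      - ∑ j ∈ Finset.range m,
          algebraMap R (FractionRing R) (c ^ j * MvPowerSeries.coeff u (H ^ j)) / (j.factorial : FractionRing R)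
      = algebraMap R (FractionRing R) r

end Exp

/-! ### Frobenius lifts, closed points and Teichmüller liftings -/

section Points

variable (R : Type*) [CommRing R] [IsDomain R] [IsLocalRing R]

/-- An algebraic closure of the fraction field of `R`; the rings `R_d` below live in it. -/
abbrev KBar : Type _ := AlgebraicClosure (FractionRing R)

/-- The unramified extension `R_d` of `R` with residue field `𝔽_{q^d}`, where `𝔽_q` is the residue
field of `R`: it is `R[ζ]` with `ζ` a primitive `(q^d - 1)`-th root of unity. -/
def Unramified (d : ℕ) : Subalgebra R (KBar R) :=
  Algebra.adjoin R {z : KBar R | z ^ (Nat.card (ResidueField R) ^ d - 1) = 1}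

variable {R} {A : Type*} [CommRing A] [Algebra R A]

/-- `σ` lifts the `q`-th power Frobenius of `A / πA`. -/
def IsFrobeniusLift (σ : A →ₐ[R] A) : Prop :=
  ∀ a : A, σ a - a ^ Nat.card (ResidueField R) ∈ (maximalIdeal R).map (algebraMap R A)

variable (R A) in
/-- The closed points of the affine scheme `X = Spec (A / πA)` over the residue field of `R`. -/
abbrev ClosedPoint : Type _ := MaximalSpectrum (ResidueField R ⊗[R] A)

/-- The degree of a closed point over the residue field of `R`. -/
def ClosedPoint.degree (P : ClosedPoint R A) : ℕ :=
  Module.finrank (ResidueField R) ((ResidueField R ⊗[R] A) ⧸ P.asIdeal)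

/-- Teichmüller liftings with respect to `σ`, of the geometric points belonging to the closed point
`P` of degree `d`: surjective `R`-algebra homomorphisms `x : A → R_d` with `x ∘ σ^d = x`, whose
reduction `A / πA → R_d / πR_d = 𝔽_{q^d}` has kernel `P`. -/
structure TeichmullerLift (σ : A →ₐ[R] A) (P : ClosedPoint R A) where
  toHom : A →ₐ[R] Unramified R P.degree
  surjective : Function.Surjective toHom
  fixed : ∀ a, toHom (σ^[P.degree] a) = toHom a
  reduction : ∀ a, toHom a ∈ (maximalIdeal R).map (algebraMap R (Unramified R P.degree)) ↔
    (1 : ResidueField R) ⊗ₜ[R] a ∈ P.asIdeal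

end Points

/-! ### Fibres of `σ`-modules

A `σ`-module over `A` is a finite free `A`-module `M` with a `σ`-linear map `φ : M →ₛₗ[σ] M`. -/

section Fibre

variable {A S : Type*} [CommRing A] [CommRing S]

/-- The fibre `M_x = M ⊗_A S` at a point `x : A → S`. -/
def Fibre (x : A →+* S) (M : Type*) [AddCommGroup M] [Module A M] : Type _ :=
  letI := x.toAlgebra
  S ⊗[A] M

variable (x : A →+* S) {M : Type*} [AddCommGroup M] [Module A M]

instance : AddCommGroup (Fibre x M) :=
  letI := x.toAlgebra
  (inferInstance : AddCommGroup (S ⊗[A] M))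

instance : Module S (Fibre x M) :=
  letI := x.toAlgebra
  (inferInstance : Module S (S ⊗[A] M))

instance [Module.Free A M] : Module.Free S (Fibre x M) :=
  letI := x.toAlgebra
  (inferInstance : Module.Free S (S ⊗[A] M))

instance [Module.Finite A M] : Module.Finite S (Fibre x M) :=
  letI := x.toAlgebra
  (inferInstance : Module.Finite S (S ⊗[A] M))

theorem iterate_smul {σ : A →+* A} (φ : M →ₛₗ[σ] M) (m : ℕ) (a : A) (v : M) :
    φ^[m] (a • v) = σ^[m] a • φ^[m] v := by
  induction m with
  | zero => rfl
  | succ m ih => simp only [Function.iterate_succ_apply', ih, map_smulₛₗ]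

theorem iterate_add {σ : A →+* A} (φ : M →ₛₗ[σ] M) (m : ℕ) (v w : M) :
    φ^[m] (v + w) = φ^[m] v + φ^[m] w := by
  induction m with
  | zero => rfl
  | succ m ih => simp only [Function.iterate_succ_apply', ih, map_add]

/-- The `m`-th iterate `φ_x^m : M_x → M_x` of the fibre of `φ` at `x`, for `m` with `x ∘ σ^m = x`;
it is `S`-linear and sends `s ⊗ v` to `s ⊗ φ^m(v)`. -/
def fibrePow {σ : A →+* A} (φ : M →ₛₗ[σ] M) (m : ℕ) (hx : ∀ a, x (σ^[m] a) = x a) :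
    Fibre x M →ₗ[S] Fibre x M :=
  letI := x.toAlgebra
  LinearMap.liftBaseChange (R := A) (M := M) (N := S ⊗[A] M) S
    { toFun := fun v => 1 ⊗ₜ[A] φ^[m] v
      map_add' := fun v w => by rw [iterate_add, TensorProduct.tmul_add]
      map_smul' := fun a v => by
        rw [iterate_smul, RingHom.id_apply, TensorProduct.tmul_smul,
          ← algebraMap_smul S (σ^[m] a), ← algebraMap_smul S a]
        exact congrArg (fun t : S => t • (1 ⊗ₜ[A] φ^[m] v : S ⊗[A] M)) (hx a) }

theorem apply_iterate_mul {σ : A →+* A} {d : ℕ} (hx : ∀ a, x (σ^[d] a) = x a) (k : ℕ) (a : A) :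
    x (σ^[k * d] a) = x a := by
  induction k with
  | zero => simp
  | succ k ih => rw [Nat.succ_mul, add_comm, Function.iterate_add_apply, hx, ih]

end Fibre

/-! ### L-functions -/

section LFunction

variable {R : Type*} [CommRing R] [IsDomain R] [IsLocalRing R]
variable {A : Type*} [CommRing A] [Algebra R A] {σ : A →ₐ[R] A}

/-- At a Teichmüller lifting `x` of a closed point of degree `d`, the endomorphism `φ_x^{k d}`. -/
def TeichmullerLift.frob {P : ClosedPoint R A} (x : TeichmullerLift σ P)
    {M : Type*} [AddCommGroup M] [Module A M] (φ : M →ₛₗ[(σ : A →+* A)] M) (k : ℕ) :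
    Fibre (x.toHom : A →+* Unramified R P.degree) M →ₗ[Unramified R P.degree]
      Fibre (x.toHom : A →+* Unramified R P.degree) M :=
  fibrePow (x.toHom : A →+* Unramified R P.degree) φ (k * P.degree)
    (apply_iterate_mul _ x.fixed k)

/-- `det(I - f T)`, for an endomorphism `f` of a finite free module over `R_d`, as a polynomial
in `T` (the reverse of the characteristic polynomial `det(T I - f)`). -/
def detOneSub {d : ℕ} {V : Type*} [AddCommGroup V] [Module (Unramified R d) V]
    [Module.Free (Unramified R d) V] [Module.Finite (Unramified R d) V]
    (f : V →ₗ[Unramified R d] V) : Polynomial (KBar R) :=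
  f.charpoly.reverse.map (algebraMap (Unramified R d) (KBar R))

open scoped Classical in
/-- The Euler factor `1 / D_x(T^d)` at a closed point of degree `d`, where `D_x` is a polynomial
attached to the Teichmüller liftings `x` of the closed point, and `x` is such a lifting. -/
def eulerFactor {P : ClosedPoint R A} (D : TeichmullerLift σ P → Polynomial (KBar R)) :
    PowerSeries (KBar R) :=
  if h : Nonempty (TeichmullerLift σ P) then
    (Polynomial.expand (KBar R) P.degree (D h.some) : PowerSeries (KBar R))⁻¹
  else 1

/-- The Euler product of `1 / D_x(T^deg(x))` over the closed points in `Z`: its coefficient of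
`T^m` is that of the finite product over the points of degree at most `m`, since all the other
factors are `1` modulo `T^(m+1)`. -/
def eulerProduct (Z : Set (ClosedPoint R A))
    (D : ∀ P : ClosedPoint R A, TeichmullerLift σ P → Polynomial (KBar R)) :
    PowerSeries (KBar R) :=
  PowerSeries.mk fun m =>
    PowerSeries.coeff m (∏ᶠ P ∈ {P : ClosedPoint R A | P ∈ Z ∧ P.degree ≤ m}, eulerFactor (D P))

variable {M N L : Type*} [AddCommGroup M] [Module A M] [Module.Free A M] [Module.Finite A M]
  [AddCommGroup N] [Module A N] [Module.Free A N] [Module.Finite A N]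
  [AddCommGroup L] [Module A L] [Module.Free A L] [Module.Finite A L]

/-- `L(φ, T)`, with the Euler product restricted to the closed points in `Z`. -/
def LFunOn (Z : Set (ClosedPoint R A)) (φ : M →ₛₗ[(σ : A →+* A)] M) : PowerSeries (KBar R) :=
  eulerProduct (σ := σ) Z fun _ x => detOneSub (x.frob φ 1)

/-- `L(ψ ⊗ φ^k, T)`, the product over the closed points of
`1 / det(I - ψ_x^{deg x} ⊗ φ_x^{k deg x} T^{deg x})`. -/
def LFunTensor (ψ : N →ₛₗ[(σ : A →+* A)] N) (φ : M →ₛₗ[(σ : A →+* A)] M) (k : ℕ) :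
    PowerSeries (KBar R) :=
  eulerProduct (σ := σ) Set.univ fun _ x =>
    detOneSub (TensorProduct.map (x.frob ψ 1) (x.frob φ k))

/-- `L(ψ ⊗ φ^k ⊗ Φ, T)`, the product over the closed points of
`1 / det(I - ψ_x^{deg x} ⊗ φ_x^{k deg x} ⊗ Φ_x^{deg x} T^{deg x})`. -/
def LFunTensor₃ (ψ : N →ₛₗ[(σ : A →+* A)] N) (φ : M →ₛₗ[(σ : A →+* A)] M) (k : ℕ)
    (Φ : L →ₛₗ[(σ : A →+* A)] L) : PowerSeries (KBar R) :=
  eulerProduct (σ := σ) Set.univ fun _ x =>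
    detOneSub (TensorProduct.map (TensorProduct.map (x.frob ψ 1) (x.frob φ k)) (x.frob Φ 1))

end LFunction

/-! ### `σ`-modules given by a Frobenius matrix -/

section OfMatrix

variable {A : Type*} [CommRing A] {ι : Type*} [Fintype ι]

/-- The `σ`-linear map on `A^ι` with `φ(e_j) = ∑ i, C i j • e_i`. -/
def ofMatrix (σ : A →+* A) (C : Matrix ι ι A) : (ι → A) →ₛₗ[σ] (ι → A) where
  toFun v := C.mulVec fun i => σ (v i)
  map_add' v w := by
    rw [← Matrix.mulVec_add]; congr 1; ext i; simp
  map_smul' a v := by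
    rw [← Matrix.mulVec_smul]; congr 1; ext i; simp

end OfMatrix

end SigmaMod

end

open SigmaMod

open IsLocalRing
open scoped TensorProduct

noncomputable section

namespace SigmaMod

/-! ### The integral exponential series -/

section Exponential

variable {R : Type*} [CommRing R] [IsLocalRing R]
  {p : ℕ} [Fact p.Prime] [CharP (ResidueField R) p]

/-! The identities come from orthogonality of additive characters, applied point by point. An Euler
product `F` satisfies `T F' = F ∑ s_j T^j`, where `s_j` sums traces of iterated Frobenius over the
fixed points of `σ^j` with values in `R_j` (`eulerProduct_recursion`). In characteristic zero this
recursion and the constant term `1` determine `F`. It therefore suffices to compare the `s_j` on the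
two sides, up to the factor `q^(sj)` produced by `T ↦ T / q^s`.

The fixed points of `𝔸^(n+s)` above a fixed point `x` of `𝔸^n` correspond to the residues `y_i` of
the coordinates `Y_i`. The orbit product of `Φ` at such a point is a `p`-th root of unity congruent
to `1 + π* Tr(∑ y_i f_i(x))` modulo `π* 𝔪`, with `Tr` the trace to `𝔽_p`. It is thus an additive
character of `y`; its sum over `y` is `q^(sj)` if every `f_i` vanishes at the reduction of `x`, and
`0` otherwise (`sum_isRootOver`, `sum_splitting`). For the second identity, flatness of `A`
identifies the fixed points over `A` with those of `R[X]†` whose reductions lie on `X`, by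
`fixed_hom_apply_eq_zero`.

The analytic input is `exists_splitting`. Put `E = (exp(π* t) - 1) / π*`, which has integral
coefficients. Expanding `(1 + π* E)^p = exp(p π* t)` and dividing by `p π*`, with `(π*)^p = -p π*`,
gives `E - E^p - π* E² g(E) = (exp(p π* t) - 1) / (p π*)`, whose right side has rapidly decreasing
coefficients. At `t = G - σ G` and modulo `𝔪` this is the Artin–Schreier equation `W - W^p = G -
G^q`, so `W ≡ ∑_{i<a} G^(p^i)` with `q = p^a`. A Hensel argument that keeps track of decay then
makes `W`, and with it `Φ = 1 + π* W`, overconvergent. The congruence gives the trace in the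
exponent of the character. That the orbit product is a `p`-th root of unity follows from `Φ^p =
exp(p π* (G - σ G))`, which converges uniformly and telescopes along an orbit. -/

theorem natCast_mem_maximalIdeal_iff (u : ℕ) : (u : R) ∈ maximalIdeal R ↔ p ∣ u := by
  rw [← residue_eq_zero_iff, map_natCast, CharP.cast_eq_zero_iff (ResidueField R) p]

/-- Legendre's formula gives `(p - 1) v_p((k+1)!) = k + 1 -` (digit sum) `≤ k`. So `π*^k` absorbs
the power of `p` in the factorial, each `p` being `-π*^(p-1)`, and the remaining cofactor is prime
to `p`, hence a unit. -/
theorem exists_mul_factorial_succ {πs : R} (hπs : πs ^ (p - 1) = -(p : R)) (k : ℕ) :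
    ∃ e : R, e * ((k + 1).factorial : R) = πs ^ k := by
  have hp : p.Prime := Fact.out
  set v := padicValNat p (k + 1).factorial
  obtain ⟨u, hu⟩ : p ^ v ∣ (k + 1).factorial := pow_padicValNat_dvd
  have hpu : ¬ p ∣ u := by
    rintro ⟨w, rfl⟩
    refine pow_succ_padicValNat_not_dvd (p := p) (Nat.factorial_ne_zero (k + 1)) ?_
    exact ⟨w, hu.trans (by ring)⟩
  have hunit : IsUnit (u : R) := by
    by_contra h
    exact hpu ((natCast_mem_maximalIdeal_iff (R := R) u).1 h)
  obtain ⟨w, hw⟩ := hunit.exists_left_inv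
  have hv : (p - 1) * v ≤ k := by
    have h1 := sub_one_mul_padicValNat_factorial (p := p) (k + 1)
    have h2 : (p.digits (k + 1)).sum ≠ 0 := by
      intro h0
      rw [List.sum_eq_zero_iff] at h0
      have h3 := Nat.getLast_digit_ne_zero p (Nat.succ_ne_zero k)
      exact h3 (h0 _ (List.getLast_mem _))
    change (p - 1) * v = _ at h1
    omega
  refine ⟨(-1) ^ v * w * πs ^ (k - (p - 1) * v), ?_⟩
  have : πs ^ k = (-(p : R)) ^ v * πs ^ (k - (p - 1) * v) := by
    rw [← hπs, ← pow_mul, ← pow_add, Nat.add_sub_cancel' hv]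
  rw [this, hu, neg_pow (p : R)]
  push_cast
  linear_combination (-1) ^ v * πs ^ (k - (p - 1) * v) * (p : R) ^ v * hw

variable (p) in
theorem sub_one_pos_of_prime : 0 < p - 1 := Nat.sub_pos_of_lt (Fact.out : p.Prime).one_lt

theorem mem_maximalIdeal_of_pow_eq {πs : R} (hπs : πs ^ (p - 1) = -(p : R)) :
    πs ∈ maximalIdeal R := by
  refine (inferInstance : (maximalIdeal R).IsPrime).mem_of_pow_mem (p - 1) ?_
  rw [hπs, neg_mem_iff, natCast_mem_maximalIdeal_iff (p := p)]

/-- `(π^k / k!) / π` for `k ≥ 1`, and `0` for `k = 0`. -/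
def expCoeff (πs : R) (hπs : πs ^ (p - 1) = -(p : R)) : ℕ → R
  | 0 => 0
  | k + 1 => (exists_mul_factorial_succ hπs k).choose

variable {πs : R} (hπs : πs ^ (p - 1) = -(p : R))

theorem expCoeff_succ_mul (k : ℕ) :
    expCoeff πs hπs (k + 1) * ((k + 1).factorial : R) = πs ^ k :=
  (exists_mul_factorial_succ hπs k).choose_spec

/-- The series `(exp(π t) - 1) / π`. -/
def expSeries : PowerSeries R := PowerSeries.mk (expCoeff πs hπs)

/-- The series `(exp(p π t) - 1) / (p π)`. -/
def expSeriesP : PowerSeries R :=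
  PowerSeries.mk fun k => expCoeff πs hπs k * (p : R) ^ (k - 1)

variable [IsDomain R] [CharZero R]

theorem ne_zero_of_pow_eq {πs : R} (hπs : πs ^ (p - 1) = -(p : R)) : πs ≠ 0 := by
  rintro rfl
  rw [zero_pow (sub_one_pos_of_prime p).ne', eq_comm, neg_eq_zero] at hπs
  exact (Fact.out : p.Prime).ne_zero (by exact_mod_cast hπs)

/-- Over the fraction field both sides become honest exponentials, and the claim is `exp(π* t)^p =
exp(p π* t)`. The coefficient map is injective. -/
theorem one_add_mul_expSeries_pow :
    (1 + PowerSeries.C πs * expSeries hπs) ^ p =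
      1 + PowerSeries.C (p * πs) * expSeriesP hπs := by
  let K := FractionRing R
  haveI : CharZero K := charZero_of_injective_algebraMap (IsFractionRing.injective R K)
  have hinj := IsFractionRing.injective R K
  have key : ∀ (a : R) (f : ℕ → R) (k : ℕ), PowerSeries.coeff k
      (1 + PowerSeries.C a * PowerSeries.mk f) = (if k = 0 then 1 else 0) + a * f k := by
    intro a f k
    rw [map_add, PowerSeries.coeff_one, PowerSeries.coeff_C_mul, PowerSeries.coeff_mk]
  have hE : PowerSeries.map (algebraMap R K) (1 + PowerSeries.C πs * expSeries hπs) =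
      PowerSeries.rescale (algebraMap R K πs) (PowerSeries.exp K) := by
    ext k
    rw [PowerSeries.coeff_map, expSeries, key, PowerSeries.coeff_rescale, PowerSeries.coeff_exp]
    rcases k with _ | k
    · simp [expCoeff]
    · have h := congrArg (algebraMap R K) (expCoeff_succ_mul hπs k)
      have h0 : ((k + 1).factorial : K) ≠ 0 := by exact_mod_cast (k + 1).factorial_ne_zero
      simp only [map_mul, map_natCast, map_pow] at h
      simp only [Nat.succ_ne_zero, if_false, map_add, map_mul, map_zero, zero_add, one_div,
        map_inv₀, map_natCast]
      rw [pow_succ', ← h]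
      rw [mul_assoc, mul_assoc, mul_inv_cancel₀ h0, mul_one]
  have hP : PowerSeries.map (algebraMap R K) (1 + PowerSeries.C (p * πs) * expSeriesP hπs) =
      PowerSeries.rescale (p : K) (PowerSeries.map (algebraMap R K)
        (1 + PowerSeries.C πs * expSeries hπs)) := by
    ext k
    rw [PowerSeries.coeff_map, expSeriesP, key, PowerSeries.coeff_rescale, PowerSeries.coeff_map,
      expSeries, key]
    rcases k with _ | k
    · simp [expCoeff]
    · simp only [Nat.succ_ne_zero, if_false, map_add, map_mul, map_zero, zero_add, map_natCast,
        map_pow, Nat.add_sub_cancel]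
      ring
  apply PowerSeries.map_injective _ hinj
  rw [hP, hE, map_pow, hE, ← map_pow, PowerSeries.exp_pow_eq_rescale_exp]
  rw [PowerSeries.rescale_rescale, PowerSeries.rescale_rescale, mul_comm]

omit [IsDomain R] [CharZero R] in
-- Binomial theorem: the inner coefficients are divisible by `p`, and the top term is `π*^p X^p = -p
-- π* X^p`. So `p π*` factors out, and the terms of degree `2` to `p - 1` keep a further factor
-- `π*`.
theorem exists_one_add_pow_eq (hπs : πs ^ (p - 1) = -(p : R)) : ∃ g : Polynomial R,
    (1 + Polynomial.C πs * Polynomial.X) ^ p =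
      1 + Polynomial.C (p * πs) * (Polynomial.X - Polynomial.X ^ p
        - Polynomial.C πs * Polynomial.X ^ 2 * g) := by
  have hp : p.Prime := Fact.out
  have hd : ∀ i, ∃ c : ℕ, 0 < i → i < p → p.choose i = p * c := fun i => by
    by_cases h : 0 < i ∧ i < p
    · obtain ⟨c, hc⟩ := hp.dvd_choose_self h.1.ne' h.2
      exact ⟨c, fun _ _ => hc⟩
    · exact ⟨0, fun h1 h2 => absurd ⟨h1, h2⟩ h⟩
  choose c hc using hd
  obtain ⟨m, hm⟩ : ∃ m, p = m + 2 := ⟨p - 2, by have := hp.two_le; omega⟩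
  -- The terms of degree `i + 2`, for `i < m = p - 2`, divided by `-p π*² X²`.
  refine ⟨-∑ i ∈ Finset.range m, Polynomial.C ((c (i + 2) : R) * πs ^ i) * Polynomial.X ^ i, ?_⟩
  have hpow : πs ^ p = -(p : R) * πs := by
    rw [← hπs, ← pow_succ, Nat.sub_add_cancel hp.one_le]
  rw [add_comm, add_pow]
  conv_lhs => rw [hm]
  rw [Finset.sum_range_succ, Finset.sum_range_succ', Finset.sum_range_succ', ← hm]
  have h1 : ∀ i ∈ Finset.range m, (Polynomial.C πs * Polynomial.X) ^ (i + 1 + 1) *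
      1 ^ (p - (i + 1 + 1)) * ((p.choose (i + 1 + 1) : ℕ) : Polynomial R) =
      Polynomial.C (p * πs) * (Polynomial.C πs * Polynomial.X ^ 2) *
        (Polynomial.C ((c (i + 2) : R) * πs ^ i) * Polynomial.X ^ i) := fun i hi => by
    rw [Finset.mem_range] at hi
    rw [hc (i + 1 + 1) (by omega) (by omega)]
    simp only [map_mul, map_pow, map_natCast, Nat.cast_mul, one_pow]
    ring
  rw [Finset.sum_congr rfl h1, ← Finset.mul_sum]
  have h2 : (Polynomial.C πs * Polynomial.X) ^ p =
      -(Polynomial.C (p * πs) * Polynomial.X ^ p : Polynomial R) := by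
    rw [mul_pow, ← map_pow, hpow]; simp
  rw [h2]
  simp
  ring

/-- The Artin–Schreier type equation satisfied by `(exp(π t) - 1) / π`. -/
theorem exists_expSeries_eq : ∃ g : Polynomial R,
    (1 + Polynomial.C πs * Polynomial.X) ^ p =
      1 + Polynomial.C (p * πs) * (Polynomial.X - Polynomial.X ^ p
        - Polynomial.C πs * Polynomial.X ^ 2 * g) ∧
    expSeries hπs = expSeries hπs ^ p
      + PowerSeries.C πs * expSeries hπs ^ 2 * Polynomial.aeval (expSeries hπs) g
      + expSeriesP hπs := by
  obtain ⟨g, hg⟩ := exists_one_add_pow_eq hπs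
  refine ⟨g, hg, ?_⟩
  have h := congrArg (Polynomial.aeval (expSeries hπs)) hg
  simp only [map_pow, map_add, map_sub, map_mul, map_one, Polynomial.aeval_X,
    Polynomial.aeval_C, ← PowerSeries.algebraMap_eq] at h
  have h' := one_add_mul_expSeries_pow hπs
  simp only [← PowerSeries.algebraMap_eq, map_mul] at h' ⊢
  rw [h] at h'
  -- Characteristic zero permits cancelling `p π*`, which turns the `p`-th power identity into the
  -- Artin–Schreier equation.
  have hne : algebraMap R (PowerSeries R) p * algebraMap R (PowerSeries R) πs ≠ 0 := by
    rw [← map_mul, PowerSeries.algebraMap_eq]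
    refine fun h0 => mul_ne_zero (Nat.cast_ne_zero.2 (Fact.out : p.Prime).ne_zero)
      (ne_zero_of_pow_eq hπs) (PowerSeries.C_injective (by rw [h0, map_zero]))
  have := mul_left_cancel₀ hne (add_left_cancel h')
  linear_combination this

end Exponential

/-! ### Evaluation of a power series at a topologically nilpotent power series -/

section Evaluation

variable {R : Type*} [CommRing R] [IsLocalRing R] {ι : Type*}

variable (R ι) in
/-- The `n`-th power of the ideal generated by the maximal ideal of `R` and the variables,
described on coefficients. -/
def coeffFiltration (n : ℕ) : Ideal (MvPowerSeries ι R) where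
  carrier := {a | ∀ u : ι →₀ ℕ, MvPowerSeries.coeff u a ∈ maximalIdeal R ^ (n - u.degree)}
  add_mem' ha hb u := by rw [map_add]; exact Ideal.add_mem _ (ha u) (hb u)
  zero_mem' u := by rw [map_zero]; exact Ideal.zero_mem _
  smul_mem' c a ha u := by
    classical
    rw [smul_eq_mul, MvPowerSeries.coeff_mul]
    refine Ideal.sum_mem _ fun vw hvw => Ideal.mul_mem_left _ _ ?_
    rw [Finset.HasAntidiagonal.mem_antidiagonal] at hvw
    refine Ideal.pow_le_pow_right ?_ (ha vw.2)
    rw [← hvw, map_add]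
    omega

theorem mul_mem_coeffFiltration {i j : ℕ} {a b : MvPowerSeries ι R}
    (ha : a ∈ coeffFiltration R ι i) (hb : b ∈ coeffFiltration R ι j) :
    a * b ∈ coeffFiltration R ι (i + j) := by
  classical
  intro u
  rw [MvPowerSeries.coeff_mul]
  refine Ideal.sum_mem _ fun vw hvw => ?_
  rw [Finset.HasAntidiagonal.mem_antidiagonal] at hvw
  refine Ideal.pow_le_pow_right ?_ (pow_add (maximalIdeal R) _ _ ▸ Ideal.mul_mem_mul (ha vw.1) (hb vw.2))
  rw [← hvw, map_add]
  omega

theorem pow_mem_coeffFiltration {a : MvPowerSeries ι R} (ha : a ∈ coeffFiltration R ι 1) (n : ℕ) :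
    a ^ n ∈ coeffFiltration R ι n := by
  induction n with
  | zero => intro u; simp
  | succ n ih => rw [pow_succ]; exact mul_mem_coeffFiltration ih ha

theorem coeffFiltration_antitone : Antitone (coeffFiltration R ι) := fun i j hij a ha u =>
  Ideal.pow_le_pow_right (by omega) (ha u)

theorem mem_coeffFiltration_one {a : MvPowerSeries ι R} :
    a ∈ coeffFiltration R ι 1 ↔ MvPowerSeries.constantCoeff a ∈ maximalIdeal R := by
  constructor
  · intro h
    simpa using h 0
  · intro h u
    by_cases hu : u = 0
    · subst hu; simpa using h
    · have : u.degree ≠ 0 := fun h0 => hu ((Finsupp.degree_eq_zero_iff u).1 h0)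
      rw [show 1 - u.degree = 0 by omega]
      simp

/-- At the monomial `u` the `n`-th filtration step only controls precision `n - |u|`, so the
approximant of index `e + |u|` is compared. This is how bounds pass from partial sums to limits. -/
theorem coeff_mem_of_sub_mem_coeffFiltration {w : MvPowerSeries ι R} {a : ℕ → MvPowerSeries ι R}
    (h : ∀ n, w - a n ∈ coeffFiltration R ι n) {u : ι →₀ ℕ} {e : ℕ}
    (ha : ∀ n, MvPowerSeries.coeff u (a n) ∈ maximalIdeal R ^ e) :
    MvPowerSeries.coeff u w ∈ maximalIdeal R ^ e := by
  have := h (e + u.degree) u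
  rw [Nat.add_sub_cancel, map_sub] at this
  exact (Submodule.sub_mem_iff_left _ (ha _)).1 this

variable [IsAdicComplete (maximalIdeal R) R]

theorem eq_zero_of_forall_mem_pow {r : R} (h : ∀ n, r ∈ maximalIdeal R ^ n) : r = 0 :=
  IsHausdorff.haus (I := maximalIdeal R) inferInstance r fun n => by
    rw [SModEq.zero, smul_eq_mul, Ideal.mul_top]; exact h n

theorem eq_zero_of_forall_mem_coeffFiltration {a : MvPowerSeries ι R}
    (h : ∀ n, a ∈ coeffFiltration R ι n) : a = 0 := by
  ext u
  refine eq_zero_of_forall_mem_pow fun n => ?_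
  simpa using h (n + u.degree) u

/-- Completeness holds coefficientwise: at `u` the sequence delayed by `|u|` is Cauchy in `R`. -/
theorem exists_sub_mem_coeffFiltration {a : ℕ → MvPowerSeries ι R}
    (h : ∀ m n, m ≤ n → a n - a m ∈ coeffFiltration R ι m) :
    ∃ w, ∀ n, w - a n ∈ coeffFiltration R ι n := by
  have key : ∀ u : ι →₀ ℕ, ∃ r : R, ∀ n,
      r - MvPowerSeries.coeff u (a (n + u.degree)) ∈ maximalIdeal R ^ n := by
    intro u
    obtain ⟨L, hL⟩ := IsPrecomplete.prec (I := maximalIdeal R) inferInstance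
      (f := fun n => MvPowerSeries.coeff u (a (n + u.degree))) (fun {m n} hmn => by
        rw [SModEq.comm, SModEq.sub_mem, smul_eq_mul, Ideal.mul_top, ← map_sub]
        simpa using h _ _ (Nat.add_le_add_right hmn u.degree) u)
    refine ⟨L, fun n => ?_⟩
    have := (hL n).symm
    rwa [SModEq.sub_mem, smul_eq_mul, Ideal.mul_top] at this
  choose w hw using key
  let w' : MvPowerSeries ι R := fun u => w u
  refine ⟨w', fun n u => ?_⟩
  rcases le_or_gt u.degree n with hu | hu
  · have := hw u (n - u.degree)
    rw [Nat.sub_add_cancel hu] at this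
    rw [map_sub]
    exact this
  -- The truncated exponent is `0`, so there is no condition at monomials of degree above `n`.
  · rw [show n - u.degree = 0 by omega]; simp

theorem exists_eval {H : MvPowerSeries ι R} (hH : H ∈ coeffFiltration R ι 1) (f : PowerSeries R) :
    ∃ w, ∀ n, w - Polynomial.aeval H (f.trunc n) ∈ coeffFiltration R ι n := by
  apply exists_sub_mem_coeffFiltration
  intro m n hmn
  obtain ⟨g, hg⟩ : Polynomial.X ^ m ∣ f.trunc n - f.trunc m := by
    rw [Polynomial.X_pow_dvd_iff]
    intro d hd
    rw [Polynomial.coeff_sub, PowerSeries.coeff_trunc, PowerSeries.coeff_trunc, if_pos hd,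
      if_pos (hd.trans_le hmn), sub_self]
  rw [← map_sub, hg, map_mul, map_pow, Polynomial.aeval_X]
  exact Ideal.mul_mem_right _ _ (pow_mem_coeffFiltration hH m)

theorem eval_unique {a : ℕ → MvPowerSeries ι R} {w w' : MvPowerSeries ι R}
    (h : ∀ n, w - a n ∈ coeffFiltration R ι n) (h' : ∀ n, w' - a n ∈ coeffFiltration R ι n) :
    w = w' := by
  refine sub_eq_zero.1 (eq_zero_of_forall_mem_coeffFiltration fun n => ?_)
  simpa using Ideal.sub_mem _ (h n) (h' n)

/-- Evaluation of power series at `H`, when the constant coefficient of `H` is in the maximal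
ideal. -/
def evalHom (H : MvPowerSeries ι R) (hH : H ∈ coeffFiltration R ι 1) :
    PowerSeries R →ₐ[R] MvPowerSeries ι R :=
  AlgHom.ofLinearMap
    { toFun := fun f => (exists_eval hH f).choose
      map_add' := fun f g => by
        refine eval_unique (exists_eval hH (f + g)).choose_spec fun n => ?_
        have := Ideal.add_mem _ ((exists_eval hH f).choose_spec n) ((exists_eval hH g).choose_spec n)
        rw [map_add, map_add]
        rwa [add_sub_add_comm]
      map_smul' := fun r f => by
        refine eval_unique (exists_eval hH (r • f)).choose_spec fun n => ?_
        have := Ideal.mul_mem_left _ (algebraMap R _ r) ((exists_eval hH f).choose_spec n)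
        rw [map_smul, map_smul, RingHom.id_apply, ← smul_sub, Algebra.smul_def]
        exact this }
    (by
      refine eval_unique (exists_eval hH 1).choose_spec fun n => ?_
      rcases n with _ | n
      · intro u; simp
      · have : (1 : PowerSeries R).trunc (n + 1) = 1 := by
          simp
        rw [this, map_one, sub_self]; exact Ideal.zero_mem _)
    (fun f g => by
      refine eval_unique (exists_eval hH (f * g)).choose_spec fun n => ?_
      have hf := (exists_eval hH f).choose_spec n
      have hg := (exists_eval hH g).choose_spec n
      obtain ⟨k, hk⟩ : Polynomial.X ^ n ∣ f.trunc n * g.trunc n - (f * g).trunc n := by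
        rw [Polynomial.X_pow_dvd_iff]
        intro d hd
        rw [Polynomial.coeff_sub, PowerSeries.coeff_trunc, if_pos hd,
          PowerSeries.coeff_mul_eq_coeff_trunc_mul_trunc f g hd, ← Polynomial.coe_mul,
          Polynomial.coeff_coe, sub_self]
      have h3 : Polynomial.aeval H (f.trunc n * g.trunc n - (f * g).trunc n) ∈
          coeffFiltration R ι n := by
        rw [hk, map_mul, map_pow, Polynomial.aeval_X]
        exact Ideal.mul_mem_right _ _ (pow_mem_coeffFiltration hH n)
      rw [map_sub, map_mul] at h3
      have := Ideal.add_mem _ (Ideal.add_mem _ (Ideal.mul_mem_right (exists_eval hH g).choose _ hf)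
        (Ideal.mul_mem_left _ (Polynomial.aeval H (f.trunc n)) hg)) h3
      convert this using 1
      simp only [LinearMap.coe_mk, AddHom.coe_mk]
      ring)

theorem evalHom_sub_mem {H : MvPowerSeries ι R} (hH : H ∈ coeffFiltration R ι 1)
    (f : PowerSeries R) (n : ℕ) :
    evalHom H hH f - ∑ k ∈ Finset.range n, PowerSeries.coeff k f • H ^ k ∈
      coeffFiltration R ι n := by
  have h := (exists_eval hH f).choose_spec n
  have : Polynomial.aeval H (f.trunc n) = ∑ k ∈ Finset.range n, PowerSeries.coeff k f • H ^ k := by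
    have ht : f.trunc n = ∑ k ∈ Finset.range n, Polynomial.monomial k (PowerSeries.coeff k f) := by
      ext d
      simp [PowerSeries.coeff_trunc, Polynomial.coeff_monomial]
    rw [ht, map_sum]
    refine Finset.sum_congr rfl fun k _ => ?_
    rw [Polynomial.aeval_monomial, Algebra.smul_def]
  rwa [this] at h

end Evaluation

/-! ### Decay of coefficients -/

section Decay

variable {R : Type*} [CommRing R] [IsLocalRing R] {ι : Type*}

/-- The coefficient of `a` at `u` lies in the `T u`-th power of the maximal ideal. -/
def HasWeight (T : (ι →₀ ℕ) → ℕ) (a : MvPowerSeries ι R) : Prop :=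
  ∀ u, MvPowerSeries.coeff u a ∈ maximalIdeal R ^ T u

theorem HasWeight.mono {T T' : (ι →₀ ℕ) → ℕ} {a : MvPowerSeries ι R} (ha : HasWeight T a)
    (h : ∀ u, T' u ≤ T u) : HasWeight T' a := fun u =>
  Ideal.pow_le_pow_right (h u) (ha u)

theorem HasWeight.add {T : (ι →₀ ℕ) → ℕ} {a b : MvPowerSeries ι R} (ha : HasWeight T a)
    (hb : HasWeight T b) : HasWeight T (a + b) := fun u => by
  rw [map_add]; exact Ideal.add_mem _ (ha u) (hb u)

theorem HasWeight.sum {T : (ι →₀ ℕ) → ℕ} {κ : Type*} {s : Finset κ} {a : κ → MvPowerSeries ι R}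
    (ha : ∀ k ∈ s, HasWeight T (a k)) : HasWeight T (∑ k ∈ s, a k) := fun u => by
  rw [map_sum]; exact Ideal.sum_mem _ fun k hk => ha k hk u

theorem HasWeight.mul {T T₁ T₂ : (ι →₀ ℕ) → ℕ} {a b : MvPowerSeries ι R} (ha : HasWeight T₁ a)
    (hb : HasWeight T₂ b) (h : ∀ v w, T (v + w) ≤ T₁ v + T₂ w) : HasWeight T (a * b) := fun u => by
  classical
  rw [MvPowerSeries.coeff_mul]
  refine Ideal.sum_mem _ fun vw hvw => ?_
  rw [Finset.HasAntidiagonal.mem_antidiagonal] at hvw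
  refine Ideal.pow_le_pow_right ?_ (pow_add (maximalIdeal R) _ _ ▸ Ideal.mul_mem_mul (ha vw.1) (hb vw.2))
  rw [← hvw]
  exact h _ _

theorem HasWeight.smul {T : (ι →₀ ℕ) → ℕ} {n : ℕ} {r : R} {a : MvPowerSeries ι R}
    (hr : r ∈ maximalIdeal R ^ n) (ha : HasWeight T a) : HasWeight (fun u => n + T u) (r • a) :=
  fun u => by
    rw [map_smul, smul_eq_mul, pow_add]; exact Ideal.mul_mem_mul hr (ha u)

theorem hasWeight_zero (a : MvPowerSeries ι R) : HasWeight (fun _ => 0) a := fun u => by simp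

theorem HasWeight.of_forall_sub_mem {T : (ι →₀ ℕ) → ℕ} {w : MvPowerSeries ι R}
    {a : ℕ → MvPowerSeries ι R} (h : ∀ n, w - a n ∈ coeffFiltration R ι n)
    (ha : ∀ n, HasWeight T (a n)) : HasWeight T w := fun u =>
  coeff_mem_of_sub_mem_coeffFiltration h fun n => ha n u

/-- `ord(a_u) ≥ ε |u| + c`. -/
abbrev Decay (ε c : ℝ) (a : MvPowerSeries ι R) : Prop :=
  HasWeight (fun u => ⌈ε * u.degree + c⌉₊) a

theorem ceil_add_le (ε c d : ℝ) (v w : ι →₀ ℕ) :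
    ⌈ε * (v + w).degree + (c + d)⌉₊ ≤ ⌈ε * v.degree + c⌉₊ + ⌈ε * w.degree + d⌉₊ := by
  rw [Nat.ceil_le]
  push_cast [map_add]
  have h1 := Nat.le_ceil (ε * (v.degree : ℝ) + c)
  have h2 := Nat.le_ceil (ε * (w.degree : ℝ) + d)
  linarith

theorem Decay.pow {ε c : ℝ} {a : MvPowerSeries ι R} (ha : Decay ε c a) (k : ℕ) :
    Decay ε (k * c) (a ^ k) := by
  classical
  induction k with
  | zero =>
    intro u
    rw [pow_zero, MvPowerSeries.coeff_one]
    split_ifs with h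
    · subst h; simp
    · exact Ideal.zero_mem _
  | succ k ih =>
    rw [pow_succ]
    refine HasWeight.mul ih ha fun v w => ?_
    have := ceil_add_le ε (k * c) c v w
    rwa [show ((k + 1 : ℕ) : ℝ) * c = k * c + c by push_cast; ring]

theorem Decay.anti {ε ε' c : ℝ} {a : MvPowerSeries ι R} (ha : Decay ε c a) (h : ε' ≤ ε) :
    Decay ε' c a :=
  HasWeight.mono ha fun u => Nat.ceil_mono (by gcongr)

/-- The slope is chosen with `ε |u| ≤ 1/2` whenever `|u| ≤ k`. In that range constant `-1/2` demands
nothing and constant `1/2` demands one factor of `𝔪`. When `ε |u| > 1/2`, the original slope `δ ≥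
2ε` pays for the constant. -/
theorem IsOverconvergent.exists_decay {a : MvPowerSeries ι R} (ha : IsOverconvergent a) :
    ∃ ε : ℝ, 0 < ε ∧ Decay ε (-(1 / 2)) a ∧ (HasWeight (fun _ => 1) a → Decay ε (1 / 2) a) := by
  obtain ⟨δ, hδ, k, h⟩ := ha
  set ε := min (δ / 2) (1 / (2 * (k + 1)))
  have hk : (0 : ℝ) < 2 * (k + 1) := by positivity
  have hε : 0 < ε := lt_min (by positivity) (by positivity)
  have hεδ : ε ≤ δ / 2 := min_le_left _ _
  have hεk : ε * (2 * (k + 1)) ≤ 1 := by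
    rw [← le_div_iff₀ hk]; exact min_le_right _ _
  have big : ∀ u : ι →₀ ℕ, 1 / 2 < ε * u.degree → k < u.degree := by
    intro u hu
    by_contra! hle
    have : (u.degree : ℝ) ≤ k := by exact_mod_cast hle
    nlinarith
  refine ⟨ε, hε, fun u => ?_, fun h1 u => ?_⟩
  · rcases le_or_gt (ε * u.degree) (1 / 2) with hu | hu
    · have : ⌈ε * u.degree + -(1 / 2)⌉₊ = 0 := by rw [Nat.ceil_eq_zero]; linarith
      simp only [this]; simp
    · refine Ideal.pow_le_pow_right (Nat.ceil_mono ?_) (h u (big u hu))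
      have : (0 : ℝ) ≤ u.degree := by positivity
      nlinarith
  · rcases le_or_gt (ε * u.degree) (1 / 2) with hu | hu
    · refine Ideal.pow_le_pow_right ?_ (h1 u)
      rw [Nat.ceil_le]; push_cast; linarith
    · refine Ideal.pow_le_pow_right (Nat.ceil_mono ?_) (h u (big u hu))
      have : (0 : ℝ) ≤ u.degree := by positivity
      nlinarith

theorem Decay.isOverconvergent {ε c : ℝ} {a : MvPowerSeries ι R} (hε : 0 < ε)
    (ha : Decay ε c a) : IsOverconvergent a := by
  refine ⟨ε / 2, by positivity, ⌈-(2 * c / ε)⌉₊, fun u hu => ?_⟩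
  refine Ideal.pow_le_pow_right (Nat.ceil_mono ?_) (ha u)
  have h1 : -(2 * c / ε) < u.degree := (Nat.le_ceil _).trans_lt (by exact_mod_cast hu)
  have h2 : -(2 * c) < u.degree * ε := by
    rwa [← neg_div, div_lt_iff₀ hε] at h1
  linarith

/-- A Hensel type lemma for overconvergent power series. -/
theorem isOverconvergent_of_eq_aeval {V : MvPowerSeries ι R} (hV : HasWeight (fun _ => 1) V)
    (Q : Polynomial (Overconvergent R ι)) (hQ : Polynomial.aeval V Q = V)
    (h0 : HasWeight (fun _ => 1) (Q.coeff 0 : MvPowerSeries ι R))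
    (h1 : HasWeight (fun _ => 1) (Q.coeff 1 : MvPowerSeries ι R)) : IsOverconvergent V := by
  -- One slope that serves all of the finitely many coefficients of `Q`.
  obtain ⟨ε, hε, hd⟩ : ∃ ε : ℝ, 0 < ε ∧ ∀ j < Q.natDegree + 1,
      Decay ε (-(1 / 2)) (Q.coeff j : MvPowerSeries ι R) ∧
      (HasWeight (fun _ => 1) (Q.coeff j : MvPowerSeries ι R) →
        Decay ε (1 / 2) (Q.coeff j : MvPowerSeries ι R)) := by
    induction Q.natDegree + 1 with
    | zero => exact ⟨1, one_pos, by simp⟩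
    | succ n ih =>
      obtain ⟨ε, hε, h⟩ := ih
      obtain ⟨δ, hδ, h', h''⟩ := (Q.coeff n).2.exists_decay
      refine ⟨min ε δ, lt_min hε hδ, fun j hj => ?_⟩
      rcases Nat.lt_succ_iff_lt_or_eq.1 hj with hj | rfl
      · exact ⟨(h j hj).1.anti (min_le_left _ _), fun hw => ((h j hj).2 hw).anti (min_le_left _ _)⟩
      · exact ⟨h'.anti (min_le_right _ _), fun hw => (h'' hw).anti (min_le_right _ _)⟩
  -- Bootstrapping through `V = Q(V)`: the bound truncated at `N + 1` yields the one truncated at `N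
  -- + 2`. The constant term has the full bound; the linear coefficient is divisible by `𝔪` and
  -- gains one; in the other terms the coefficient loses `1/2`, while `V^j` with `j ≥ 2` has
  -- constant `1` and gains one since every factor has weight at least `1`.
  have key : ∀ N : ℕ, HasWeight (fun u => min (N + 1) ⌈ε * u.degree + 1 / 2⌉₊) V := by
    intro N
    induction N with
    | zero => exact hV.mono fun u => by simp
    | succ N ih =>
      have hpow : ∀ j : ℕ, HasWeight (fun u => min (N + 2) ⌈ε * u.degree + 1⌉₊) (V ^ (j + 2)) := by
        intro j
        induction j with
        | zero =>
          rw [zero_add, sq]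
          refine HasWeight.mul ih ih fun v w => ?_
          have h3 := ceil_add_le ε (1 / 2) (1 / 2) v w
          rw [add_halves] at h3
          have h4 : 1 ≤ ⌈ε * v.degree + 1 / 2⌉₊ := Nat.one_le_ceil_iff.2 (by positivity)
          have h5 : 1 ≤ ⌈ε * w.degree + 1 / 2⌉₊ := Nat.one_le_ceil_iff.2 (by positivity)
          omega
        | succ j ihj =>
          rw [show j + 1 + 2 = (j + 2) + 1 by ring, pow_succ]
          refine HasWeight.mul ihj ih fun v w => ?_
          have h3 := ceil_add_le ε 1 (1 / 2) v w
          have h3' : ⌈ε * (v + w).degree + 1⌉₊ ≤ ⌈ε * (v + w).degree + (1 + 1 / 2)⌉₊ :=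
            Nat.ceil_mono (by linarith)
          have h4 : 1 ≤ ⌈ε * v.degree + 1⌉₊ := Nat.one_le_ceil_iff.2 (by positivity)
          have h5 : 1 ≤ ⌈ε * w.degree + 1 / 2⌉₊ := Nat.one_le_ceil_iff.2 (by positivity)
          omega
      rw [← hQ, Polynomial.aeval_eq_sum_range]
      refine HasWeight.sum fun j hj => ?_
      rw [Finset.mem_range] at hj
      rw [Subalgebra.smul_def, smul_eq_mul]
      match j, hj with
      | 0, hj =>
        rw [pow_zero, mul_one]
        exact ((hd 0 hj).2 h0).mono fun u => min_le_right _ _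
      | 1, hj =>
        rw [pow_one]
        refine HasWeight.mul ((hd 1 hj).2 h1) ih fun v w => ?_
        have h3 := ceil_add_le ε (1 / 2) (1 / 2) v w
        have h3' : ⌈ε * (v + w).degree + 1 / 2⌉₊ ≤ ⌈ε * (v + w).degree + (1 / 2 + 1 / 2)⌉₊ :=
          Nat.ceil_mono (by linarith)
        have h4 : 1 ≤ ⌈ε * v.degree + 1 / 2⌉₊ := Nat.one_le_ceil_iff.2 (by positivity)
        omega
      | j + 2, hj =>
        refine HasWeight.mul (hd _ hj).1 (hpow j) fun v w => ?_
        have h3 := ceil_add_le ε (-(1 / 2)) 1 v w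
        rw [show (-(1 / 2) + 1 : ℝ) = 1 / 2 by norm_num] at h3
        omega
  -- For a given `u` it is enough to take `N` as large as the desired exponent, so that the
  -- truncation disappears.
  refine Decay.isOverconvergent (c := 1 / 2) hε fun u => ?_
  exact Ideal.pow_le_pow_right (by simp) (key ⌈ε * u.degree + 1 / 2⌉₊ u)

theorem hasWeight_one_iff {a : MvPowerSeries ι R} :
    HasWeight (fun _ => 1) a ↔ MvPowerSeries.map (residue R) a = 0 := by
  rw [MvPowerSeries.ext_iff]
  simp [HasWeight, MvPowerSeries.coeff_map, residue_eq_zero_iff]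

/-- The overconvergent series with all coefficients in the `n`-th power of the maximal ideal. -/
def weightIdeal (R : Type*) [CommRing R] [IsLocalRing R] (ι : Type*) (n : ℕ) :
    Ideal (Overconvergent R ι) where
  carrier := {a | HasWeight (fun _ => n) (a : MvPowerSeries ι R)}
  add_mem' ha hb := HasWeight.add ha hb
  zero_mem' u := by simp
  smul_mem' c _ ha := HasWeight.mul (hasWeight_zero (c : MvPowerSeries ι R)) ha (by simp)

theorem map_maximalIdeal_le_weightIdeal :
    (maximalIdeal R).map (algebraMap R (Overconvergent R ι)) ≤ weightIdeal R ι 1 := by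
  rw [Ideal.map_le_iff_le_comap]
  intro r hr u
  classical
  change MvPowerSeries.coeff u (algebraMap R (MvPowerSeries ι R) r) ∈ _
  rw [MvPowerSeries.algebraMap_apply, MvPowerSeries.coeff_C]
  split_ifs
  · simpa using hr
  · exact Ideal.zero_mem _

/-- Coefficients may be divided by `π^n` one at a time: the quotient stays overconvergent because
only the constant in the decay estimate drops, by `n`, while the slope is kept. -/
theorem mem_map_pow_of_hasWeight {R : Type*} [CommRing R] [IsDomain R]
    [IsDiscreteValuationRing R] {ι : Type*} {n : ℕ} {a : Overconvergent R ι} (ha : HasWeight (fun _ => n) (a : MvPowerSeries ι R)) :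
    a ∈ (maximalIdeal R ^ n).map (algebraMap R (Overconvergent R ι)) := by
  obtain ⟨π, hπ⟩ := IsDiscreteValuationRing.exists_irreducible R
  have hm := hπ.maximalIdeal_eq
  simp only [HasWeight, hm, Ideal.span_singleton_pow, Ideal.mem_span_singleton] at ha
  choose b hb using ha
  have hov : IsOverconvergent (fun u => b u : MvPowerSeries ι R) := by
    obtain ⟨ε, hε, hd, -⟩ := a.2.exists_decay
    refine Decay.isOverconvergent (ε := ε) (c := -(1 / 2) - n) hε fun u => ?_
    have h1 := hd u
    simp only [hm, Ideal.span_singleton_pow, Ideal.mem_span_singleton] at h1 ⊢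
    rw [hb u] at h1
    change π ^ _ ∣ b u
    have hceil : ⌈ε * u.degree + (-(1 / 2) - n)⌉₊ = ⌈ε * u.degree + -(1 / 2)⌉₊ - n := by
      rw [← Nat.ceil_sub_natCast]; congr 1; ring
    rw [hceil]
    rcases le_total n ⌈ε * u.degree + -(1 / 2)⌉₊ with hn | hn
    · refine (mul_dvd_mul_iff_left (pow_ne_zero n hπ.ne_zero)).1 (dvd_trans ?_ h1)
      rw [← pow_add, Nat.add_sub_cancel' hn]
    · rw [Nat.sub_eq_zero_of_le hn, pow_zero]
      exact one_dvd _
  let b' : MvPowerSeries ι R := fun u => b u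
  have : a = algebraMap R _ (π ^ n) * (⟨b', hov⟩ : Overconvergent R ι) := by
    refine Subtype.ext (MvPowerSeries.ext fun u => ?_)
    rw [hb u]
    change _ = MvPowerSeries.coeff u (algebraMap R (MvPowerSeries ι R) (π ^ n) * b')
    rw [MvPowerSeries.algebraMap_apply, MvPowerSeries.coeff_C_mul]
    rfl
  rw [this]
  exact Ideal.mul_mem_right _ _ (Ideal.mem_map_of_mem _ (by
    rw [hm]; exact Ideal.pow_mem_pow (Ideal.mem_span_singleton_self π) n))

end Decay

/-! ### The exponential `exp(π (G - σ G))` is overconvergent -/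

section Splitting

variable {R : Type*} [CommRing R] [IsDomain R] [IsDiscreteValuationRing R] [CharZero R]
  [IsAdicComplete (maximalIdeal R) R] [Finite (ResidueField R)]
  {p : ℕ} [Fact p.Prime] [CharP (ResidueField R) p] {ι : Type*}

variable {πs : R} (hπs : πs ^ (p - 1) = -(p : R))

/-- `π^k / k!`. -/
def expCoeff' (k : ℕ) : R := (if k = 0 then 1 else 0) + πs * expCoeff πs hπs k

theorem expCoeff'_mul (k : ℕ) : expCoeff' hπs k * (k.factorial : R) = πs ^ k := by
  rcases k with _ | k
  · simp [expCoeff', expCoeff]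
  · rw [expCoeff', if_neg k.succ_ne_zero, zero_add, mul_assoc, expCoeff_succ_mul, pow_succ']

theorem expCoeff'_zero : expCoeff' hπs 0 = 1 := by simp [expCoeff', expCoeff]

theorem natCast_prime_mem : (p : R) ∈ maximalIdeal R :=
  (natCast_mem_maximalIdeal_iff (p := p) p).2 dvd_rfl

/-- The series `(exp(p π* t) - 1) / (p π*)` begins with `t`, and its terms of degree `k ≥ 2` contain
`p^(k-1)`. -/
theorem hasWeight_evalHom_expSeriesP_sub {H : MvPowerSeries ι R} (hH : H ∈ coeffFiltration R ι 1) :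
    HasWeight (fun _ => 1) (evalHom H hH (expSeriesP hπs) - H) := by
  refine HasWeight.of_forall_sub_mem (a := fun n => ∑ k ∈ Finset.range n,
    PowerSeries.coeff (k + 2) (expSeriesP hπs) • H ^ (k + 2)) (fun n => ?_) (fun n => ?_)
  · have h := coeffFiltration_antitone (show n ≤ n + 2 by omega)
      (evalHom_sub_mem hH (expSeriesP hπs) (n + 2))
    rw [Finset.sum_range_succ', Finset.sum_range_succ'] at h
    convert h using 1
    simp [expSeriesP, expCoeff]
    ring
  · refine HasWeight.sum fun k _ => ?_
    refine (HasWeight.smul (n := 1) ?_ (hasWeight_zero _)).mono (by simp)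
    rw [pow_one, expSeriesP, PowerSeries.coeff_mk]
    exact Ideal.mul_mem_left _ _ (Ideal.pow_mem_of_mem _ natCast_prime_mem _ (by simp))

/-- The power `H^k` loses `k/2` in the decay estimate while its coefficient gains `k - 1`. For `k ≥
1` the balance is at least `-1/2`, uniformly in `k`. -/
theorem isOverconvergent_evalHom_expSeriesP {H : MvPowerSeries ι R}
    (hH : H ∈ coeffFiltration R ι 1) (hov : IsOverconvergent H) :
    IsOverconvergent (evalHom H hH (expSeriesP hπs)) := by
  obtain ⟨ε, hε, hd, -⟩ := hov.exists_decay
  refine Decay.isOverconvergent (c := -(1 / 2)) hε ?_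
  refine HasWeight.of_forall_sub_mem (evalHom_sub_mem hH _) fun n => HasWeight.sum fun k _ => ?_
  rw [expSeriesP, PowerSeries.coeff_mk]
  rcases k with _ | k
  · intro u; simp [expCoeff]
  · have hmem : expCoeff πs hπs (k + 1) * (p : R) ^ (k + 1 - 1) ∈ maximalIdeal R ^ k := by
      rw [Nat.add_sub_cancel]
      exact Ideal.mul_mem_left _ _ (Ideal.pow_mem_pow natCast_prime_mem _)
    refine (HasWeight.smul hmem (hd.pow (k + 1))).mono fun u => ?_
    rw [Nat.ceil_le]
    push_cast
    have := Nat.le_ceil (ε * (u.degree : ℝ) + (k + 1) * -(1 / 2))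
    have hk : (0 : ℝ) ≤ k := by positivity
    linarith

theorem one_add_mul_evalHom_pow {H : MvPowerSeries ι R} (hH : H ∈ coeffFiltration R ι 1) :
    (1 + πs • evalHom H hH (expSeries hπs)) ^ p =
      1 + (p * πs : R) • evalHom H hH (expSeriesP hπs) := by
  have := congrArg (evalHom H hH) (one_add_mul_expSeries_pow hπs)
  simp only [← PowerSeries.algebraMap_eq] at this
  rw [map_pow, map_add, map_add, map_one, ← Algebra.smul_def, ← Algebra.smul_def, map_smul,
    map_smul] at this
  exact this

theorem isExp_evalHom {H : MvPowerSeries ι R} (hH : H ∈ coeffFiltration R ι 1) :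
    IsExp πs H (1 + πs • evalHom H hH (expSeries hπs)) := by
  intro u N
  have hE : 1 + πs • evalHom H hH (expSeries hπs) =
      evalHom H hH (PowerSeries.mk (expCoeff' hπs)) := by
    have : PowerSeries.mk (expCoeff' hπs) = 1 + πs • expSeries hπs := by
      ext k; simp [expCoeff', expSeries, PowerSeries.coeff_one]
    rw [this, map_add, map_one, map_smul]
  -- The filtration loses `|u|` at the monomial `u`, whence the extra terms.
  refine ⟨N + u.degree, fun m hm => ⟨_, Ideal.pow_le_pow_right (by omega)
    (evalHom_sub_mem hH (PowerSeries.mk (expCoeff' hπs)) m u), ?_⟩⟩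
  rw [hE, map_sub, map_sub, map_sum, map_sum]
  congr 1
  refine Finset.sum_congr rfl fun j _ => ?_
  haveI : CharZero (FractionRing R) :=
    charZero_of_injective_algebraMap (IsFractionRing.injective R (FractionRing R))
  have h0 : (j.factorial : FractionRing R) ≠ 0 := by exact_mod_cast j.factorial_ne_zero
  rw [div_eq_iff h0, ← expCoeff'_mul hπs j, PowerSeries.coeff_mk, map_smul, smul_eq_mul]
  simp only [map_mul, map_natCast]
  ring

/-- The `k`-th term of `exp(p π* H)` contains `p^k`. The partial sums of the `p`-th power therefore
converge uniformly over all monomials, which the exponential itself is not claimed to do; this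
uniformity allows evaluation at points. -/
theorem hasWeight_pow_sub {H : MvPowerSeries ι R} (hH : H ∈ coeffFiltration R ι 1) (n : ℕ) :
    HasWeight (fun _ => n) ((1 + πs • evalHom H hH (expSeries hπs)) ^ p -
      ∑ k ∈ Finset.range n, (expCoeff' hπs k * (p : R) ^ k) • H ^ k) := by
  have hE : (1 + πs • evalHom H hH (expSeries hπs)) ^ p =
      evalHom H hH (PowerSeries.mk fun k => expCoeff' hπs k * (p : R) ^ k) := by
    have : (PowerSeries.mk fun k => expCoeff' hπs k * (p : R) ^ k) =
        1 + (p * πs : R) • expSeriesP hπs := by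
      ext k
      rcases k with _ | k
      · simp [expCoeff', expSeriesP, expCoeff]
      · simp [expCoeff', expSeriesP, PowerSeries.coeff_one]
        ring
    rw [this, map_add, map_one, map_smul, one_add_mul_evalHom_pow]
  rw [hE]
  refine HasWeight.of_forall_sub_mem (a := fun j => ∑ k ∈ Finset.range j,
    (expCoeff' hπs (n + k) * (p : R) ^ (n + k)) • H ^ (n + k)) (fun j => ?_) (fun j => ?_)
  · have h := coeffFiltration_antitone (show j ≤ n + j by omega)
      (evalHom_sub_mem hH (PowerSeries.mk fun k => expCoeff' hπs k * (p : R) ^ k) (n + j))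
    rw [Finset.sum_range_add] at h
    convert h using 1
    simp only [PowerSeries.coeff_mk]
    ring
  · refine HasWeight.sum fun k _ => ?_
    refine (HasWeight.smul (n := n) ?_ (hasWeight_zero _)).mono (by simp)
    exact Ideal.mul_mem_left _ _ (Ideal.pow_le_pow_right (by omega)
      (Ideal.pow_mem_pow natCast_prime_mem _))

/-- Overconvergence of the splitting function `exp(π (G - σ G))`, which is `1 + π W` with
`W ≡ ∑ G^(p^i)`. -/
theorem exists_splitting (σ : Overconvergent R ι →ₐ[R] Overconvergent R ι) (hσ : IsFrobeniusLift σ)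
    {a : ℕ} (ha : Nat.card (ResidueField R) = p ^ a) (G : Overconvergent R ι)
    (hG : MvPowerSeries.constantCoeff (G : MvPowerSeries ι R) = 0) :
    ∃ W : Overconvergent R ι,
      IsExp πs ((G - σ G : Overconvergent R ι) : MvPowerSeries ι R)
        ((1 + πs • W : Overconvergent R ι) : MvPowerSeries ι R) ∧
      W - ∑ i ∈ Finset.range a, G ^ p ^ i ∈
        (maximalIdeal R).map (algebraMap R (Overconvergent R ι)) ∧
      ∀ n, (1 + πs • W) ^ p - ∑ k ∈ Finset.range n,
        (expCoeff' hπs k * (p : R) ^ k) • (G - σ G) ^ k ∈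
          (maximalIdeal R ^ n).map (algebraMap R (Overconvergent R ι)) := by
  set H : Overconvergent R ι := G - σ G with hHdef
  have hHG : HasWeight (fun _ => 1) ((H - (G - G ^ p ^ a) : Overconvergent R ι) :
      MvPowerSeries ι R) := by
    have := map_maximalIdeal_le_weightIdeal (hσ G)
    rw [ha] at this
    have h2 := (weightIdeal R ι 1).neg_mem this
    rw [hHdef, show G - σ G - (G - G ^ p ^ a) = -(σ G - G ^ p ^ a) by ring]
    exact h2
  -- `G` has no constant term and `σ G ≡ G^q`, so the constant term of `H` lies in `𝔪`, although it
  -- need not vanish.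
  have hH : (H : MvPowerSeries ι R) ∈ coeffFiltration R ι 1 := by
    rw [mem_coeffFiltration_one]
    have h := hHG 0
    have hpa : p ^ a ≠ 0 := (pow_pos (Fact.out : p.Prime).pos a).ne'
    rw [pow_one, MvPowerSeries.coeff_zero_eq_constantCoeff_apply] at h
    push_cast at h
    rw [map_sub, map_sub, map_pow, hG, zero_pow hpa, sub_zero, sub_zero] at h
    exact h
  obtain ⟨g, -, hg⟩ := exists_expSeries_eq hπs
  set W := evalHom (H : MvPowerSeries ι R) hH (expSeries hπs) with hW
  set W' := evalHom (H : MvPowerSeries ι R) hH (expSeriesP hπs) with hW'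
  have hov' : IsOverconvergent W' := isOverconvergent_evalHom_expSeriesP hπs hH H.2
  have heq : W = W ^ p + πs • (W ^ 2 * Polynomial.aeval W g) + W' := by
    have h := congrArg (evalHom (H : MvPowerSeries ι R) hH) hg
    simp only [← PowerSeries.algebraMap_eq] at h
    rw [mul_assoc, ← Algebra.smul_def] at h
    simpa only [map_add, map_smul, map_mul, map_pow, ← Polynomial.aeval_algHom_apply] using h
  let W₀ : Overconvergent R ι := ∑ i ∈ Finset.range a, G ^ p ^ i
  let ρ := MvPowerSeries.map (σ := ι) (residue R)
  have hρπ : ρ (algebraMap R _ πs) = 0 := by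
    rw [← hasWeight_one_iff]
    exact map_maximalIdeal_le_weightIdeal (R := R) (ι := ι)
      (Ideal.mem_map_of_mem _ (mem_maximalIdeal_of_pow_eq hπs))
  haveI : CharP (MvPowerSeries ι (ResidueField R)) p :=
    charP_of_injective_algebraMap (R := ResidueField R) (by
      intro x y hxy
      simpa [MvPowerSeries.algebraMap_apply] using hxy) p
  have hρW' : ρ W' = ρ (G : MvPowerSeries ι R) - ρ (G : MvPowerSeries ι R) ^ p ^ a := by
    have h1 := hasWeight_one_iff.1 (hasWeight_evalHom_expSeriesP_sub hπs hH)
    have h2 := hasWeight_one_iff.1 hHG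
    rw [map_sub, sub_eq_zero] at h1
    push_cast at h2
    rw [map_sub, map_sub, map_pow, sub_eq_zero] at h2
    exact h1.trans h2
  have hρW₀ : ρ (W₀ : MvPowerSeries ι R) - ρ (W₀ : MvPowerSeries ι R) ^ p =
      ρ (G : MvPowerSeries ι R) - ρ (G : MvPowerSeries ι R) ^ p ^ a := by
    have : ρ (W₀ : MvPowerSeries ι R) =
        ∑ i ∈ Finset.range a, ρ (G : MvPowerSeries ι R) ^ p ^ i := by
      simp [W₀, map_sum]
    rw [this, sum_pow_char, ← Finset.sum_sub_distrib]
    have h3 := Finset.sum_range_sub' (fun i => ρ (G : MvPowerSeries ι R) ^ p ^ i) a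
    simpa [pow_succ, pow_mul] using h3
  have hρW : ρ W - ρ W ^ p = ρ (G : MvPowerSeries ι R) - ρ (G : MvPowerSeries ι R) ^ p ^ a := by
    have h := congrArg ρ heq
    rw [Algebra.smul_def, map_add, map_add, map_mul, hρπ, zero_mul, add_zero, hρW', map_pow] at h
    linear_combination h
  -- Modulo `𝔪` both `W` and `W₀` solve `w - w^p = G - G^q`, so their difference satisfies `δ^p =
  -- δ`, that is `δ (δ^(p-1) - 1) = 0` in a domain. Since `δ` has no constant term, the second
  -- factor is nonzero.
  have hV : HasWeight (fun _ => 1) (W - (W₀ : MvPowerSeries ι R)) := by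
    rw [hasWeight_one_iff]
    set δ := ρ (W - (W₀ : MvPowerSeries ι R)) with hδ
    have hδp : δ ^ p = δ := by
      rw [hδ, map_sub, sub_pow_char]
      linear_combination hρW₀ - hρW
    have hδ0 : MvPowerSeries.constantCoeff δ = 0 := by
      have h1 := evalHom_sub_mem hH (expSeries hπs) 1
      rw [mem_coeffFiltration_one, Finset.sum_range_one, expSeries, PowerSeries.coeff_mk,
        show expCoeff πs hπs 0 = 0 from rfl, zero_smul, sub_zero] at h1
      have h2 : MvPowerSeries.constantCoeff (W₀ : MvPowerSeries ι R) = 0 := by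
        push_cast [W₀]
        rw [map_sum]
        refine Finset.sum_eq_zero fun i _ => ?_
        rw [map_pow, hG, zero_pow (pow_pos (Fact.out : p.Prime).pos i).ne']
      rw [hδ, MvPowerSeries.constantCoeff_map, map_sub, h2, sub_zero]
      exact (residue_eq_zero_iff _).2 h1
    have hp1 : p - 1 + 1 = p := Nat.sub_add_cancel (Fact.out : p.Prime).one_le
    have hmul : δ * (δ ^ (p - 1) - 1) = 0 := by
      rw [mul_sub, ← pow_succ', hp1, hδp, mul_one, sub_self]
    refine (mul_eq_zero.1 hmul).resolve_right fun h => ?_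
    have := congrArg MvPowerSeries.constantCoeff h
    rw [map_sub, map_pow, hδ0, zero_pow (sub_one_pos_of_prime p).ne'] at this
    simp at this
  have hovW : IsOverconvergent W := by
    -- `W` is a fixed point of `P`. Expanding at the overconvergent approximation `W₀` gives an
    -- equation for `W - W₀` of the Hensel type: its constant term vanishes modulo `𝔪` by the
    -- equation for `W₀`, its linear term because `P' ≡ p X^(p-1)` modulo `π*`.
    let P : Polynomial (Overconvergent R ι) := Polynomial.X ^ p
      + Polynomial.C (algebraMap R _ πs) * (Polynomial.X ^ 2 * g.map (algebraMap R _)) + Polynomial.C ⟨W', hov'⟩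
    have hP : ∀ v : MvPowerSeries ι R, Polynomial.aeval v P =
        v ^ p + πs • (v ^ 2 * Polynomial.aeval v g) + W' := by
      intro v
      simp only [P, map_add, map_mul, map_pow, Polynomial.aeval_X, Polynomial.aeval_C,
        Polynomial.aeval_map_algebraMap, Algebra.smul_def]
      rfl
    have hV' : IsOverconvergent (W - (W₀ : MvPowerSeries ι R)) := by
      refine isOverconvergent_of_eq_aeval hV (Polynomial.taylor W₀ P - Polynomial.C W₀) ?_ ?_ ?_
      · refine (map_sub (Polynomial.aeval (R := Overconvergent R ι) (W - (W₀ : MvPowerSeries ι R))) _ _).trans ?_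
        have hX : Polynomial.aeval (R := Overconvergent R ι) (W - (W₀ : MvPowerSeries ι R))
            (Polynomial.X + Polynomial.C W₀) = W := by
          rw [map_add, Polynomial.aeval_X, Polynomial.aeval_C]
          exact sub_add_cancel W _
        rw [Polynomial.taylor_apply, Polynomial.aeval_comp, hX, hP, ← heq, Polynomial.aeval_C]
        rfl
      · rw [Polynomial.coeff_sub, Polynomial.taylor_coeff_zero, Polynomial.coeff_C_zero,
          hasWeight_one_iff]
        have h1 : ((P.eval W₀ : Overconvergent R ι) : MvPowerSeries ι R) =
            Polynomial.aeval (W₀ : MvPowerSeries ι R) P :=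
          (Polynomial.aeval_algebraMap_apply_eq_algebraMap_eval W₀ P).symm
        push_cast
        rw [h1, hP]
        change ρ _ = 0
        rw [Algebra.smul_def, map_sub, map_add, map_add, map_mul, hρπ, zero_mul, add_zero, hρW',
          map_pow, ← hρW₀]
        ring
      · rw [Polynomial.coeff_sub, Polynomial.taylor_coeff_one, Polynomial.coeff_C_of_ne_zero one_ne_zero,
          sub_zero]
        have hI : ∀ r ∈ maximalIdeal R, algebraMap R (Overconvergent R ι) r ∈ weightIdeal R ι 1 :=
          fun r hr => map_maximalIdeal_le_weightIdeal (Ideal.mem_map_of_mem _ hr)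
        change P.derivative.eval W₀ ∈ weightIdeal R ι 1
        simp only [P, Polynomial.derivative_add, Polynomial.derivative_X_pow,
          Polynomial.derivative_C_mul, Polynomial.derivative_C, add_zero, Polynomial.eval_add,
          Polynomial.eval_mul, Polynomial.eval_C]
        refine Ideal.add_mem _ (Ideal.mul_mem_right _ _ ?_)
          (Ideal.mul_mem_right _ _ (hI _ (mem_maximalIdeal_of_pow_eq hπs)))
        rw [← map_natCast (algebraMap R (Overconvergent R ι))]
        exact hI _ natCast_prime_mem
    simpa using hV'.add W₀.2
  refine ⟨⟨W, hovW⟩, isExp_evalHom hπs hH, ?_, fun n => ?_⟩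
  · have := mem_map_pow_of_hasWeight (n := 1) (a := ⟨W, hovW⟩ - W₀) hV
    rwa [pow_one] at this
  · refine mem_map_pow_of_hasWeight ?_
    have := hasWeight_pow_sub hπs hH n
    convert this using 1
    push_cast
    simp [hW]

end Splitting

/-! ### The unramified extensions -/

section Complete

universe u

/-- For finite modules over a noetherian ring, completion is tensoring with the completed ring, here
`R` itself. -/
theorem isAdicComplete_of_finite {R : Type u} [CommRing R] [IsNoetherianRing R] (I : Ideal R)
    [IsAdicComplete I R] (M : Type u) [AddCommGroup M] [Module R M] [Module.Finite R M] :
    IsAdicComplete I M := by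
  rw [← AdicCompletion.of_bijective_iff]
  let e : M ≃ₗ[R] AdicCompletion I R ⊗[R] M :=
    (TensorProduct.lid R M).symm ≪≫ₗ LinearEquiv.rTensor M (AdicCompletion.ofLinearEquiv I R)
  have h : ⇑(AdicCompletion.of I M) = ⇑(AdicCompletion.ofTensorProduct I M) ∘ ⇑e := by
    funext x
    have h1 : e x = (1 : AdicCompletion I R) ⊗ₜ[R] x := by
      simp only [e, LinearEquiv.trans_apply, TensorProduct.lid_symm_apply,
        LinearEquiv.rTensor_tmul]
      rfl
    rw [Function.comp_apply, h1, AdicCompletion.ofTensorProduct_tmul, one_smul]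
  rw [h]
  exact (AdicCompletion.ofTensorProduct_bijective_of_finite_of_isNoetherian I M).comp e.bijective

theorem exists_generator_of_finite_field (ℓ : Type*) [Field ℓ] [Finite ℓ] :
    ∃ α : ℓ, orderOf α = Nat.card ℓ - 1 ∧ ∀ x : ℓ, x ≠ 0 → ∃ n : ℕ, x = α ^ n := by
  obtain ⟨g, hg⟩ := IsCyclic.exists_generator (α := ℓˣ)
  refine ⟨g, ?_, fun x hx => ?_⟩
  · rw [orderOf_units, orderOf_eq_card_of_forall_mem_zpowers hg, Nat.card_units]
  · obtain ⟨n, hn⟩ := mem_powers_iff_mem_zpowers.2 (hg (Units.mk0 x hx))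
    exact ⟨n, by simpa using congrArg Units.val hn.symm⟩

end Complete

section Unramified

universe u

variable {R : Type u} [CommRing R] [IsDomain R] [IsDiscreteValuationRing R]
  [IsAdicComplete (maximalIdeal R) R] [Finite (ResidueField R)]

variable (R) in
/-- A model of the unramified extension of degree `d` with its residue field. -/
theorem exists_unramified_model (d : ℕ) [NeZero d] :
    ∃ (S : Type u) (_ : CommRing S) (_ : IsDomain S) (_ : Algebra R S) (_ : Module.Finite R S)
      (_ : Module.IsTorsionFree R S)
      (ℓ : Type) (_ : Field ℓ) (_ : Algebra R ℓ) (θ : S →ₐ[R] ℓ),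
      Nat.card ℓ = Nat.card (ResidueField R) ^ d ∧
      Function.Surjective θ ∧ RingHom.ker θ = (maximalIdeal R).map (algebraMap R S) := by
  obtain ⟨p, hp⟩ := CharP.exists (ResidueField R)
  haveI : Fact p.Prime := ⟨CharP.char_is_prime (ResidueField R) p⟩
  let k := ResidueField R
  let ℓ := FiniteField.Extension k p d
  letI : Algebra R ℓ := ((algebraMap k ℓ).comp (residue R)).toAlgebra
  haveI : IsScalarTower R k ℓ := IsScalarTower.of_algebraMap_eq' rfl
  obtain ⟨α, -, hα⟩ := exists_generator_of_finite_field ℓ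
  have hint : IsIntegral k α := Algebra.IsIntegral.isIntegral α
  -- The model is `R[X]/(h)`, with `h` a monic lift of the minimal polynomial of a generator of
  -- `ℓˣ`. Irreducibility of the reduction makes `h` irreducible, hence prime as `R[X]` is
  -- factorial.
  obtain ⟨h, hmap, -, hmonic⟩ := Polynomial.lifts_and_natDegree_eq_and_monic
    (Polynomial.mem_lifts_of_surjective (residue_surjective (R := R)) (minpoly k α))
    (minpoly.monic hint)
  have hirr : Irreducible h := Polynomial.Monic.irreducible_of_irreducible_map (residue R) h hmonic
    (hmap ▸ minpoly.irreducible hint)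
  have haeval : ∀ f : Polynomial R,
      Polynomial.aeval α f = Polynomial.aeval α (f.map (residue R)) := fun f =>
    (Polynomial.aeval_map_algebraMap k α f).symm
  have hroot : Polynomial.eval₂ (Algebra.ofId R ℓ : R →+* ℓ) α h = 0 := by
    change Polynomial.aeval α h = 0
    rw [haeval, hmap, minpoly.aeval]
  haveI : IsDomain (AdjoinRoot h) := AdjoinRoot.isDomain_of_prime hirr.prime
  haveI := hmonic.free_adjoinRoot
  refine ⟨AdjoinRoot h, inferInstance, inferInstance, inferInstance, hmonic.finite_adjoinRoot,
    inferInstance, ℓ, inferInstance, inferInstance,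
    AdjoinRoot.liftAlgHom h (Algebra.ofId R ℓ) α hroot, FiniteField.natCard_extension k p d, ?_, ?_⟩
  · intro x
    by_cases hx : x = 0
    · exact ⟨0, by rw [hx, map_zero]⟩
    · obtain ⟨n, rfl⟩ := hα x hx
      exact ⟨AdjoinRoot.root h ^ n, by simp⟩
  · refine le_antisymm (fun x hx => ?_) ?_
    · obtain ⟨f, rfl⟩ := AdjoinRoot.mk_surjective x
      have hf : Polynomial.aeval α f = 0 := by
        simpa [Polynomial.aeval_def] using hx
      rw [haeval] at hf
      obtain ⟨g, hg⟩ := minpoly.dvd k α hf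
      obtain ⟨g', rfl⟩ := Polynomial.map_surjective _ (residue_surjective (R := R)) g
      -- A polynomial vanishing at `α` is, modulo `𝔪`, a multiple of the minimal polynomial, hence
      -- congruent to a multiple of `h`.
      have hmem : f - h * g' ∈ (maximalIdeal R).map Polynomial.C := by
        rw [← ker_residue, ← Polynomial.ker_mapRingHom, RingHom.mem_ker]
        simp [hg, hmap]
      have h2 : AdjoinRoot.mk h f = AdjoinRoot.mk h (f - h * g') := by simp
      rw [h2]
      have h3 := Ideal.mem_map_of_mem (AdjoinRoot.mk h) hmem
      rwa [Ideal.map_map] at h3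
    · rw [Ideal.map_le_iff_le_comap]
      intro r hr
      rw [Ideal.mem_comap, RingHom.mem_ker, AlgHom.commutes,
        IsScalarTower.algebraMap_apply R k ℓ, ResidueField.algebraMap_eq,
        (residue_eq_zero_iff r).2 hr, map_zero]

/-- The abstract model is transported into `KBar R`. By Hensel a generator of `ℓˣ` lifts to a
primitive `(q^d - 1)`-th root of unity `a`; by Nakayama `a` generates the model over `R`; and an
embedding into `KBar R` has image `R_d`, since every `(q^d - 1)`-th root of unity there is a power
of the image of `a`. -/
theorem exists_reduction_unramified [CharZero R] (d : ℕ) [NeZero d] :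
    Module.Finite R (Unramified R d) ∧
    ∃ (ℓ : Type) (_ : Field ℓ) (_ : Algebra R ℓ) (θ : Unramified R d →ₐ[R] ℓ),
      Nat.card ℓ = Nat.card (ResidueField R) ^ d ∧ Function.Surjective θ ∧
      RingHom.ker θ = (maximalIdeal R).map (algebraMap R (Unramified R d)) := by
  obtain ⟨S, _, _, _, hfin, htf, ℓ, _, _, θ, hcard, hsurj, hker⟩ := exists_unramified_model R d
  have hq : 1 < Nat.card (ResidueField R) ^ d :=
    one_lt_pow₀ (Finite.one_lt_card) (NeZero.ne d)
  haveI : Finite ℓ := Nat.finite_of_card_ne_zero (by omega)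
  letI := Fintype.ofFinite ℓ
  set N := Nat.card (ResidueField R) ^ d - 1 with hN
  haveI : NeZero N := ⟨by omega⟩
  haveI := isAdicComplete_of_finite (maximalIdeal R) S
  haveI hc : IsAdicComplete ((maximalIdeal R).map (algebraMap R S)) S :=
    (IsAdicComplete.map_algebraMap_iff _ _).2 this
  obtain ⟨β, hβ, hgen⟩ := exists_generator_of_finite_field ℓ
  rw [hcard] at hβ
  obtain ⟨a₀, ha₀⟩ := hsurj β
  have hβN : β ^ N = 1 := by rw [hN, ← hβ, pow_orderOf_eq_one]
  have hβ0 : β ≠ 0 := by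
    rintro rfl
    rw [zero_pow (NeZero.ne N)] at hβN
    exact zero_ne_one hβN
  obtain ⟨a, haN, haθ⟩ : ∃ a : S, a ^ N = 1 ∧ θ a = β := by
    have hD : θ (Polynomial.eval a₀ (Polynomial.derivative (Polynomial.X ^ N - 1))) ≠ 0 := by
      -- `N = q^d - 1` and `q^d = 0` in `ℓ`, so `X^N - 1` is separable modulo `𝔪`.
      have hNl : (N : ℓ) = -1 := by
        have h := FiniteField.cast_card_eq_zero ℓ
        rw [← Nat.card_eq_fintype_card, hcard] at h
        rw [hN, Nat.cast_sub hq.le, h]; simp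
      rw [Polynomial.derivative_sub, Polynomial.derivative_X_pow, Polynomial.derivative_one]
      simp [ha₀, hNl, hβ0]
    obtain ⟨a, ha, ha'⟩ := HenselianRing.is_henselian
      (I := (maximalIdeal R).map (algebraMap R S)) (Polynomial.X ^ N - 1 : Polynomial S)
      (Polynomial.monic_X_pow_sub_C 1 (NeZero.ne N)) a₀ (by
        rw [← hker, RingHom.mem_ker]
        simp [ha₀, hβN]) (by
        generalize Polynomial.eval a₀ (Polynomial.derivative (Polynomial.X ^ N - 1)) = D at hD
        obtain ⟨y, hy⟩ := hsurj (θ D)⁻¹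
        refine IsUnit.of_mul_eq_one (Ideal.Quotient.mk _ y) ?_
        rw [← map_mul, ← map_one (Ideal.Quotient.mk _), Ideal.Quotient.eq, ← hker, RingHom.mem_ker]
        rw [map_sub, map_mul, map_one, hy, mul_inv_cancel₀ hD, sub_self])
    refine ⟨a, ?_, ?_⟩
    · simpa [Polynomial.IsRoot, sub_eq_zero] using ha
    · rw [← hker, RingHom.mem_ker] at ha'
      rw [← ha₀]
      simpa [sub_eq_zero] using ha'
  have hprim : IsPrimitiveRoot a N := by
    refine ⟨haN, fun l hl => ?_⟩
    rw [hN, ← hβ]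
    exact orderOf_dvd_of_pow_eq_one (by rw [← haθ, ← map_pow, hl, map_one])
  have hadj : Algebra.adjoin R {a} = ⊤ := by
    have h1 : (⊤ : Submodule R S) ≤ Subalgebra.toSubmodule (Algebra.adjoin R {a}) := by
      refine Submodule.le_of_le_smul_of_le_jacobson_bot (I := maximalIdeal R) hfin.fg_top
        (maximalIdeal_le_jacobson _) fun x _ => ?_
      rw [Ideal.smul_top_eq_map, ← hker]
      by_cases hx : θ x = 0
      · exact Submodule.mem_sup_right hx
      · obtain ⟨n, hn⟩ := hgen _ hx
        rw [← add_sub_cancel (a ^ n) x]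
        refine Submodule.add_mem_sup (pow_mem (Algebra.self_mem_adjoin_singleton R a) n) ?_
        rw [Submodule.restrictScalars_mem, RingHom.mem_ker]
        simp [haθ, hn]
    exact top_le_iff.1 h1
  haveI : Module.IsTorsionFree R (KBar R) := by
    rw [Module.isTorsionFree_iff_algebraMap_injective,
      IsScalarTower.algebraMap_eq R (FractionRing R) (KBar R)]
    exact (algebraMap (FractionRing R) (KBar R)).injective.comp (IsFractionRing.injective R _)
  let j : S →ₐ[R] KBar R := IsAlgClosed.lift
  have hj : Function.Injective j := by
    rw [injective_iff_map_eq_zero]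
    intro x hx
    -- An ideal of a domain integral over `R` is zero as soon as its contraction to `R` is.
    have : RingHom.ker j = ⊥ := by
      apply Ideal.eq_bot_of_comap_eq_bot (R := R)
      rw [eq_bot_iff]
      intro r hr
      rw [Ideal.mem_comap, RingHom.mem_ker, AlgHom.commutes] at hr
      exact (FaithfulSMul.algebraMap_injective R (KBar R)) (by rw [hr, map_zero])
    exact (this ▸ (show x ∈ RingHom.ker j from hx) : x ∈ (⊥ : Ideal S))
  have hrange : j.range = Unramified R d := by
    apply le_antisymm
    · rw [← Algebra.map_top, ← hadj, AlgHom.map_adjoin, Set.image_singleton]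
      refine Algebra.adjoin_mono (Set.singleton_subset_iff.2 ?_)
      change j a ^ N = 1
      rw [← map_pow, haN, map_one]
    · refine Algebra.adjoin_le fun w hw => ?_
      obtain ⟨i, -, hi⟩ := (hprim.map_of_injective hj).eq_pow_of_pow_eq_one hw
      exact ⟨a ^ i, by rw [← hi, ← map_pow]; rfl⟩
  let e : S ≃ₐ[R] Unramified R d :=
    (AlgEquiv.ofInjective j hj).trans (Subalgebra.equivOfEq _ _ hrange)
  refine ⟨Module.Finite.equiv e.toLinearEquiv, ℓ, inferInstance, inferInstance,
    θ.comp e.symm.toAlgHom, hcard, hsurj.comp e.symm.surjective, ?_⟩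
  have h1 : (maximalIdeal R).map (algebraMap R (Unramified R d)) =
      ((maximalIdeal R).map (algebraMap R S)).map (e.toAlgHom : S →+* Unramified R d) := by
    rw [Ideal.map_map, AlgHom.comp_algebraMap]
  ext x
  obtain ⟨y, rfl⟩ := e.surjective x
  rw [h1, ← hker, RingHom.mem_ker, 
    Ideal.mem_map_iff_of_surjective (e.toAlgHom : S →+* Unramified R d) e.surjective]
  constructor
  · intro h
    exact ⟨y, by simpa using h, rfl⟩
  · rintro ⟨z, hz, hzy⟩
    have : z = y := e.injective hzy
    subst this
    simpa using hz

variable (R) in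
/-- The maximal ideal of the unramified extension. -/
abbrev maxIdeal (d : ℕ) : Ideal (Unramified R d) :=
  (maximalIdeal R).map (algebraMap R (Unramified R d))

variable [CharZero R] (d : ℕ) [NeZero d]

instance : Module.Finite R (Unramified R d) := (exists_reduction_unramified d).1

instance : (maxIdeal R d).IsMaximal := by
  obtain ⟨-, ℓ, _, _, θ, -, hsurj, hker⟩ := exists_reduction_unramified (R := R) d
  rw [maxIdeal, ← hker]
  exact RingHom.ker_isMaximal_of_surjective _ hsurj

instance : IsAdicComplete (maxIdeal R d) (Unramified R d) :=
  (IsAdicComplete.map_algebraMap_iff _ _).2 (isAdicComplete_of_finite (maximalIdeal R) _)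

variable (R) in
/-- The residue field `𝔽_{q^d}` of the unramified extension. -/
def UnramifiedResidue (d : ℕ) : Type u := Unramified R d ⧸ maxIdeal R d

variable (R) in
/-- The field structure of the residue field, kept opaque to instance search. -/
def UnramifiedResidue.fieldOfQuotient : Field (UnramifiedResidue R d) :=
  Ideal.Quotient.field (maxIdeal R d)

instance : Field (UnramifiedResidue R d) := UnramifiedResidue.fieldOfQuotient R d

variable (R) in
/-- Reduction as a ring homomorphism. -/
def unramifiedReduction : Unramified R d →+* UnramifiedResidue R d :=
  Ideal.Quotient.mk (maxIdeal R d)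

instance : Algebra R (UnramifiedResidue R d) :=
  ((unramifiedReduction R d).comp (algebraMap R (Unramified R d))).toAlgebra

variable (R) in
/-- The reduction map `R_d → 𝔽_{q^d}`. -/
def toResidue : Unramified R d →ₐ[R] UnramifiedResidue R d :=
  { unramifiedReduction R d with commutes' := fun _ => rfl }

theorem toResidue_surjective : Function.Surjective (toResidue R d) :=
  Ideal.Quotient.mk_surjective

variable {d} in
theorem toResidue_eq_zero_iff {y : Unramified R d} : toResidue R d y = 0 ↔ y ∈ maxIdeal R d :=
  Ideal.Quotient.eq_zero_iff_mem

variable {d} in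
theorem toResidue_eq_iff {y z : Unramified R d} :
    toResidue R d y = toResidue R d z ↔ y - z ∈ maxIdeal R d := by
  rw [← sub_eq_zero, ← map_sub, toResidue_eq_zero_iff]

theorem algebraMap_unramifiedResidue_eq_zero {r : R} (hr : r ∈ maximalIdeal R) :
    algebraMap R (UnramifiedResidue R d) r = 0 := by
  rw [← (toResidue R d).commutes, toResidue_eq_zero_iff]
  exact Ideal.mem_map_of_mem _ hr

instance : Algebra (ResidueField R) (UnramifiedResidue R d) :=
  (Ideal.Quotient.lift (maximalIdeal R) (algebraMap R (UnramifiedResidue R d))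
    fun _ hr => algebraMap_unramifiedResidue_eq_zero d hr).toAlgebra

instance : IsScalarTower R (ResidueField R) (UnramifiedResidue R d) :=
  IsScalarTower.of_algebraMap_eq fun _ => rfl

theorem natCard_unramifiedResidue :
    Nat.card (UnramifiedResidue R d) = Nat.card (ResidueField R) ^ d := by
  obtain ⟨-, ℓ, _, _, θ, hcard, hsurj, hker⟩ := exists_reduction_unramified (R := R) d
  rw [← hcard]
  exact Nat.card_congr ((Ideal.quotEquivOfEq hker.symm).trans
    (RingHom.quotientKerEquivOfSurjective hsurj)).toEquiv

instance : Finite (UnramifiedResidue R d) :=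
  Nat.finite_of_card_ne_zero (by
    rw [natCard_unramifiedResidue]
    exact (pow_pos Nat.card_pos d).ne')

theorem finrank_unramifiedResidue :
    Module.finrank (ResidueField R) (UnramifiedResidue R d) = d := by
  have h := Module.natCard_eq_pow_finrank (K := ResidueField R) (V := UnramifiedResidue R d)
  rw [natCard_unramifiedResidue] at h
  exact (Nat.pow_right_injective Finite.one_lt_card h).symm

omit [IsDiscreteValuationRing R] [IsAdicComplete (maximalIdeal R) R] [NeZero d] [CharZero R] in
theorem unramified_le [IsLocalRing R] {d m : ℕ} (h : d ∣ m) : Unramified R d ≤ Unramified R m := by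
  refine Algebra.adjoin_mono fun z hz => ?_
  obtain ⟨c, hc⟩ := Nat.pow_sub_one_dvd_pow_sub_one (Nat.card (ResidueField R)) h
  change z ^ _ = 1
  rw [hc, pow_mul, hz, one_pow]

end Unramified

/-! ### Lifting points along Frobenius -/

section Contraction

variable {R : Type*} [CommRing R] [IsLocalRing R] [Finite (ResidueField R)]
  {A : Type*} [CommRing A] [Algebra R A] {S : Type*} [CommRing S] [Algebra R S]

theorem natCard_residueField_mem : ((Nat.card (ResidueField R) : ℕ) : R) ∈ maximalIdeal R := by
  letI := Fintype.ofFinite (ResidueField R)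
  rw [← residue_eq_zero_iff, map_natCast, Nat.card_eq_fintype_card]
  exact FiniteField.cast_card_eq_zero _

theorem two_le_natCard_residueField : 2 ≤ Nat.card (ResidueField R) := Finite.one_lt_card

variable (R) in
-- In `x^q - y^q = (∑ x^i y^(q-1-i)) (x - y)` the sum is congruent to `q y^(q-1)`, hence to `0`,
-- modulo `J`.
theorem pow_sub_pow_mem {I J : Ideal S} (hJ : J = (maximalIdeal R).map (algebraMap R S))
    (hI : I ≤ J) {x y : S} (h : x - y ∈ I) :
    x ^ Nat.card (ResidueField R) - y ^ Nat.card (ResidueField R) ∈ J * I := by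
  rw [← (Commute.all x y).geom_sum₂_mul]
  refine Ideal.mul_mem_mul ?_ h
  rw [← Ideal.Quotient.eq_zero_iff_mem, map_sum]
  have hxy : Ideal.Quotient.mk J x = Ideal.Quotient.mk J y := Ideal.Quotient.eq.2 (hI h)
  have hq : ((Nat.card (ResidueField R) : ℕ) : S ⧸ J) = 0 := by
    rw [← map_natCast (Ideal.Quotient.mk J), Ideal.Quotient.eq_zero_iff_mem, hJ,
      ← map_natCast (algebraMap R S)]
    exact Ideal.mem_map_of_mem _ natCard_residueField_mem
  have : ∀ i ∈ Finset.range (Nat.card (ResidueField R)),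
      Ideal.Quotient.mk J (x ^ i * y ^ (Nat.card (ResidueField R) - 1 - i)) =
        Ideal.Quotient.mk J y ^ (Nat.card (ResidueField R) - 1) := fun i hi => by
    rw [Finset.mem_range] at hi
    rw [map_mul, map_pow, map_pow, hxy, ← pow_add]
    congr 1
    omega
  rw [Finset.sum_congr rfl this, Finset.sum_const, Finset.card_range, nsmul_eq_mul, hq, zero_mul]

variable {σ : A →ₐ[R] A} (hσ : IsFrobeniusLift σ)
include hσ

/-- Writing `σ a = a^q + t` with `t ∈ 𝔪 A`, the `q`-th power gains one power of `J` by
`pow_sub_pow_mem`, and `t` gains one from the factor in `𝔪`. -/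
theorem frobenius_contracts {n : ℕ} {x y : A →ₐ[R] S}
    (h : ∀ a, x a - y a ∈ (maximalIdeal R).map (algebraMap R S) ^ (n + 1)) (a : A) :
    x (σ a) - y (σ a) ∈ (maximalIdeal R).map (algebraMap R S) ^ (n + 2) := by
  set J := (maximalIdeal R).map (algebraMap R S) with hJ
  have h1 : ∀ t ∈ (maximalIdeal R).map (algebraMap R A), ∀ c : A,
      x (c * t) - y (c * t) ∈ J ^ (n + 2) := by
    intro t ht
    refine Submodule.span_induction (p := fun t _ => ∀ c : A, x (c * t) - y (c * t) ∈ J ^ (n + 2))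
      ?_ ?_ ?_ ?_ ht
    · rintro _ ⟨r, hr, rfl⟩ c
      rw [map_mul, map_mul, AlgHom.commutes, AlgHom.commutes, ← sub_mul, pow_succ]
      exact Ideal.mul_mem_mul (h c) (Ideal.mem_map_of_mem _ hr)
    · intro c; simp
    · intro t t' _ _ ht ht' c
      rw [mul_add, map_add, map_add, add_sub_add_comm]
      exact Ideal.add_mem _ (ht c) (ht' c)
    · intro b t _ ht c
      rw [smul_eq_mul, ← mul_assoc]
      exact ht _
  have h2 := h1 _ (hσ a) 1
  rw [one_mul, map_sub, map_sub, map_pow, map_pow] at h2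
  have h3 := pow_sub_pow_mem R hJ (Ideal.pow_le_self (Nat.succ_ne_zero n)) (h a)
  rw [← pow_succ'] at h3
  have := Ideal.add_mem _ h2 h3
  convert this using 1
  ring

theorem frobenius_iterate_contracts {x y : A →ₐ[R] S}
    (h : ∀ a, x a - y a ∈ (maximalIdeal R).map (algebraMap R S)) (k : ℕ) (a : A) :
    x (σ^[k] a) - y (σ^[k] a) ∈ (maximalIdeal R).map (algebraMap R S) ^ (k + 1) := by
  have key : ∀ a, (x.comp (σ ^ k)) a - (y.comp (σ ^ k)) a ∈
      (maximalIdeal R).map (algebraMap R S) ^ (k + 1) := by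
    induction k with
    | zero => intro a; simpa using h a
    | succ k ih =>
      intro a
      have := frobenius_contracts hσ ih a
      simpa only [AlgHom.comp_apply, pow_succ, AlgHom.mul_apply] using this
  simpa only [AlgHom.comp_apply, AlgHom.coe_pow] using key a

/-- A fixed homomorphism equals its own composite with `σ^(nm)`, and these composites agree to ever
higher order by contraction. -/
theorem fixed_hom_unique [IsHausdorff ((maximalIdeal R).map (algebraMap R S)) S] {m : ℕ}
    (hm : m ≠ 0) {x y : A →ₐ[R] S} (hx : ∀ a, x (σ^[m] a) = x a) (hy : ∀ a, y (σ^[m] a) = y a)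
    (h : ∀ a, x a - y a ∈ (maximalIdeal R).map (algebraMap R S)) : x = y := by
  ext a
  refine sub_eq_zero.1 (IsHausdorff.haus
    (I := (maximalIdeal R).map (algebraMap R S)) inferInstance _ fun n => ?_)
  rw [SModEq.zero, smul_eq_mul, Ideal.mul_top]
  have h1 := frobenius_iterate_contracts hσ h (n * m) a
  have hx' := apply_iterate_mul (x := (x : A →+* S)) (σ := (σ : A →+* A)) hx n a
  have hy' := apply_iterate_mul (x := (y : A →+* S)) (σ := (σ : A →+* A)) hy n a
  change x (σ^[n * m] a) = x a at hx'
  change y (σ^[n * m] a) = y a at hy'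
  rw [hx', hy'] at h1
  exact Ideal.pow_le_pow_right (by nlinarith [Nat.pos_of_ne_zero hm]) h1

/-- The fixed homomorphism is the limit of `y ∘ σ^(nm)`; contraction makes this sequence Cauchy. -/
theorem exists_fixed_hom [IsAdicComplete ((maximalIdeal R).map (algebraMap R S)) S] {m : ℕ}
    (hm : m ≠ 0) (y : A →ₐ[R] S)
    (hy : ∀ a, y (σ^[m] a) - y a ∈ (maximalIdeal R).map (algebraMap R S)) :
    ∃ x : A →ₐ[R] S, (∀ a, x (σ^[m] a) = x a) ∧
      ∀ a, x a - y a ∈ (maximalIdeal R).map (algebraMap R S) := by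
  set J := (maximalIdeal R).map (algebraMap R S) with hJ
  have hy' : ∀ k a, y (σ^[k * m] a) - y a ∈ J := by
    intro k
    induction k with
    | zero => intro a; simp
    | succ k ih =>
      intro a
      rw [Nat.succ_mul, Function.iterate_add_apply]
      have := Ideal.add_mem _ (ih (σ^[m] a)) (hy a)
      simpa using this
  have hcong : ∀ k n a, y (σ^[(n + k) * m] a) - y (σ^[n * m] a) ∈ J ^ n := by
    intro k n a
    have h1 := frobenius_iterate_contracts hσ (x := y.comp (σ ^ (k * m))) (y := y) (fun a => by
      rw [AlgHom.comp_apply, AlgHom.coe_pow]; exact hy' k a) (n * m) a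
    rw [AlgHom.comp_apply, AlgHom.coe_pow, ← Function.iterate_add_apply, ← add_mul,
      add_comm k] at h1
    exact Ideal.pow_le_pow_right (by nlinarith [Nat.pos_of_ne_zero hm]) h1
  let f : (n : ℕ) → A →ₐ[R] S ⧸ J ^ n := fun n =>
    (Ideal.Quotient.mkₐ R (J ^ n)).comp (y.comp (σ ^ (n * m)))
  have hf : ∀ n a, f n a = Ideal.Quotient.mk (J ^ n) (y (σ^[n * m] a)) := fun n a => by
    simp only [f, AlgHom.comp_apply, AlgHom.coe_pow]; rfl
  have hcomp : ∀ {a b : ℕ} (hle : a ≤ b),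
      (Ideal.Quotient.factorₐ R (Ideal.pow_le_pow_right hle)).comp (f b) = f a := by
    intro a b hle
    obtain ⟨k, rfl⟩ := Nat.exists_eq_add_of_le hle
    ext c
    rw [AlgHom.comp_apply, hf, hf]
    exact Ideal.Quotient.eq.2 (hcong k a c)
  let x := IsAdicComplete.liftAlgHom J f hcomp
  have hx : ∀ n a, x a - y (σ^[n * m] a) ∈ J ^ n := fun n a => by
    rw [← Ideal.Quotient.eq, ← hf]
    exact IsAdicComplete.mk_liftAlgHom J f hcomp n a
  refine ⟨x, fun a => ?_, fun a => ?_⟩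
  · refine sub_eq_zero.1 (IsHausdorff.haus (I := J) inferInstance _ fun n => ?_)
    rw [SModEq.zero, smul_eq_mul, Ideal.mul_top]
    have h1 := hx n (σ^[m] a)
    have h2 := Ideal.pow_le_pow_right (Nat.le_succ n) (hx (n + 1) a)
    rw [← Function.iterate_add_apply, ← Nat.succ_mul] at h1
    simpa using Ideal.sub_mem _ h1 h2
  · have h1 := hx 1 a
    rw [one_mul, pow_one] at h1
    simpa using Ideal.add_mem _ h1 (hy a)

end Contraction

/-! ### Fixed points and the kernel of a flat quotient -/

section KillKernel

variable {R : Type*} [CommRing R] [IsDomain R] [IsDiscreteValuationRing R]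
  [Finite (ResidueField R)]
  {B : Type*} [CommRing B] [Algebra R B] {A : Type*} [CommRing A] [Algebra R A] [Module.Flat R A]
  {S : Type*} [CommRing S] [Algebra R S]

/-- If `i ∈ ker μ`, then `σ₀ i = i^q + π h` with `π μ(h) = 0`, so `h ∈ ker μ` because `A` is torsion
free. By induction `y(σ₀^k i) ∈ J^(k+1)`, and `y` is invariant under `σ₀^m`, so `y(i)` lies in every
power of `J`. -/
theorem fixed_hom_apply_eq_zero [IsHausdorff ((maximalIdeal R).map (algebraMap R S)) S]
    {μ : B →ₐ[R] A} {σ : A →ₐ[R] A} {σ₀ : B →ₐ[R] B} (hσ₀ : IsFrobeniusLift σ₀)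
    (hcomm : ∀ a, μ (σ₀ a) = σ (μ a)) {m : ℕ} (hm : m ≠ 0) {y : B →ₐ[R] S}
    (hy : ∀ a, y (σ₀^[m] a) = y a)
    (hker : ∀ i, μ i = 0 → y i ∈ (maximalIdeal R).map (algebraMap R S)) {i : B} (hi : μ i = 0) :
    y i = 0 := by
  set J := (maximalIdeal R).map (algebraMap R S) with hJ
  obtain ⟨π, hπ⟩ := IsDiscreteValuationRing.exists_irreducible R
  have key : ∀ k i, μ i = 0 → y (σ₀^[k] i) ∈ J ^ (k + 1) := by
    intro k
    induction k with
    | zero => intro i hi; simpa using hker i hi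
    | succ k ih =>
      intro i hi
      have h1 := hσ₀ i
      rw [hπ.maximalIdeal_eq, Ideal.map_span, Set.image_singleton,
        Ideal.mem_span_singleton'] at h1
      obtain ⟨h, hh⟩ := h1
      have hσi : σ₀ i = i ^ Nat.card (ResidueField R) + h * algebraMap R B π := by
        rw [hh]; ring
      have hq := two_le_natCard_residueField (R := R)
      have hμ : μ h = 0 := by
        have h2 := congrArg μ hh
        rw [map_mul, AlgHom.commutes, map_sub, hcomm, map_pow, hi, map_zero,
          zero_pow (by omega), sub_zero, mul_comm, ← Algebra.smul_def] at h2
        exact (smul_eq_zero.1 h2).resolve_left hπ.ne_zero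
      have hπJ : algebraMap R S π ∈ J := Ideal.mem_map_of_mem _ (by
        rw [hπ.maximalIdeal_eq]; exact Ideal.mem_span_singleton_self π)
      rw [Function.iterate_succ_apply, hσi, ← AlgHom.coe_pow, map_add, map_pow, map_mul,
        AlgHom.commutes, AlgHom.coe_pow, map_add, map_pow, map_mul, AlgHom.commutes]
      refine Ideal.add_mem _ ?_ ?_
      · have h3 := Ideal.pow_mem_pow (ih i hi) (Nat.card (ResidueField R))
        rw [← pow_mul] at h3
        exact Ideal.pow_le_pow_right (by nlinarith) h3
      · rw [pow_succ]
        exact Ideal.mul_mem_mul (ih h hμ) hπJ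
  refine IsHausdorff.haus (I := J) inferInstance _ fun n => ?_
  rw [SModEq.zero, smul_eq_mul, Ideal.mul_top]
  have hy' := apply_iterate_mul (x := (y : B →+* S)) (σ := (σ₀ : B →+* B)) hy n i
  change y (σ₀^[n * m] i) = y i at hy'
  rw [← hy']
  exact Ideal.pow_le_pow_right (by nlinarith [Nat.pos_of_ne_zero hm]) (key (n * m) i hi)

end KillKernel

/-! ### Points of overconvergent power series rings -/

section Evaluation

variable {R : Type*} [CommRing R] [IsDomain R] [IsDiscreteValuationRing R] {ι : Type*}

variable (R ι) in
/-- Polynomials as overconvergent power series. -/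
def polyHom : MvPolynomial ι R →ₐ[R] Overconvergent R ι := MvPolynomial.aeval Overconvergent.X

theorem polyHom_coe (P : MvPolynomial ι R) :
    (polyHom R ι P : MvPowerSeries ι R) = (P : MvPowerSeries ι R) := by
  have h : (Overconvergent R ι).val.comp (polyHom R ι) = MvPolynomial.coeToMvPowerSeries.algHom R := by
    ext i : 1
    simp [polyHom, Overconvergent.X, MvPolynomial.coeToMvPowerSeries.algHom_apply]
  have := congrArg (fun g => g P) h
  simpa [MvPolynomial.coeToMvPowerSeries.algHom_apply] using this

/-- Decay leaves only finitely many monomials with coefficients outside `𝔪^n`. The degree bound `K`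
ensures `ε |u| - 1/2 ≥ n` beyond it. -/
theorem exists_poly_sub_mem [Finite ι] (b : Overconvergent R ι) (n : ℕ) :
    ∃ P : MvPolynomial ι R, b - polyHom R ι P ∈
      (maximalIdeal R ^ n).map (algebraMap R (Overconvergent R ι)) := by
  classical
  obtain ⟨ε, hε, hd, -⟩ := b.2.exists_decay
  let K := ⌈((n : ℝ) + 1) / ε⌉₊
  let P : MvPolynomial ι R := ∑ u ∈ (Finsupp.finite_of_degree_le (σ := ι) K).toFinset,
    MvPolynomial.monomial u (MvPowerSeries.coeff u (b : MvPowerSeries ι R))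
  refine ⟨P, mem_map_pow_of_hasWeight fun u => ?_⟩
  push_cast
  rw [polyHom_coe, map_sub, MvPolynomial.coeff_coe]
  have hP : P.coeff u = if u.degree ≤ K then MvPowerSeries.coeff u (b : MvPowerSeries ι R) else 0 := by
    simp only [P, MvPolynomial.coeff_sum, MvPolynomial.coeff_monomial, Finset.sum_ite_eq',
      Set.Finite.mem_toFinset, Set.mem_ofPred_eq]
  rw [hP]
  split_ifs with h
  · simp
  · rw [sub_zero]
    refine Ideal.pow_le_pow_right ?_ (hd u)
    have h1 : ((n : ℝ) + 1) / ε < u.degree :=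
      (Nat.le_ceil _).trans_lt (Nat.cast_lt.2 (not_le.1 h))
    rw [div_lt_iff₀ hε] at h1
    have h2 : ((n : ℕ) : ℝ) ≤ ε * u.degree + -(1 / 2) := by linarith
    exact_mod_cast h2.trans (Nat.le_ceil _)

theorem aeval_mem_of_polyHom_mem {S : Type*} [CommRing S] [Algebra R S] (c : ι → S) {n : ℕ}
    {P : MvPolynomial ι R}
    (hP : polyHom R ι P ∈ (maximalIdeal R ^ n).map (algebraMap R (Overconvergent R ι))) :
    MvPolynomial.aeval c P ∈ (maximalIdeal R).map (algebraMap R S) ^ n := by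
  have hcoeff : ∀ u, P.coeff u ∈ maximalIdeal R ^ n := by
    have h1 : (maximalIdeal R ^ n).map (algebraMap R (Overconvergent R ι)) ≤ weightIdeal R ι n := by
      rw [Ideal.map_le_iff_le_comap]
      intro r hr u
      classical
      change MvPowerSeries.coeff u (algebraMap R (MvPowerSeries ι R) r) ∈ _
      rw [MvPowerSeries.algebraMap_apply, MvPowerSeries.coeff_C]
      split_ifs
      · exact hr
      · exact Ideal.zero_mem _
    intro u
    have := h1 hP u
    rwa [polyHom_coe, MvPolynomial.coeff_coe] at this
  rw [MvPolynomial.aeval_def, MvPolynomial.eval₂_eq]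
  refine Ideal.sum_mem _ fun u _ => Ideal.mul_mem_right _ _ ?_
  rw [← Ideal.map_pow]
  exact Ideal.mem_map_of_mem _ (hcoeff u)

/-- Evaluation of overconvergent series at integral points. -/
theorem exists_eval_overconvergent [Finite ι] {S : Type*} [CommRing S] [Algebra R S]
    [IsAdicComplete ((maximalIdeal R).map (algebraMap R S)) S] (c : ι → S) :
    ∃ y : Overconvergent R ι →ₐ[R] S, ∀ i, y (Overconvergent.X i) = c i := by
  set J := (maximalIdeal R).map (algebraMap R S) with hJ
  -- Modulo `𝔪^n` every overconvergent series is a polynomial, which can be evaluated; the resulting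
  -- maps to `S / J^n` are compatible, and `S` is complete.
  let W : ℕ → Ideal (Overconvergent R ι) := fun n =>
    (maximalIdeal R ^ n).map (algebraMap R (Overconvergent R ι))
  let ψ : (n : ℕ) → MvPolynomial ι R →ₐ[R] Overconvergent R ι ⧸ W n := fun n =>
    (Ideal.Quotient.mkₐ R (W n)).comp (polyHom R ι)
  have hψ : ∀ n, Function.Surjective (ψ n) := by
    intro n b
    obtain ⟨b, rfl⟩ := Ideal.Quotient.mk_surjective b
    obtain ⟨P, hP⟩ := exists_poly_sub_mem b n
    exact ⟨P, (Ideal.Quotient.eq.2 hP).symm⟩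
  have hker : ∀ n, ∀ P ∈ RingHom.ker (ψ n),
      ((Ideal.Quotient.mkₐ R (J ^ n)).comp (MvPolynomial.aeval c)) P = 0 := fun n P hP =>
    Ideal.Quotient.eq_zero_iff_mem.2
      (aeval_mem_of_polyHom_mem c (Ideal.Quotient.eq_zero_iff_mem.1 hP))
  let f : (n : ℕ) → Overconvergent R ι →ₐ[R] S ⧸ J ^ n := fun n =>
    ((Ideal.Quotient.liftₐ _ _ (hker n)).comp
      (Ideal.quotientKerAlgEquivOfSurjective (hψ n)).symm.toAlgHom).comp (Ideal.Quotient.mkₐ R (W n))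
  have hf : ∀ n b P, b - polyHom R ι P ∈ W n →
      f n b = Ideal.Quotient.mk (J ^ n) (MvPolynomial.aeval c P) := by
    intro n b P hP
    have h1 : Ideal.Quotient.mkₐ R (W n) b = ψ n P := Ideal.Quotient.eq.2 hP
    have h2 : (Ideal.quotientKerAlgEquivOfSurjective (hψ n)).symm (ψ n P) =
        Ideal.Quotient.mk _ P := by
      rw [AlgEquiv.symm_apply_eq]; rfl
    simp only [f, AlgHom.comp_apply, h1]
    erw [h2]
    rfl
  have hcomp : ∀ {a b : ℕ} (hle : a ≤ b),
      (Ideal.Quotient.factorₐ R (Ideal.pow_le_pow_right hle)).comp (f b) = f a := by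
    intro m n hle
    ext b
    obtain ⟨P, hP⟩ := exists_poly_sub_mem b n
    rw [AlgHom.comp_apply, hf n b P hP,
      hf m b P (Ideal.map_mono (Ideal.pow_le_pow_right hle) hP)]
    rfl
  refine ⟨IsAdicComplete.liftAlgHom J f hcomp, fun i => ?_⟩
  refine sub_eq_zero.1 (IsHausdorff.haus (I := J) inferInstance _ fun n => ?_)
  rw [SModEq.zero, smul_eq_mul, Ideal.mul_top, ← Ideal.Quotient.eq,
    IsAdicComplete.mk_liftAlgHom J f hcomp n, hf n _ (MvPolynomial.X i)]
  · simp
  · simp [polyHom]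

end Evaluation

/-! ### Closed points and fixed points -/

section Points

universe u

variable {R : Type u} [CommRing R] [IsDomain R] [IsDiscreteValuationRing R]
  [IsAdicComplete (maximalIdeal R) R] [Finite (ResidueField R)]

variable [CharZero R]

variable {A : Type*} [CommRing A] [Algebra R A]

/-- `R`-algebra homomorphisms `x : A → R_m` with `x ∘ σ^m = x`. -/
def FixedPoint (σ : A →ₐ[R] A) (m : ℕ) : Type _ :=
  {x : A →ₐ[R] Unramified R m // ∀ a, x (σ^[m] a) = x a}

/-- Points of the special fibre with values in `𝔽_{q^m}`. -/
abbrev residuePoint {m : ℕ} [NeZero m] (x : A →ₐ[R] Unramified R m) :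
    A →ₐ[R] UnramifiedResidue R m :=
  (toResidue R m).comp x

/-- The induced homomorphism on `A / πA`. -/
def specialize {m : ℕ} [NeZero m] (x : A →ₐ[R] UnramifiedResidue R m) :
    ResidueField R ⊗[R] A →ₐ[ResidueField R] UnramifiedResidue R m :=
  Algebra.TensorProduct.lift (Algebra.ofId _ _) x fun _ _ => Commute.all _ _

theorem specialize_tmul {m : ℕ} [NeZero m] (x : A →ₐ[R] UnramifiedResidue R m) (a : A) :
    specialize x (1 ⊗ₜ a) = x a := by
  simp [specialize]

theorem exists_one_tmul_eq {R : Type*} [CommRing R] [IsLocalRing R] {A : Type*} [CommRing A]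
    [Algebra R A] (t : ResidueField R ⊗[R] A) : ∃ a : A, t = 1 ⊗ₜ a := by
  induction t using TensorProduct.induction_on with
  | zero => exact ⟨0, by simp⟩
  | tmul c a =>
    obtain ⟨r, rfl⟩ := residue_surjective c
    refine ⟨r • a, ?_⟩
    rw [TensorProduct.tmul_smul, TensorProduct.smul_tmul', Algebra.smul_def, mul_one]
    rfl
  | add s t hs ht =>
    obtain ⟨a, rfl⟩ := hs
    obtain ⟨b, rfl⟩ := ht
    exact ⟨a + b, by rw [TensorProduct.tmul_add]⟩

theorem ker_isMaximal_of_finite_field {B F : Type*} [CommRing B] [Field F] [Finite F]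
    (f : B →+* F) : (RingHom.ker f).IsMaximal := by
  apply Ideal.Quotient.maximal_of_isField
  haveI : Finite (B ⧸ RingHom.ker f) := Finite.of_injective _ (RingHom.kerLift_injective f)
  haveI : (RingHom.ker f).IsPrime := RingHom.ker_isPrime f
  exact Finite.isField_of_domain _

/-- The closed point of a point of the special fibre. -/
def closedPoint {m : ℕ} [NeZero m] (x : A →ₐ[R] UnramifiedResidue R m) : ClosedPoint R A :=
  ⟨RingHom.ker (specialize x), ker_isMaximal_of_finite_field
    (specialize x : ResidueField R ⊗[R] A →+* UnramifiedResidue R m)⟩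

theorem mem_closedPoint {m : ℕ} [NeZero m] (x : A →ₐ[R] UnramifiedResidue R m) (a : A) :
    (1 : ResidueField R) ⊗ₜ[R] a ∈ (closedPoint x).asIdeal ↔ x a = 0 := by
  change _ ∈ RingHom.ker (specialize x) ↔ _
  rw [RingHom.mem_ker, specialize_tmul]

theorem closedPoint_ext {P Q : ClosedPoint R A}
    (h : ∀ a : A, (1 : ResidueField R) ⊗ₜ[R] a ∈ P.asIdeal → (1 : ResidueField R) ⊗ₜ[R] a ∈ Q.asIdeal) :
    P = Q := by
  have hle : P.asIdeal ≤ Q.asIdeal := fun t ht => by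
    obtain ⟨a, rfl⟩ := exists_one_tmul_eq t
    exact h a ht
  exact MaximalSpectrum.ext (P.isMaximal.eq_of_le Q.isMaximal.ne_top hle)

/-- The residue field at a closed point. -/
def ClosedPoint.ResField (P : ClosedPoint R A) : Type _ := (ResidueField R ⊗[R] A) ⧸ P.asIdeal

/-- The field structure of the residue field, kept opaque to instance search. -/
def ClosedPoint.fieldOfQuotient (P : ClosedPoint R A) : Field P.ResField :=
  haveI := P.isMaximal
  Ideal.Quotient.field P.asIdeal

instance (P : ClosedPoint R A) : Field P.ResField := P.fieldOfQuotient

/-- Reduction modulo a closed point. -/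
def ClosedPoint.mk (P : ClosedPoint R A) : ResidueField R ⊗[R] A →+* P.ResField :=
  Ideal.Quotient.mk P.asIdeal

instance (P : ClosedPoint R A) : Algebra (ResidueField R) P.ResField :=
  (P.mk.comp (algebraMap (ResidueField R) (ResidueField R ⊗[R] A))).toAlgebra

/-- Reduction modulo a closed point, over the residue field. -/
def ClosedPoint.mkₐ (P : ClosedPoint R A) :
    ResidueField R ⊗[R] A →ₐ[ResidueField R] P.ResField :=
  { P.mk with commutes' := fun _ => rfl }

theorem ClosedPoint.mkₐ_surjective (P : ClosedPoint R A) : Function.Surjective P.mkₐ :=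
  Ideal.Quotient.mk_surjective

theorem ClosedPoint.mkₐ_eq_zero_iff (P : ClosedPoint R A) {t : ResidueField R ⊗[R] A} :
    P.mkₐ t = 0 ↔ t ∈ P.asIdeal :=
  Ideal.Quotient.eq_zero_iff_mem

theorem ClosedPoint.exists_eq (P : ClosedPoint R A) (c : P.ResField) :
    ∃ a : A, c = P.mkₐ (1 ⊗ₜ a) := by
  obtain ⟨c, rfl⟩ := P.mkₐ_surjective c
  obtain ⟨a, rfl⟩ := exists_one_tmul_eq c
  exact ⟨a, rfl⟩

theorem ClosedPoint.finrank_resField (P : ClosedPoint R A) :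
    Module.finrank (ResidueField R) P.ResField = P.degree := by
  let e : P.ResField ≃ₗ[ResidueField R] (ResidueField R ⊗[R] A) ⧸ P.asIdeal :=
    { AddEquiv.refl ((ResidueField R ⊗[R] A) ⧸ P.asIdeal) with
      map_smul' := fun c y => by
        rw [Algebra.smul_def]
        obtain ⟨y, rfl⟩ := P.mkₐ_surjective y
        change Ideal.Quotient.mk P.asIdeal (algebraMap _ _ c * y) = c • Ideal.Quotient.mk _ y
        rw [← Algebra.smul_def]
        rfl }
  exact e.finrank_eq

/-- The residue field at a closed point, embedded by a point over it. -/
def residueEmbedding {m : ℕ} [NeZero m] {P : ClosedPoint R A} (x : A →ₐ[R] UnramifiedResidue R m)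
    (h : closedPoint x = P) : P.ResField →ₐ[ResidueField R] UnramifiedResidue R m :=
  { Ideal.Quotient.lift P.asIdeal (specialize x : _ →+* UnramifiedResidue R m) (by
      subst h; exact fun _ ha => ha) with
    commutes' := fun c => by
      change specialize x (algebraMap _ _ c) = _
      exact (specialize x).commutes c }

theorem residueEmbedding_mk {m : ℕ} [NeZero m] {P : ClosedPoint R A}
    (x : A →ₐ[R] UnramifiedResidue R m) (h : closedPoint x = P) (a : A) :
    residueEmbedding x h (P.mkₐ (1 ⊗ₜ a)) = x a :=
  specialize_tmul x a

variable (σ : A →ₐ[R] A)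

variable (R A) in
/-- The special fibre is of finite type, and its points lift to fixed points of `σ`. -/
structure HasTeichmullerLifts : Prop where
  frob : IsFrobeniusLift σ
  finiteType : Algebra.FiniteType (ResidueField R) (ResidueField R ⊗[R] A)
  exists_lift : ∀ (m : ℕ) [NeZero m] (x : A →ₐ[R] UnramifiedResidue R m),
    ∃ y : FixedPoint σ m, residuePoint y.1 = x

variable {σ}

/-- Zariski's form of the Nullstellensatz. -/
theorem finite_resField (hft : Algebra.FiniteType (ResidueField R) (ResidueField R ⊗[R] A))
    (P : ClosedPoint R A) : Module.Finite (ResidueField R) P.ResField :=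
  haveI : Algebra.FiniteType (ResidueField R) P.ResField :=
    Algebra.FiniteType.of_surjective P.mkₐ P.mkₐ_surjective
  finite_of_finite_type_of_isJacobsonRing _ _

theorem degree_pos (hft : Algebra.FiniteType (ResidueField R) (ResidueField R ⊗[R] A))
    (P : ClosedPoint R A) : 0 < P.degree := by
  haveI := finite_resField hft P
  rw [← P.finrank_resField]
  exact Module.finrank_pos

theorem degree_closedPoint_dvd {m : ℕ} [NeZero m] (x : A →ₐ[R] UnramifiedResidue R m) :
    (closedPoint x).degree ∣ m := by
  have h : Nonempty ((closedPoint x).ResField →ₐ[ResidueField R] UnramifiedResidue R m) :=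
    ⟨residueEmbedding x rfl⟩
  rw [FiniteField.nonempty_algHom_iff_finrank_dvd, finrank_unramifiedResidue,
    ClosedPoint.finrank_resField] at h
  exact h

/-- Together with `HasTeichmullerLifts.exists_lift` this identifies fixed points of `σ^m` with
points of the special fibre over `𝔽_{q^m}`. -/
theorem fixedPoint_ext (hσ : IsFrobeniusLift σ) {m : ℕ} [NeZero m] {x y : FixedPoint σ m}
    (h : residuePoint x.1 = residuePoint y.1) : x = y :=
  Subtype.ext (fixed_hom_unique hσ (NeZero.ne m) x.2 y.2 fun a =>
    toResidue_eq_iff.1 (congrArg (fun f => f a) h))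

theorem finite_residuePoints (hft : Algebra.FiniteType (ResidueField R) (ResidueField R ⊗[R] A))
    (m : ℕ) [NeZero m] : Finite (A →ₐ[R] UnramifiedResidue R m) := by
  obtain ⟨s, hs⟩ := hft.out
  refine Finite.of_injective (β := s → UnramifiedResidue R m) (fun x t => specialize x t) ?_
  intro x y hxy
  have h1 : specialize x = specialize y :=
    AlgHom.ext_of_adjoin_eq_top hs fun t ht => congrFun hxy ⟨t, ht⟩
  ext a
  rw [← specialize_tmul, h1, specialize_tmul]

theorem finite_fixedPoint (h : HasTeichmullerLifts R A σ) (m : ℕ) [NeZero m] :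
    Finite (FixedPoint σ m) :=
  haveI := finite_residuePoints h.finiteType m
  Finite.of_injective (fun x : FixedPoint σ m => residuePoint x.1) fun _ _ => fixedPoint_ext h.frob

theorem algHom_surjective_of_finrank_eq {k K L : Type*} [Field k] [Field K] [Field L] [Algebra k K]
    [Algebra k L] [Module.Finite k K] [Module.Finite k L]
    (h : Module.finrank k K = Module.finrank k L) (e : K →ₐ[k] L) : Function.Surjective e :=
  (LinearMap.injective_iff_surjective_of_finrank_eq_finrank (f := e.toLinearMap) h).1
    e.toRingHom.injective

/-- The residue field at `P` and that of `R_d` are finite of the same degree over `𝔽_q`, hence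
isomorphic. The resulting residue point lifts to a fixed point, which is surjective by Nakayama. -/
theorem nonempty_teichmullerLift (h : HasTeichmullerLifts R A σ) (P : ClosedPoint R A) :
    Nonempty (TeichmullerLift σ P) := by
  haveI := finite_resField h.finiteType P
  haveI : NeZero P.degree := ⟨(degree_pos h.finiteType P).ne'⟩
  obtain ⟨e⟩ : Nonempty (P.ResField →ₐ[ResidueField R] UnramifiedResidue R P.degree) := by
    rw [FiniteField.nonempty_algHom_iff_finrank_dvd, finrank_unramifiedResidue, P.finrank_resField]
  have he : Function.Surjective e := algHom_surjective_of_finrank_eq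
    (P.finrank_resField.trans (finrank_unramifiedResidue P.degree).symm) e
  let x₀ : A →ₐ[R] UnramifiedResidue R P.degree :=
    ((e.comp P.mkₐ).restrictScalars R).comp Algebra.TensorProduct.includeRight
  have hx₀ : ∀ a, x₀ a = e (P.mkₐ (1 ⊗ₜ a)) := fun a => rfl
  obtain ⟨x, hx⟩ := h.exists_lift P.degree x₀
  have hxa : ∀ a, toResidue R P.degree (x.1 a) = x₀ a := fun a => congrArg (fun f => f a) hx
  refine ⟨⟨x.1, ?_, x.2, fun a => ?_⟩⟩
  · have h1 : (⊤ : Submodule R (Unramified R P.degree)) ≤ Subalgebra.toSubmodule x.1.range := by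
      refine Submodule.le_of_le_smul_of_le_jacobson_bot (I := maximalIdeal R)
        (Module.Finite.fg_top) (maximalIdeal_le_jacobson _) fun y _ => ?_
      rw [Ideal.smul_top_eq_map]
      obtain ⟨t, ht⟩ := he (toResidue R P.degree y)
      obtain ⟨a, rfl⟩ := P.exists_eq t
      rw [← add_sub_cancel (x.1 a) y]
      refine Submodule.add_mem_sup ⟨a, rfl⟩ ?_
      rw [Submodule.restrictScalars_mem]
      exact toResidue_eq_iff.1 (by rw [hxa, hx₀, ht])
    intro y
    exact h1 (Submodule.mem_top (x := y))
  · change x.1 a ∈ maxIdeal R P.degree ↔ _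
    rw [← toResidue_eq_zero_iff, hxa, hx₀, map_eq_zero, P.mkₐ_eq_zero_iff]

/-- The ideal of `R_d` is maximal and lies in the contraction of that of `R_m`, which is proper; so
the two coincide. -/
theorem mem_maxIdeal_inclusion_iff {d m : ℕ} [NeZero d] [NeZero m] (h : d ∣ m) (y : Unramified R d) :
    Subalgebra.inclusion (unramified_le h) y ∈ maxIdeal R m ↔ y ∈ maxIdeal R d := by
  let j : Unramified R d →ₐ[R] Unramified R m := Subalgebra.inclusion (unramified_le h)
  have h1 : maxIdeal R d ≤ (maxIdeal R m).comap (j : Unramified R d →+* Unramified R m) := by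
    rw [← Ideal.map_le_iff_le_comap, maxIdeal, Ideal.map_map, AlgHom.comp_algebraMap]
  have h2 : maxIdeal R d = (maxIdeal R m).comap (j : Unramified R d →+* Unramified R m) :=
    (inferInstance : (maxIdeal R d).IsMaximal).eq_of_le
      (Ideal.comap_ne_top _ (Ideal.IsMaximal.ne_top inferInstance)) h1
  constructor
  · intro hy
    rw [h2]
    exact Ideal.mem_comap.2 hy
  · intro hy
    exact Ideal.mem_comap.1 (h1 hy)

theorem TeichmullerLift.apply_iterate {P : ClosedPoint R A} (t : TeichmullerLift σ P) {m : ℕ}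
    (h : P.degree ∣ m) (a : A) : t.toHom (σ^[m] a) = t.toHom a := by
  obtain ⟨k, rfl⟩ := h
  rw [mul_comm]
  exact apply_iterate_mul (t.toHom : A →+* Unramified R P.degree) (σ := (σ : A →+* A)) t.fixed k a

/-- A Teichmüller lift of a point of degree `d` viewed as a fixed point of `σ^m`, for `d ∣ m`. -/
def TeichmullerLift.fixedPoint {P : ClosedPoint R A} (t : TeichmullerLift σ P) {m : ℕ}
    (h : P.degree ∣ m) : FixedPoint σ m :=
  ⟨(Subalgebra.inclusion (unramified_le h)).comp t.toHom, fun a => by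
    rw [AlgHom.comp_apply, AlgHom.comp_apply, t.apply_iterate h]⟩

/-- Translation of a fixed point by `σ`. -/
def FixedPoint.shift {m : ℕ} (x : FixedPoint σ m) (i : ℕ) : FixedPoint σ m :=
  ⟨x.1.comp (σ ^ i), fun a => by
    rw [AlgHom.comp_apply, AlgHom.comp_apply, AlgHom.coe_pow, ← Function.iterate_add_apply,
      add_comm, Function.iterate_add_apply, x.2]⟩

theorem closedPoint_fixedPoint {P : ClosedPoint R A} [NeZero P.degree] (t : TeichmullerLift σ P)
    {m : ℕ} [NeZero m] (h : P.degree ∣ m) :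
    closedPoint (residuePoint (t.fixedPoint h).1) = P := by
  refine (closedPoint_ext fun a ha => ?_).symm
  rw [mem_closedPoint]
  refine toResidue_eq_zero_iff.2 ((mem_maxIdeal_inclusion_iff h _).2 ?_)
  exact (t.reduction a).2 ha

theorem residuePoint_shift (hσ : IsFrobeniusLift σ) {m : ℕ} [NeZero m] (x : FixedPoint σ m) (i : ℕ) (a : A) :
    residuePoint (x.shift i).1 a = residuePoint x.1 a ^ Nat.card (ResidueField R) ^ i := by
  induction i generalizing a with
  | zero => simp [FixedPoint.shift]
  | succ i ih =>
    have h1 : residuePoint (x.shift (i + 1)).1 a = residuePoint (x.shift i).1 (σ a) := by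
      simp only [FixedPoint.shift, pow_succ]
      rfl
    rw [h1, ih, pow_succ', pow_mul]
    congr 1
    rw [← map_pow]
    refine toResidue_eq_iff.2 ?_
    rw [← map_sub]
    have h2 := Ideal.mem_map_of_mem (x.1 : A →+* Unramified R m) (hσ a)
    rwa [Ideal.map_map, AlgHom.comp_algebraMap] at h2

theorem closedPoint_shift (hσ : IsFrobeniusLift σ) {m : ℕ} [NeZero m] (x : FixedPoint σ m) (i : ℕ) :
    closedPoint (residuePoint (x.shift i).1) = closedPoint (residuePoint x.1) := by
  refine closedPoint_ext fun a ha => ?_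
  rw [mem_closedPoint, residuePoint_shift hσ] at ha
  rw [mem_closedPoint]
  exact eq_zero_of_pow_eq_zero ha

section FiniteField

variable {k κ L : Type*} [Field k] [Finite k] [Field κ] [Finite κ] [Algebra k κ] [Field L]
  [Algebra k L]

theorem frobeniusAlgHom_pow_apply [Fintype k] (i : ℕ) (c : κ) :
    (FiniteField.frobeniusAlgHom k κ ^ i) c = c ^ Nat.card k ^ i := by
  induction i with
  | zero => simp
  | succ i ih =>
    rw [pow_succ', AlgHom.mul_apply, ih, pow_succ, pow_mul, Nat.card_eq_fintype_card]
    rfl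

theorem eq_of_frobenius_pow_eq (e : κ →ₐ[k] L) {i j : ℕ} (hi : i < Module.finrank k κ)
    (hj : j < Module.finrank k κ) (h : ∀ c, e c ^ Nat.card k ^ i = e c ^ Nat.card k ^ j) :
    i = j := by
  letI := Fintype.ofFinite k
  refine congrArg Fin.val ((FiniteField.bijective_frobeniusAlgHom_pow k κ).1
    (a₁ := ⟨i, hi⟩) (a₂ := ⟨j, hj⟩) (AlgHom.ext fun c => e.toRingHom.injective ?_))
  change e ((FiniteField.frobeniusAlgHom k κ ^ i) c) = e ((FiniteField.frobeniusAlgHom k κ ^ j) c)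
  rw [frobeniusAlgHom_pow_apply, frobeniusAlgHom_pow_apply, map_pow, map_pow, h]

/-- Finite extensions of finite fields are normal, so two embeddings differ by an automorphism, and
these are the powers of Frobenius. -/
theorem exists_eq_frobenius_pow [Finite L] (e₀ e : κ →ₐ[k] L) :
    ∃ i < Module.finrank k κ, ∀ c, e c = e₀ c ^ Nat.card k ^ i := by
  letI := Fintype.ofFinite k
  letI : Algebra κ L := e₀.toRingHom.toAlgebra
  haveI : IsScalarTower k κ L := IsScalarTower.of_algebraMap_eq fun c => (e₀.commutes c).symm
  let g := Normal.algHomEquivAut k L κ e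
  obtain ⟨i, hi⟩ := (FiniteField.bijective_frobeniusAlgHom_pow k κ).2 (g : κ →ₐ[k] κ)
  refine ⟨i, i.2, fun c => ?_⟩
  have h1 := congrArg (fun f => f c) ((Normal.algHomEquivAut k L κ).symm_apply_apply e)
  have h2 : e₀ (g c) = e c := h1
  have h3 : (FiniteField.frobeniusAlgHom k κ ^ (i : ℕ)) c = g c := congrArg (fun f => f c) hi
  rw [← h2, ← h3, frobeniusAlgHom_pow_apply, map_pow]

end FiniteField

/-- The fixed points over a closed point are the `σ`-translates of any of them. -/
theorem bijective_shift (h : HasTeichmullerLifts R A σ) {P : ClosedPoint R A}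
    {m : ℕ} [NeZero m] (x₀ : FixedPoint σ m) (hx₀ : closedPoint (residuePoint x₀.1) = P) :
    Function.Bijective (fun i : Fin P.degree =>
      (⟨x₀.shift i, (closedPoint_shift h.frob x₀ i).trans hx₀⟩ :
        {x : FixedPoint σ m // closedPoint (residuePoint x.1) = P})) := by
  haveI := finite_resField h.finiteType P
  haveI : Finite P.ResField := Module.finite_of_finite (ResidueField R)
  have hshift : ∀ (i : ℕ) (a : A), residuePoint (x₀.shift i).1 a =
      residueEmbedding (residuePoint x₀.1) hx₀ (P.mkₐ (1 ⊗ₜ a)) ^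
        Nat.card (ResidueField R) ^ i := by
    intro i a
    rw [residuePoint_shift h.frob, residueEmbedding_mk]
  have hlt : ∀ i : Fin P.degree, (i : ℕ) < Module.finrank (ResidueField R) P.ResField := fun i => by
    rw [P.finrank_resField]
    exact i.2
  constructor
  · intro i j hij
    have hij' : x₀.shift i = x₀.shift j := congrArg Subtype.val hij
    refine Fin.ext (eq_of_frobenius_pow_eq (residueEmbedding (residuePoint x₀.1) hx₀)
      (hlt i) (hlt j) fun c => ?_)
    obtain ⟨a, rfl⟩ := P.exists_eq c
    rw [← hshift, ← hshift, hij']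
  · rintro ⟨x, hx⟩
    obtain ⟨i, hi, he⟩ := exists_eq_frobenius_pow (residueEmbedding (residuePoint x₀.1) hx₀)
      (residueEmbedding (residuePoint x.1) hx)
    rw [P.finrank_resField] at hi
    refine ⟨⟨i, hi⟩, Subtype.ext (fixedPoint_ext h.frob (AlgHom.ext fun a => ?_))⟩
    have h1 := he (P.mkₐ (1 ⊗ₜ a))
    rw [← hshift, residueEmbedding_mk] at h1
    exact h1.symm

end Points

/-! ### Existence of Teichmüller liftings -/

section Lifts

universe u

variable {R : Type u} [CommRing R] [IsDomain R] [IsDiscreteValuationRing R]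
  [IsAdicComplete (maximalIdeal R) R] [Finite (ResidueField R)] [CharZero R]

variable {A : Type*} [CommRing A] [Algebra R A] {σ : A →ₐ[R] A}

theorem residue_apply_eq_zero {m : ℕ} [NeZero m] (x : A →ₐ[R] UnramifiedResidue R m) {a : A}
    (ha : a ∈ (maximalIdeal R).map (algebraMap R A)) : x a = 0 := by
  have h : (maximalIdeal R).map (algebraMap R A) ≤ RingHom.ker (x : A →+* UnramifiedResidue R m) := by
    rw [Ideal.map_le_iff_le_comap]
    intro r hr
    rw [Ideal.mem_comap, RingHom.mem_ker]
    exact (x.commutes r).trans (algebraMap_unramifiedResidue_eq_zero m hr)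
  exact h ha

theorem residue_apply_frobenius (hσ : IsFrobeniusLift σ) {m : ℕ} [NeZero m]
    (x : A →ₐ[R] UnramifiedResidue R m) (k : ℕ) (a : A) :
    x (σ^[k] a) = x a ^ Nat.card (ResidueField R) ^ k := by
  induction k with
  | zero => simp
  | succ k ih =>
    rw [Function.iterate_succ_apply', pow_succ, pow_mul, ← ih, ← map_pow, ← sub_eq_zero, ← map_sub]
    exact residue_apply_eq_zero x (hσ _)

theorem residue_apply_iterate (hσ : IsFrobeniusLift σ) {m : ℕ} [NeZero m]
    (x : A →ₐ[R] UnramifiedResidue R m) (a : A) : x (σ^[m] a) = x a := by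
  letI := Fintype.ofFinite (UnramifiedResidue R m)
  rw [residue_apply_frobenius hσ, ← natCard_unramifiedResidue, Nat.card_eq_fintype_card,
    FiniteField.pow_card]

/-- Modulo `𝔪` an overconvergent series is a polynomial, so the values on the variables determine a
residue point. -/
theorem residue_hom_ext {ι : Type*} [Finite ι] {m : ℕ} [NeZero m]
    {x y : Overconvergent R ι →ₐ[R] UnramifiedResidue R m}
    (h : ∀ i, x (Overconvergent.X i) = y (Overconvergent.X i)) : x = y := by
  have h1 : x.comp (polyHom R ι) = y.comp (polyHom R ι) :=
    MvPolynomial.algHom_ext fun i => by simpa [polyHom] using h i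
  ext b
  obtain ⟨P, hP⟩ := exists_poly_sub_mem b 1
  rw [pow_one] at hP
  have hx := residue_apply_eq_zero x hP
  have hy := residue_apply_eq_zero y hP
  rw [map_sub, sub_eq_zero] at hx hy
  rw [hx, hy]
  exact congrArg (fun f => f P) h1

theorem exists_factor {B S : Type*} [CommRing B] [CommRing S] [Algebra R B] [Algebra R S]
    {μ : B →ₐ[R] A} (hμ : Function.Surjective μ) (y : B →ₐ[R] S) (h : ∀ i, μ i = 0 → y i = 0) :
    ∃ x : A →ₐ[R] S, ∀ b, x (μ b) = y b := by
  refine ⟨(Ideal.Quotient.liftₐ (RingHom.ker μ) y h).comp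
    (Ideal.quotientKerAlgEquivOfSurjective hμ).symm.toAlgHom, fun b => ?_⟩
  have : (Ideal.quotientKerAlgEquivOfSurjective hμ).symm (μ b) = Ideal.Quotient.mk _ b := by
    rw [AlgEquiv.symm_apply_eq]
    rfl
  change Ideal.Quotient.liftₐ (RingHom.ker μ) y h
    ((Ideal.quotientKerAlgEquivOfSurjective hμ).symm (μ b)) = y b
  rw [this]
  rfl

section Quotient

variable {ι : Type*} {μ : Overconvergent R ι →ₐ[R] A} (hμ : Function.Surjective μ)

include hμ in
theorem finiteType_specialFibre [Finite ι] :
    Algebra.FiniteType (ResidueField R) (ResidueField R ⊗[R] A) := by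
  have h : Function.Surjective ((Algebra.TensorProduct.includeRight :
      A →ₐ[R] ResidueField R ⊗[R] A).comp (μ.comp (polyHom R ι))) := by
    intro t
    obtain ⟨a, rfl⟩ := exists_one_tmul_eq t
    obtain ⟨b, rfl⟩ := hμ a
    obtain ⟨P, hP⟩ := exists_poly_sub_mem b 1
    rw [pow_one] at hP
    refine ⟨P, ?_⟩
    let g : Overconvergent R ι →ₐ[R] ResidueField R ⊗[R] A :=
      (Algebra.TensorProduct.includeRight : A →ₐ[R] ResidueField R ⊗[R] A).comp μ
    have h1 : (maximalIdeal R).map (algebraMap R (Overconvergent R ι)) ≤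
        RingHom.ker (g : Overconvergent R ι →+* ResidueField R ⊗[R] A) := by
      rw [Ideal.map_le_iff_le_comap]
      intro r hr
      rw [Ideal.mem_comap, RingHom.mem_ker]
      refine (g.commutes r).trans ?_
      rw [IsScalarTower.algebraMap_apply R (ResidueField R), 
        show algebraMap R (ResidueField R) r = 0 from (residue_eq_zero_iff r).2 hr, map_zero]
    have h2 : g (b - polyHom R ι P) = 0 := h1 hP
    rw [map_sub, sub_eq_zero] at h2
    exact h2.symm
  haveI : Algebra.FiniteType R (ResidueField R ⊗[R] A) := Algebra.FiniteType.of_surjective _ h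
  exact Algebra.FiniteType.of_restrictScalars_finiteType R _ _

variable {σ₀ : Overconvergent R ι →ₐ[R] Overconvergent R ι} (hσ₀ : IsFrobeniusLift σ₀)
  (hcomm : ∀ a, μ (σ₀ a) = σ (μ a))

include hcomm in
theorem apply_iterate_of_comm (m : ℕ) (b : Overconvergent R ι) : μ (σ₀^[m] b) = σ^[m] (μ b) := by
  induction m with
  | zero => rfl
  | succ m ih => rw [Function.iterate_succ_apply', hcomm, ih, Function.iterate_succ_apply']

include hμ hcomm in
theorem exists_fixedPoint_factor [Module.Flat R A] (hσ₀ : IsFrobeniusLift σ₀) {m : ℕ} [NeZero m]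
    (y : FixedPoint σ₀ m) (h : ∀ i, μ i = 0 → residuePoint y.1 i = 0) :
    ∃ x : FixedPoint σ m, x.1.comp μ = y.1 := by
  obtain ⟨x, hx⟩ := exists_factor hμ y.1 fun i hi =>
    fixed_hom_apply_eq_zero hσ₀ hcomm (NeZero.ne m) y.2
      (fun i hi => toResidue_eq_zero_iff.1 (h i hi)) hi
  refine ⟨⟨x, fun a => ?_⟩, AlgHom.ext hx⟩
  obtain ⟨b, rfl⟩ := hμ a
  rw [← apply_iterate_of_comm hcomm, hx, hx, y.2]

include hμ hcomm hσ₀ in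
-- Lift the coordinates of the residue point to `R_m` arbitrarily, evaluate overconvergent series
-- there, and replace the result by its limit under `σ₀^m`. This fixed point still reduces to the
-- given one, so `ker μ` has zero reduction and, by flatness, zero image.
theorem hasTeichmullerLifts_of_surjective [Finite ι] [Module.Flat R A] (hσ : IsFrobeniusLift σ) :
    HasTeichmullerLifts R A σ where
  frob := hσ
  finiteType := finiteType_specialFibre hμ
  exists_lift m _ x := by
    choose c hc using fun i => toResidue_surjective m (x (μ (Overconvergent.X i)))
    obtain ⟨y₀, hy₀⟩ := exists_eval_overconvergent (R := R) (ι := ι) (S := Unramified R m) c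
    have h0 : residuePoint y₀ = x.comp μ := residue_hom_ext fun i => by
      change toResidue R m (y₀ _) = x (μ _)
      rw [hy₀, hc]
    obtain ⟨y, hyfix, hy⟩ := exists_fixed_hom hσ₀ (NeZero.ne m) y₀ fun b =>
      toResidue_eq_iff.1 (residue_apply_iterate hσ₀ (residuePoint y₀) b)
    have h1 : residuePoint y = x.comp μ := by
      rw [← h0]
      exact AlgHom.ext fun b => toResidue_eq_iff.2 (hy b)
    obtain ⟨z, hz⟩ := exists_fixedPoint_factor hμ hcomm hσ₀ ⟨y, hyfix⟩ fun i hi => by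
      change residuePoint y i = 0
      rw [h1, AlgHom.comp_apply, hi, map_zero]
    refine ⟨z, AlgHom.ext fun a => ?_⟩
    obtain ⟨b, rfl⟩ := hμ a
    have h2 : z.1 (μ b) = y b := congrArg (fun f => f b) hz
    change toResidue R m (z.1 (μ b)) = x (μ b)
    rw [h2]
    exact congrArg (fun f => f b) h1

end Quotient

instance flat_overconvergent {ι : Type*} : Module.Flat R (Overconvergent R ι) := by
  haveI : Module.IsTorsionFree R (Overconvergent R ι) := by
    refine ⟨fun r hr x y hxy => Subtype.ext (MvPowerSeries.ext fun u => hr.left ?_)⟩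
    have h := congrArg (fun f : Overconvergent R ι =>
      MvPowerSeries.coeff u (f : MvPowerSeries ι R)) hxy
    simpa using h
  infer_instance

theorem hasTeichmullerLifts_overconvergent {ι : Type*} [Finite ι]
    {σ₀ : Overconvergent R ι →ₐ[R] Overconvergent R ι} (hσ₀ : IsFrobeniusLift σ₀) :
    HasTeichmullerLifts R (Overconvergent R ι) σ₀ :=
  hasTeichmullerLifts_of_surjective (μ := AlgHom.id R _) Function.surjective_id hσ₀
    (fun _ => rfl) hσ₀

end Lifts

/-! ### Closed points and fixed points: finiteness and counting -/

section Counting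

universe u

variable {R : Type u} [CommRing R] [IsDomain R] [IsDiscreteValuationRing R]
  [IsAdicComplete (maximalIdeal R) R] [Finite (ResidueField R)] [CharZero R]

variable {A : Type*} [CommRing A] [Algebra R A] {σ : A →ₐ[R] A}

theorem finite_degree_dvd (h : HasTeichmullerLifts R A σ) (m : ℕ) [NeZero m] :
    {P : ClosedPoint R A | P.degree ∣ m}.Finite := by
  haveI := finite_fixedPoint h m
  refine (Set.finite_range fun x : FixedPoint σ m => closedPoint (residuePoint x.1)).subset ?_
  intro P hP
  haveI : NeZero P.degree := ⟨(degree_pos h.finiteType P).ne'⟩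
  obtain ⟨t⟩ := nonempty_teichmullerLift h P
  exact ⟨t.fixedPoint hP, closedPoint_fixedPoint t hP⟩

/-- Every degree at most `m` divides `m!`, so all these closed points come from the finitely many
fixed points of `σ^(m!)`. -/
theorem finite_degree_le (h : HasTeichmullerLifts R A σ) (m : ℕ) :
    {P : ClosedPoint R A | P.degree ≤ m}.Finite := by
  haveI : NeZero m.factorial := ⟨m.factorial_ne_zero⟩
  exact (finite_degree_dvd h m.factorial).subset fun P hP =>
    Nat.dvd_factorial (degree_pos h.finiteType P) hP

open scoped Classical in
/-- Sums over fixed points are sums over closed points. -/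
theorem sum_fixedPoint_eq (h : HasTeichmullerLifts R A σ) {m M : ℕ} [NeZero m] (hmM : m ≤ M)
    [Fintype (FixedPoint σ m)] {K : Type*} [Semiring K] (τ : FixedPoint σ m → K)
    (hτ : ∀ x i, τ (FixedPoint.shift x i) = τ x) (Z : Set (ClosedPoint R A))
    (t : ∀ P : ClosedPoint R A, TeichmullerLift σ P) (v : ClosedPoint R A → K)
    (hv : ∀ P (hP : P.degree ∣ m), τ ((t P).fixedPoint hP) = v P)
    (T : Finset (ClosedPoint R A)) (hT : ∀ P, P ∈ T ↔ P ∈ Z ∧ P.degree ≤ M) :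
    ∑ x with closedPoint (residuePoint x.1) ∈ Z, τ x =
      ∑ P ∈ T, if P.degree ∣ m then (P.degree : K) * v P else 0 := by
  rw [← Finset.sum_fiberwise_of_maps_to (t := T)
    (g := fun x : FixedPoint σ m => closedPoint (residuePoint x.1))]
  · refine Finset.sum_congr rfl fun P hP => ?_
    have hPZ := ((hT P).1 hP).1
    rw [Finset.filter_filter]
    split_ifs with hd
    · haveI : NeZero P.degree := ⟨(degree_pos h.finiteType P).ne'⟩
      have hb := bijective_shift h ((t P).fixedPoint hd) (closedPoint_fixedPoint (t P) hd)
      rw [← Finset.sum_subtype_eq_sum_filter]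
      have h1 : ∀ i : Fin P.degree, τ ((t P).fixedPoint hd) = τ (((t P).fixedPoint hd).shift i) :=
        fun i => (hτ _ _).symm
      calc _ = ∑ x : {x : FixedPoint σ m // closedPoint (residuePoint x.1) = P}, τ x.1 := by
            refine Finset.sum_bij' (fun x _ => ⟨x.1, ?_⟩) (fun x _ => ⟨x.1, ?_⟩) ?_ ?_ ?_ ?_ ?_
            · exact x.2.2
            · exact ⟨by rw [x.2]; exact hPZ, x.2⟩
            all_goals simp
        _ = ∑ i : Fin P.degree, τ (((t P).fixedPoint hd).shift i) :=
            (Fintype.sum_bijective _ hb _ _ fun i => rfl).symm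
        _ = _ := by
            simp [hτ, hv P hd]
    · refine Finset.sum_eq_zero fun x hx => ?_
      rw [Finset.mem_filter] at hx
      exact absurd (hx.2.2 ▸ degree_closedPoint_dvd (residuePoint x.1)) hd
  · intro x hx
    rw [Finset.mem_filter] at hx
    exact (hT _).2 ⟨hx.2, (Nat.le_of_dvd (NeZero.pos m) (degree_closedPoint_dvd _)).trans hmM⟩

end Counting

/-! ### The exponential `exp(p π* a)` in an arbitrary `R`-algebra -/

section Character

universe u

variable {R : Type u} [CommRing R] [IsDomain R] [IsDiscreteValuationRing R]
  [IsAdicComplete (maximalIdeal R) R] [Finite (ResidueField R)] [CharZero R] {p : ℕ} [Fact p.Prime]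
  [CharP (ResidueField R) p] {πs : R} (hπs : πs ^ (p - 1) = -(p : R))

theorem expCoeff'_mul_expCoeff' (i j : ℕ) :
    expCoeff' hπs i * expCoeff' hπs j = (i + j).choose i * expCoeff' hπs (i + j) := by
  have h : ((i.factorial * j.factorial : ℕ) : R) ≠ 0 :=
    Nat.cast_ne_zero.2 (mul_ne_zero i.factorial_ne_zero j.factorial_ne_zero)
  apply mul_right_cancel₀ h
  have h1 := expCoeff'_mul hπs i
  have h2 := expCoeff'_mul hπs j
  have h3 := expCoeff'_mul hπs (i + j)
  have h4 : (((i + j).choose i * i.factorial * j.factorial : ℕ) : R) = (i + j).factorial := by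
    rw [Nat.choose_symm_add, Nat.add_choose_mul_factorial_mul_factorial]
  rw [← h4] at h3
  push_cast at h3 ⊢
  linear_combination h2 * πs ^ i + expCoeff' hπs j * (j.factorial : R) * h1 - h3 + pow_add πs i j

variable {S : Type*} [CommRing S] [Algebra R S]

/-- `X = exp(p π* a)`, read modulo all powers of the maximal ideal. -/
def IsScaledExp (a X : S) : Prop :=
  ∀ n, X - ∑ k ∈ Finset.range n, (expCoeff' hπs k * (p : R) ^ k) • a ^ k ∈
    (maximalIdeal R).map (algebraMap R S) ^ n

variable {hπs}

/-- Product of truncated exponentials: the pairs with `i + j < n` assemble into the truncation at `a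
+ b` by the binomial theorem, and the others contain `p^(i+j)`, which lies in `𝔪^n`. -/
theorem IsScaledExp.mul {a b X Y : S} (hX : IsScaledExp hπs a X) (hY : IsScaledExp hπs b Y) :
    IsScaledExp hπs (a + b) (X * Y) := by
  intro n
  set J := (maximalIdeal R).map (algebraMap R S) with hJ
  let c : ℕ → R := fun k => expCoeff' hπs k * (p : R) ^ k
  have hc : ∀ i j, c i * c j = (i + j).choose i * c (i + j) := by
    intro i j
    have := expCoeff'_mul_expCoeff' hπs i j
    simp only [c]
    linear_combination (p : R) ^ i * (p : R) ^ j * this -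
      ((i + j).choose i : R) * expCoeff' hπs (i + j) * pow_add (p : R) i j
  have hmem : ∀ i j (s : S), n ≤ i + j → (c i * c j) • s ∈ J ^ n := by
    intro i j s hij
    rw [Algebra.smul_def]
    refine Ideal.mul_mem_right _ _ (Ideal.pow_le_pow_right hij ?_)
    rw [hJ, ← Ideal.map_pow]
    refine Ideal.mem_map_of_mem _ ?_
    rw [hc]
    exact Ideal.mul_mem_left _ _ (Ideal.mul_mem_left _ _
      (Ideal.pow_mem_pow (natCast_prime_mem (R := R) (p := p)) _))
  have h1 : ∑ k ∈ Finset.range n, c k • (a + b) ^ k =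
      ∑ x ∈ Finset.range n ×ˢ Finset.range n with x.1 + x.2 < n,
        (c x.1 * c x.2) • (a ^ x.1 * b ^ x.2) := by
    rw [← Finset.sum_fiberwise_of_maps_to (t := Finset.range n) (g := fun x : ℕ × ℕ => x.1 + x.2)]
    · refine Finset.sum_congr rfl fun k hk => ?_
      rw [(Commute.all a b).add_pow', Finset.smul_sum, Finset.filter_filter]
      refine Finset.sum_congr ?_ fun x hx => ?_
      · ext x
        simp only [Finset.HasAntidiagonal.mem_antidiagonal, Finset.mem_filter, Finset.mem_product,
          Finset.mem_range] at hk ⊢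
        constructor
        · rintro rfl
          exact ⟨⟨by omega, by omega⟩, hk, rfl⟩
        · exact fun h => h.2.2
      · rw [Finset.mem_filter] at hx
        obtain ⟨-, -, rfl⟩ := hx
        rw [hc, ← Nat.cast_smul_eq_nsmul R, smul_smul, mul_comm]
    · intro x hx
      simp only [Finset.mem_filter] at hx
      exact Finset.mem_range.2 hx.2
  have h2 : (∑ k ∈ Finset.range n, c k • a ^ k) * (∑ k ∈ Finset.range n, c k • b ^ k) -
      ∑ k ∈ Finset.range n, c k • (a + b) ^ k ∈ J ^ n := by
    rw [h1, Finset.sum_mul_sum, ← Finset.sum_product',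
      ← Finset.sum_filter_add_sum_filter_not _ (fun x : ℕ × ℕ => x.1 + x.2 < n)]
    simp only [smul_mul_smul_comm]
    rw [add_sub_cancel_left]
    refine Ideal.sum_mem _ fun x hx => ?_
    rw [Finset.mem_filter, not_lt] at hx
    exact hmem _ _ _ hx.2
  have h3 := Ideal.add_mem _ (Ideal.add_mem _ (Ideal.mul_mem_right Y _ (hX n))
    (Ideal.mul_mem_left _ (∑ k ∈ Finset.range n, c k • a ^ k) (hY n))) h2
  convert h3 using 1
  simp only [c]
  ring

theorem isScaledExp_zero_one : IsScaledExp hπs (0 : S) 1 := by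
  intro n
  cases n with
  | zero => simp
  | succ n =>
    rw [Finset.sum_range_succ']
    simp [expCoeff'_zero hπs]

theorem IsScaledExp.prod {ι : Type*} (s : Finset ι) {a X : ι → S}
    (h : ∀ i ∈ s, IsScaledExp hπs (a i) (X i)) : IsScaledExp hπs (∑ i ∈ s, a i) (∏ i ∈ s, X i) := by
  classical
  induction s using Finset.induction_on with
  | empty => simpa using isScaledExp_zero_one
  | insert i s hi ih =>
    rw [Finset.sum_insert hi, Finset.prod_insert hi]
    exact (h i (Finset.mem_insert_self i s)).mul
      (ih fun j hj => h j (Finset.mem_insert_of_mem hj))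

theorem IsScaledExp.eq_one [IsHausdorff ((maximalIdeal R).map (algebraMap R S)) S] {X : S}
    (h : IsScaledExp hπs 0 X) : X = 1 := by
  refine sub_eq_zero.1 (IsHausdorff.haus
    (I := (maximalIdeal R).map (algebraMap R S)) inferInstance _ fun n => ?_)
  rw [SModEq.zero, smul_eq_mul, Ideal.mul_top]
  have h1 := Ideal.sub_mem _ (h n) (isScaledExp_zero_one (hπs := hπs) (S := S) n)
  simpa using h1

theorem IsScaledExp.map {S' : Type*} [CommRing S'] [Algebra R S'] (x : S →ₐ[R] S') {a X : S}
    (h : IsScaledExp hπs a X) : IsScaledExp hπs (x a) (x X) := by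
  intro n
  have h1 := Ideal.mem_map_of_mem (x : S →+* S') (h n)
  rw [Ideal.map_pow, Ideal.map_map, AlgHom.comp_algebraMap] at h1
  simpa using h1

end Character

/-! ### `p`-th roots of unity and orbit products of the splitting function -/

section RootsOfUnity

universe u

variable {R : Type u} [CommRing R] [IsDomain R] [IsDiscreteValuationRing R]
  [IsAdicComplete (maximalIdeal R) R] [Finite (ResidueField R)] [CharZero R]
  {p : ℕ} [Fact p.Prime] [CharP (ResidueField R) p]
  {πs : R} (hπs : πs ^ (p - 1) = -(p : R)) {m : ℕ} [NeZero m]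

variable (p πs) in
/-- `ζ` is a `p`-th root of unity, congruent to `1 + π* c` modulo `π* 𝔪`. -/
def IsRootOver (ζ : Unramified R m) (c : UnramifiedResidue R m) : Prop :=
  ζ ^ p = 1 ∧ ∃ w, ζ = 1 + πs • w ∧ toResidue R m w = c

include hπs in
theorem toResidue_smul_eq_zero (w : Unramified R m) : toResidue R m (πs • w) = 0 := by
  rw [toResidue_eq_zero_iff, Algebra.smul_def]
  exact Ideal.mul_mem_right _ _ (Ideal.mem_map_of_mem _ (mem_maximalIdeal_of_pow_eq hπs))

theorem algebraMap_unramified_injective :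
    Function.Injective (algebraMap R (Unramified R m)) := by
  intro a b h
  have h1 : algebraMap R (KBar R) a = algebraMap R (KBar R) b := congrArg Subtype.val h
  rw [IsScalarTower.algebraMap_eq R (FractionRing R) (KBar R)] at h1
  exact IsFractionRing.injective R (FractionRing R)
    ((algebraMap (FractionRing R) (KBar R)).injective h1)

include hπs in
-- Dividing `(1 + π* w)^p = 1` by `p π*` gives `w (1 - w^(p-1) - π* w g(w)) = 0`. As `w` reduces to
-- `0`, the second factor reduces to `1`, so `w = 0`.
theorem IsRootOver.eq_one {ζ : Unramified R m} (h : IsRootOver p πs ζ 0) : ζ = 1 := by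
  obtain ⟨h1, w, rfl, hw⟩ := h
  obtain ⟨g, hg⟩ := exists_one_add_pow_eq hπs
  have h2 := congrArg (Polynomial.aeval w) hg
  simp only [map_pow, map_add, map_one, map_mul, Polynomial.aeval_C, Polynomial.aeval_X,
    map_sub, ← Algebra.smul_def, smul_eq_mul] at h2
  rw [h1, left_eq_add] at h2
  have h3 : algebraMap R (Unramified R m) (p * πs) ≠ 0 := by
    rw [Ne, map_eq_zero_iff _ algebraMap_unramified_injective]
    exact mul_ne_zero (Nat.cast_ne_zero.2 (Fact.out : p.Prime).ne_zero) (ne_zero_of_pow_eq hπs)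
  have h4 : toResidue R m (1 - w ^ (p - 1) - πs • (w * Polynomial.aeval w g)) = 1 := by
    rw [map_sub, map_sub, toResidue_smul_eq_zero hπs, map_pow, hw, map_one,
      zero_pow (sub_one_pos_of_prime p).ne', sub_zero, sub_zero]
  have h5 : w * (1 - w ^ (p - 1) - πs • (w * Polynomial.aeval w g)) = 0 := by
    rw [Algebra.smul_def] at h2
    rcases mul_eq_zero.1 h2 with h | h
    · exact absurd h (by rwa [← map_mul])
    · rw [← h, mul_sub, mul_sub, mul_one, mul_pow_sub_one (Fact.out : p.Prime).ne_zero,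
        Algebra.smul_def, Algebra.smul_def]
      ring
  rcases mul_eq_zero.1 h5 with h | h
  · rw [h, smul_zero, add_zero]
  · rw [h, map_zero] at h4
    exact absurd h4 zero_ne_one

variable (p πs) in
theorem isRootOver_one : IsRootOver p πs (1 : Unramified R m) 0 :=
  ⟨one_pow p, 0, by simp, map_zero _⟩

include hπs in
theorem IsRootOver.mul {ζ ξ : Unramified R m} {c d : UnramifiedResidue R m}
    (h : IsRootOver p πs ζ c) (h' : IsRootOver p πs ξ d) : IsRootOver p πs (ζ * ξ) (c + d) := by
  obtain ⟨h1, w, rfl, rfl⟩ := h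
  obtain ⟨h2, v, rfl, rfl⟩ := h'
  refine ⟨by rw [mul_pow, h1, h2, one_mul], w + v + πs • (w * v), ?_, ?_⟩
  · simp only [Algebra.smul_def]
    ring
  · rw [map_add, toResidue_smul_eq_zero hπs, add_zero, map_add]

include hπs in
theorem IsRootOver.pow {ζ : Unramified R m} {c : UnramifiedResidue R m}
    (h : IsRootOver p πs ζ c) (k : ℕ) : IsRootOver p πs (ζ ^ k) (k * c) := by
  induction k with
  | zero => simpa using isRootOver_one p πs
  | succ k ih =>
    rw [pow_succ, Nat.cast_succ, add_one_mul]
    exact ih.mul hπs h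

variable (R p m) in
theorem natCast_unramifiedResidue_eq_zero : (p : UnramifiedResidue R m) = 0 := by
  rw [← map_natCast (algebraMap R (UnramifiedResidue R m))]
  exact algebraMap_unramifiedResidue_eq_zero m natCast_prime_mem

include hπs in
-- `ζ ξ^(p-1) = ζ ξ⁻¹` lies over `c + (p - 1) c = 0`, hence is `1`.
theorem IsRootOver.unique {ζ ξ : Unramified R m} {c : UnramifiedResidue R m}
    (h : IsRootOver p πs ζ c) (h' : IsRootOver p πs ξ c) : ζ = ξ := by
  have h1 := h.mul hπs (h'.pow hπs (p - 1))
  have h2 : c + ((p - 1 : ℕ) : UnramifiedResidue R m) * c = 0 := by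
    have := natCast_unramifiedResidue_eq_zero R p m
    rw [← Nat.sub_add_cancel (Fact.out : p.Prime).one_le] at this
    push_cast at this
    linear_combination c * this
  rw [h2] at h1
  have h3 := congrArg (· * ξ) (h1.eq_one hπs)
  simp only [mul_assoc, one_mul, pow_sub_one_mul (Fact.out : p.Prime).ne_zero, h'.1,
    mul_one] at h3
  exact h3

theorem IsRootOver.ne_one (hne : πs ≠ 0) {ζ : Unramified R m} {c : UnramifiedResidue R m}
    (h : IsRootOver p πs ζ c) (hc : c ≠ 0) : ζ ≠ 1 := by
  obtain ⟨-, w, rfl, rfl⟩ := h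
  intro h1
  rw [add_eq_left, Algebra.smul_def, mul_eq_zero,
    map_eq_zero_iff _ algebraMap_unramified_injective] at h1
  exact hc (by rw [h1.resolve_left hne, map_zero])

include hπs in
theorem exists_prod_eq_one_add {ι : Type*} (s : Finset ι) (W : ι → Unramified R m) :
    ∃ w, ∏ i ∈ s, (1 + πs • W i) = 1 + πs • w ∧
      toResidue R m w = ∑ i ∈ s, toResidue R m (W i) := by
  classical
  induction s using Finset.induction_on with
  | empty => exact ⟨0, by simp⟩
  | insert i s hi ih =>
    obtain ⟨w, hw, hw'⟩ := ih
    refine ⟨W i + w + πs • (W i * w), ?_, ?_⟩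
    · rw [Finset.prod_insert hi, hw]
      simp only [Algebra.smul_def]
      ring
    · rw [map_add, toResidue_smul_eq_zero hπs, add_zero, map_add, hw', Finset.sum_insert hi]

variable {A : Type*} [CommRing A] [Algebra R A] {σ : A →ₐ[R] A}

theorem sum_range_mul_eq {M : Type*} [AddCommMonoid M] (f : ℕ → M) (m a : ℕ) :
    ∑ l ∈ Finset.range (m * a), f l =
      ∑ j ∈ Finset.range m, ∑ i ∈ Finset.range a, f (j * a + i) := by
  induction m with
  | zero => simp
  | succ m ih => rw [Nat.succ_mul, Finset.sum_range_add, ih, Finset.sum_range_succ]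

variable (p) in
/-- The values at a fixed point of the splitting function `1 + π* W` of `G - σ G`. -/
theorem isRootOver_prod (hσ : IsFrobeniusLift σ) {a : ℕ} (ha : Nat.card (ResidueField R) = p ^ a)
    {G W : A} (hW : W - ∑ i ∈ Finset.range a, G ^ p ^ i ∈ (maximalIdeal R).map (algebraMap R A))
    (hexp : IsScaledExp hπs (G - σ G) ((1 + πs • W) ^ p)) {z : A →ₐ[R] Unramified R m}
    (hz : ∀ a, z (σ^[m] a) = z a) :
    IsRootOver p πs (∏ j ∈ Finset.range m, z (σ^[j] (1 + πs • W)))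
      (∑ l ∈ Finset.range (m * a), residuePoint z G ^ p ^ l) := by
  have hcoe : ∀ j : ℕ, σ^[j] = ⇑(σ ^ j) := fun j => (AlgHom.coe_pow σ j).symm
  refine ⟨?_, ?_⟩
  -- Only the `p`-th power is handled as an exponential at points. Its exponent is `p π*` times `∑
  -- z(σ^j G) - z(σ^(j+1) G)`, which telescopes to `z(G) - z(σ^m G) = 0`.
  · have h1 : IsScaledExp hπs (∑ j ∈ Finset.range m, z ((σ ^ j) (G - σ G)))
        (∏ j ∈ Finset.range m, z ((σ ^ j) ((1 + πs • W) ^ p))) :=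
      IsScaledExp.prod _ fun j _ => hexp.map (z.comp (σ ^ j))
    have h2 : ∑ j ∈ Finset.range m, z ((σ ^ j) (G - σ G)) = 0 := by
      have h3 : ∀ j, z ((σ ^ j) (G - σ G)) = z ((σ ^ j) G) - z ((σ ^ (j + 1)) G) := by
        intro j
        rw [map_sub, map_sub, pow_succ]
        rfl
      rw [Finset.sum_congr rfl fun j _ => h3 j, Finset.sum_range_sub', ← hcoe, ← hcoe, hz]
      simp
    rw [h2] at h1
    rw [← Finset.prod_pow, ← h1.eq_one]
    refine Finset.prod_congr rfl fun j _ => ?_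
    rw [hcoe, map_pow, map_pow]
  · obtain ⟨w, hw, hw'⟩ := exists_prod_eq_one_add hπs (Finset.range m)
      fun j => z ((σ ^ j) W)
    refine ⟨w, ?_, ?_⟩
    · rw [← hw]
      refine Finset.prod_congr rfl fun j _ => ?_
      rw [hcoe, map_add, map_one, map_smul, map_add, map_one, map_smul]
    -- The reduction of `z(σ^j W)` is `∑_{i<a} u^(p^(ja+i))` with `u` the reduction of `z(G)`; over
    -- all `j < m` this makes the full trace to `𝔽_p`.
    · rw [hw', sum_range_mul_eq]
      refine Finset.sum_congr rfl fun j _ => ?_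
      have h1 := residue_apply_eq_zero ((residuePoint z).comp (σ ^ j)) hW
      rw [map_sub, sub_eq_zero, map_sum] at h1
      refine h1.trans (Finset.sum_congr rfl fun i _ => ?_)
      have h2 : (residuePoint z) ((σ ^ j) G) = residuePoint z G ^ p ^ (a * j) := by
        rw [← hcoe, residue_apply_frobenius hσ, ha, pow_mul]
      rw [map_pow, AlgHom.comp_apply, h2, ← pow_mul, ← pow_add, mul_comm a]

end RootsOfUnity

/-! ### Orthogonality of characters -/

section CharacterSum

universe u

variable {R : Type u} [CommRing R] [IsDomain R] [IsDiscreteValuationRing R]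
  [IsAdicComplete (maximalIdeal R) R] [Finite (ResidueField R)] [CharZero R]
  {p : ℕ} [Fact p.Prime] [CharP (ResidueField R) p]
  {πs : R} (hπs : πs ^ (p - 1) = -(p : R)) {m : ℕ} [NeZero m]

/-- The trace polynomial has degree at most `p^(n-1) < |F|` and is nonzero, its coefficient at `X`
being `1`. So it cannot vanish on all of `F`. -/
theorem exists_sum_pow_ne_zero {F : Type*} [Field F] [Finite F] {n : ℕ} (hn : n ≠ 0)
    (hF : Nat.card F = p ^ n) : ∃ u : F, ∑ l ∈ Finset.range n, u ^ p ^ l ≠ 0 := by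
  letI := Fintype.ofFinite F
  by_contra! h
  have hp : 1 < p := (Fact.out : p.Prime).one_lt
  let P : Polynomial F := ∑ l ∈ Finset.range n, Polynomial.X ^ p ^ l
  have hdeg : P.natDegree < Fintype.card F := by
    rw [← Nat.card_eq_fintype_card, hF]
    refine (Polynomial.natDegree_sum_le_of_forall_le (n := p ^ (n - 1)) _ _ fun l hl => ?_).trans_lt
      (Nat.pow_lt_pow_right hp (by omega))
    rw [Polynomial.natDegree_X_pow]
    exact Nat.pow_le_pow_right hp.le (by have := Finset.mem_range.1 hl; omega)
  have h0 : P = 0 := Polynomial.eq_zero_of_natDegree_lt_card_of_eval_eq_zero' P Finset.univ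
    (fun u _ => by simpa [P, Polynomial.eval_finsetSum] using h u)
    (by simpa using hdeg)
  have h1 : P.coeff 1 = 1 := by
    simp only [P, Polynomial.finsetSum_coeff, Polynomial.coeff_X_pow]
    rw [Finset.sum_eq_single 0]
    · simp
    · intro l _ hl
      rw [if_neg]
      exact (Nat.one_lt_pow hl hp).ne
    · intro h
      exact absurd (Finset.mem_range.2 (Nat.pos_of_ne_zero hn)) h
  rw [h0, Polynomial.coeff_zero] at h1
  exact zero_ne_one h1

variable (p) in
theorem sum_range_pow_add {F : Type*} [Field F] [CharP F p] (n : ℕ) (u v : F) :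
    ∑ l ∈ Finset.range n, (u + v) ^ p ^ l =
      ∑ l ∈ Finset.range n, u ^ p ^ l + ∑ l ∈ Finset.range n, v ^ p ^ l := by
  rw [← Finset.sum_add_distrib]
  exact Finset.sum_congr rfl fun l _ => add_pow_char_pow u v p l

include hπs in
/-- Orthogonality of the characters `y ↦ ζ^Tr(∑ y_i c_i)`. -/
theorem sum_isRootOver {s a : ℕ} (ha : Nat.card (ResidueField R) = p ^ a)
    [Fintype (UnramifiedResidue R m)]
    (c : Fin s → UnramifiedResidue R m) (θ : (Fin s → UnramifiedResidue R m) → Unramified R m)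
    (hθ : ∀ y, IsRootOver p πs (θ y)
      (∑ l ∈ Finset.range (m * a), (∑ i, y i * c i) ^ p ^ l)) [Decidable (c = 0)] :
    ∑ y, θ y = if c = 0 then (Nat.card (ResidueField R) : Unramified R m) ^ (s * m) else 0 := by
  classical
  have hp : p.Prime := Fact.out
  haveI : CharP (UnramifiedResidue R m) p := charP_of_injective_algebraMap
    (algebraMap (ResidueField R) (UnramifiedResidue R m)).injective p
  split_ifs with h
  · have h1 : ∀ y, θ y = 1 := by
      intro y
      have := hθ y
      simp only [h, Pi.zero_apply, mul_zero, Finset.sum_const_zero] at this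
      rw [Finset.sum_eq_zero fun l _ => zero_pow (pow_pos hp.pos l).ne'] at this
      exact this.eq_one hπs
    simp only [h1, Finset.sum_const, Finset.card_univ, Fintype.card_fun, Fintype.card_fin,
      nsmul_eq_mul, mul_one]
    rw [← Nat.card_eq_fintype_card, natCard_unramifiedResidue, ← pow_mul, mul_comm m]
    push_cast
    rfl
  · obtain ⟨i, hi⟩ := Function.ne_iff.1 h
    rw [Pi.zero_apply] at hi
    have ha0 : a ≠ 0 := by
      rintro rfl
      have := Finite.one_lt_card (α := ResidueField R)
      rw [ha, pow_zero] at this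
      exact lt_irrefl _ this
    obtain ⟨u, hu⟩ := exists_sum_pow_ne_zero (p := p) (F := UnramifiedResidue R m)
      (mul_ne_zero (NeZero.ne m) ha0)
      (by rw [natCard_unramifiedResidue, ha, ← pow_mul, mul_comm])
    -- A vector at which `∑ y_i c_i = u` has nonzero trace, so that the character is nontrivial at
    -- `y₀`; translating the sum by `y₀` then forces it to vanish.
    let y₀ : Fin s → UnramifiedResidue R m := Pi.single i (u / c i)
    have hy₀ : ∑ j, y₀ j * c j = u := by
      rw [Finset.sum_eq_single i]
      · simp [y₀, hi]
      · intro j _ hj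
        simp [y₀, hj]
      · simp
    have h1 : ∀ y, θ (y + y₀) = θ y * θ y₀ := by
      intro y
      refine (hθ _).unique hπs ?_
      have := (hθ y).mul hπs (hθ y₀)
      rw [← sum_range_pow_add, ← Finset.sum_add_distrib] at this
      simpa only [Pi.add_apply, add_mul] using this
    have h2 : θ y₀ ≠ 1 := (hθ y₀).ne_one (ne_zero_of_pow_eq hπs) (by rw [hy₀]; exact hu)
    have h3 : (∑ y, θ y) * (θ y₀ - 1) = 0 := by
      rw [mul_sub, mul_one, Finset.sum_mul, ← Equiv.sum_comp (Equiv.addRight y₀) θ]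
      simp [h1]
    exact (mul_eq_zero.1 h3).resolve_right (sub_ne_zero.2 h2)

end CharacterSum

/-! ### Fixed points of `𝔸^(n+s)` above those of `𝔸^n` -/

section Fibration

universe u

variable {R : Type u} [CommRing R] [IsDomain R] [IsDiscreteValuationRing R]
  [IsAdicComplete (maximalIdeal R) R] [Finite (ResidueField R)] [CharZero R] {m : ℕ} [NeZero m]

theorem inclX_X {ι κ : Type*} (i : ι) :
    inclX R ι κ (Overconvergent.X i) = Overconvergent.X (Sum.inl i) := by
  apply Subtype.ext
  change MvPowerSeries.rename _ (MvPowerSeries.X i) = MvPowerSeries.X (Sum.inl i)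
  simp

theorem exists_residue_hom {ι : Type*} [Finite ι] (c : ι → UnramifiedResidue R m) :
    ∃ x : Overconvergent R ι →ₐ[R] UnramifiedResidue R m, ∀ i, x (Overconvergent.X i) = c i := by
  choose c' hc' using fun i => toResidue_surjective m (c i)
  obtain ⟨y, hy⟩ := exists_eval_overconvergent (R := R) (S := Unramified R m) c'
  refine ⟨residuePoint y, fun i => ?_⟩
  rw [AlgHom.comp_apply, hy, hc']

variable {ι κ : Type*} 
  {σ₀ : Overconvergent R ι →ₐ[R] Overconvergent R ι} (hσ₀ : IsFrobeniusLift σ₀)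
  {σ₁ : Overconvergent R (ι ⊕ κ) →ₐ[R] Overconvergent R (ι ⊕ κ)} (hσ₁ : IsFrobeniusLift σ₁)
  (hσ₁σ₀ : ∀ a, σ₁ (inclX R ι κ a) = inclX R ι κ (σ₀ a))

include hσ₁σ₀ in
theorem iterate_inclX (j : ℕ) (a : Overconvergent R ι) :
    σ₁^[j] (inclX R ι κ a) = inclX R ι κ (σ₀^[j] a) := by
  induction j with
  | zero => rfl
  | succ j ih => rw [Function.iterate_succ_apply', ih, hσ₁σ₀, Function.iterate_succ_apply']

/-- The projection of fixed points along `𝔸^(n+s) → 𝔸^n`. -/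
def FixedPoint.restrict (z : FixedPoint σ₁ m) : FixedPoint σ₀ m :=
  ⟨z.1.comp (inclX R ι κ), fun a => by
    rw [AlgHom.comp_apply, ← iterate_inclX hσ₁σ₀, z.2, AlgHom.comp_apply]⟩

variable [Finite ι] [Finite κ]

include hσ₀ hσ₁ in
/-- The fixed points over `x` are parametrised by the reductions of the coordinates `Y_i`. -/
theorem bijective_coordinates (x : FixedPoint σ₀ m) :
    Function.Bijective
      (fun (z : {z : FixedPoint σ₁ m // z.restrict hσ₁σ₀ = x}) (i : κ) =>
        residuePoint z.1.1 (Overconvergent.X (Sum.inr i))) := by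
  have hX : ∀ (z : FixedPoint σ₁ m) (i : ι), residuePoint (z.restrict hσ₁σ₀).1 (Overconvergent.X i) =
      residuePoint z.1 (Overconvergent.X (Sum.inl i)) := by
    intro z i
    rw [← inclX_X]
    rfl
  constructor
  · rintro ⟨z, rfl⟩ ⟨z', hz'⟩ h
    refine Subtype.ext (fixedPoint_ext hσ₁ (residue_hom_ext ?_))
    rintro (i | i)
    · rw [← hX z, ← hX z', hz']
    · exact congrFun h i
  · intro y
    obtain ⟨w, hw⟩ := exists_residue_hom
      (Sum.elim (fun i => residuePoint x.1 (Overconvergent.X i)) y)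
    obtain ⟨z, hz⟩ := (hasTeichmullerLifts_overconvergent hσ₁).exists_lift m w
    refine ⟨⟨z, fixedPoint_ext hσ₀ (residue_hom_ext fun i => ?_)⟩, funext fun i => ?_⟩
    · rw [hX, hz, hw]
      rfl
    · change residuePoint z.1 _ = _
      rw [hz, hw]
      rfl

end Fibration

/-! ### The character sum along the fibres -/

section Sum

universe u

variable {R : Type u} [CommRing R] [IsDomain R] [IsDiscreteValuationRing R]
  [IsAdicComplete (maximalIdeal R) R] [Finite (ResidueField R)] [CharZero R] {m : ℕ} [NeZero m]
  {p : ℕ} [Fact p.Prime] [CharP (ResidueField R) p] {πs : R} (hπs : πs ^ (p - 1) = -(p : R))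

open scoped Classical in
include hπs in
/-- Summing the values of the splitting function over the fixed points of `𝔸^(n+s)` selects the
fixed points of `𝔸^n` at which all `f_i` vanish. -/
theorem sum_splitting {ι : Type*} [Finite ι] {s a : ℕ} (ha : Nat.card (ResidueField R) = p ^ a)
    {σ₀ : Overconvergent R ι →ₐ[R] Overconvergent R ι} (hσ₀ : IsFrobeniusLift σ₀)
    {σ₁ : Overconvergent R (ι ⊕ Fin s) →ₐ[R] Overconvergent R (ι ⊕ Fin s)}
    (hσ₁ : IsFrobeniusLift σ₁)
    (hσ₁σ₀ : ∀ a, σ₁ (inclX R ι (Fin s) a) = inclX R ι (Fin s) (σ₀ a))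
    [Fintype (FixedPoint σ₀ m)] [Fintype (FixedPoint σ₁ m)]
    (f : Fin s → Overconvergent R ι) {W : Overconvergent R (ι ⊕ Fin s)}
    {G : Overconvergent R (ι ⊕ Fin s)}
    (hG : G = ∑ i, Overconvergent.X (Sum.inr i) * inclX R ι (Fin s) (f i))
    (hW : W - ∑ i ∈ Finset.range a, G ^ p ^ i ∈
      (maximalIdeal R).map (algebraMap R (Overconvergent R (ι ⊕ Fin s))))
    (hexp : IsScaledExp hπs (G - σ₁ G) ((1 + πs • W) ^ p))
    (F : FixedPoint σ₀ m → Unramified R m) :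
    ∑ z : FixedPoint σ₁ m, F (z.restrict hσ₁σ₀) *
        ∏ j ∈ Finset.range m, z.1 (σ₁^[j] (1 + πs • W)) =
      (Nat.card (ResidueField R) : Unramified R m) ^ (s * m) *
        ∑ x with ∀ i, residuePoint x.1 (f i) = 0, F x := by
  letI := Fintype.ofFinite (UnramifiedResidue R m)
  -- The sum is grouped by the projection to `𝔸^n`. On each fibre `F` is constant, and what remains
  -- is a character sum over the residues of the `Y_i`.
  rw [← Finset.sum_fiberwise_of_maps_to (t := Finset.univ)
    (g := fun z : FixedPoint σ₁ m => z.restrict hσ₁σ₀) fun _ _ => Finset.mem_univ _,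
    Finset.mul_sum, Finset.sum_filter]
  refine Finset.sum_congr rfl fun x _ => ?_
  have hb := bijective_coordinates hσ₀ hσ₁ hσ₁σ₀ x
  let e := Equiv.ofBijective _ hb
  let c : Fin s → UnramifiedResidue R m := fun i => residuePoint x.1 (f i)
  have hroot : ∀ z : {z : FixedPoint σ₁ m // z.restrict hσ₁σ₀ = x},
      IsRootOver p πs (∏ j ∈ Finset.range m, z.1.1 (σ₁^[j] (1 + πs • W)))
        (∑ l ∈ Finset.range (m * a), (∑ i, e z i * c i) ^ p ^ l) := by
    intro z
    have h := isRootOver_prod p hπs hσ₁ ha hW hexp z.1.2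
    have hg : residuePoint z.1.1 G = ∑ i, e z i * c i := by
      rw [hG, map_sum]
      refine Finset.sum_congr rfl fun i _ => ?_
      rw [map_mul]
      refine congrArg₂ _ rfl ?_
      change residuePoint (z.1.restrict hσ₁σ₀).1 (f i) = _
      rw [z.2]
    rwa [hg] at h
  have hsum := sum_isRootOver hπs ha c
    (fun y => ∏ j ∈ Finset.range m, (e.symm y).1.1 (σ₁^[j] (1 + πs • W)))
    fun y => by
      have := hroot (e.symm y)
      rwa [e.apply_symm_apply] at this
  rw [e.symm.sum_comp (fun z => ∏ j ∈ Finset.range m, z.1.1 (σ₁^[j] (1 + πs • W)))] at hsum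
  have hleft : ∑ z : FixedPoint σ₁ m with z.restrict hσ₁σ₀ = x, F (z.restrict hσ₁σ₀) *
        ∏ j ∈ Finset.range m, z.1 (σ₁^[j] (1 + πs • W)) =
      F x * ∑ z : {z : FixedPoint σ₁ m // z.restrict hσ₁σ₀ = x},
        ∏ j ∈ Finset.range m, z.1.1 (σ₁^[j] (1 + πs • W)) := by
    rw [Finset.mul_sum]
    refine Finset.sum_bij' (fun z hz => ⟨z, (Finset.mem_filter.1 hz).2⟩) (fun z _ => z.1)
      (fun _ _ => Finset.mem_univ _) (fun z _ => Finset.mem_filter.2 ⟨Finset.mem_univ _, z.2⟩)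
      (fun _ _ => rfl) (fun _ _ => rfl) fun z hz => ?_
    exact congrArg (F · * ∏ j ∈ Finset.range m, z.1 (σ₁^[j] (1 + πs • W)))
      (Finset.mem_filter.1 hz).2
  rw [hleft, hsum]
  by_cases hc : c = 0
  · have hc' : ∀ i, residuePoint x.1 (f i) = 0 := fun i => congrFun hc i
    rw [if_pos hc, if_pos hc', mul_comm]
  · have hc' : ¬ ∀ i, residuePoint x.1 (f i) = 0 := fun h => hc (funext h)
    rw [if_neg hc, if_neg hc', mul_zero]

end Sum

/-! ### Determinants and traces through eigenvalues -/

section Roots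

variable {K : Type*} [Field K] [IsAlgClosed K] {κ : Type*} [Fintype κ] [DecidableEq κ]

theorem charpoly_eq_prod_roots (M : Matrix κ κ K) :
    M.charpoly = (M.charpoly.roots.map fun l => Polynomial.X - Polynomial.C l).prod :=
  (IsAlgClosed.splits M.charpoly).eq_prod_roots_of_monic M.charpoly_monic

theorem card_roots_charpoly (M : Matrix κ κ K) : M.charpoly.roots.card = Fintype.card κ := by
  rw [← (IsAlgClosed.splits M.charpoly).natDegree_eq_card_roots, M.charpoly_natDegree_eq_dim]

/-- Over an algebraically closed field `f` splits into linear factors, and `det(M - β)` is the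
characteristic polynomial at `β` up to the sign `(-1)^dim`. -/
theorem det_aeval (M : Matrix κ κ K) (f : Polynomial K) :
    (Polynomial.aeval M f).det = (M.charpoly.roots.map f.eval).prod := by
  rw [(IsAlgClosed.splits f).eq_prod_roots]
  simp only [map_mul, Matrix.det_mul, Polynomial.eval_mul, Multiset.prod_map_mul]
  congr 1
  · simp [Matrix.algebraMap_eq_diagonal, card_roots_charpoly]
  · induction f.roots using Multiset.induction_on with
    | empty => simp
    | cons β s ih =>
      simp only [Multiset.map_cons, Multiset.prod_cons, map_mul, Matrix.det_mul,
        Polynomial.eval_mul, Multiset.prod_map_mul, ih]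
      congr 1
      have h1 : Polynomial.aeval M (Polynomial.X - Polynomial.C β) = -(Matrix.scalar κ β - M) := by
        simp [Matrix.algebraMap_eq_diagonal]
      rw [h1, Matrix.det_neg, ← Matrix.eval_charpoly]
      nth_rewrite 1 [charpoly_eq_prod_roots M]
      rw [Polynomial.eval_multiset_prod, Multiset.map_map, ← card_roots_charpoly M]
      induction M.charpoly.roots using Multiset.induction_on with
      | empty => simp
      | cons l t ih =>
        simp only [Multiset.card_cons, Multiset.map_cons, Multiset.prod_cons, pow_succ, ← ih]
        simp
        ring

/-- At each `c`, the characteristic polynomial of `f(M)` is the determinant of `(c - f)(M)`. By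
`det_aeval` its roots are the `f(λ)`, with multiplicity. -/
theorem trace_aeval (M : Matrix κ κ K) (f : Polynomial K) :
    (Polynomial.aeval M f).trace = (M.charpoly.roots.map f.eval).sum := by
  have h : (Polynomial.aeval M f).charpoly =
      ((M.charpoly.roots.map f.eval).map fun l => Polynomial.X - Polynomial.C l).prod := by
    refine Polynomial.funext fun c => ?_
    rw [Matrix.eval_charpoly, Polynomial.eval_multiset_prod]
    have h1 : Matrix.scalar κ c - Polynomial.aeval M f =
        Polynomial.aeval M (Polynomial.C c - f) := by
      simp [Matrix.algebraMap_eq_diagonal]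
    rw [h1, det_aeval]
    simp [Multiset.map_map]
  rw [Matrix.trace_eq_sum_roots_charpoly, h, Polynomial.roots_multiset_prod_X_sub_C]

theorem trace_pow_eq (M : Matrix κ κ K) (j : ℕ) :
    (M ^ j).trace = (M.charpoly.roots.map (· ^ j)).sum := by
  have := trace_aeval M (Polynomial.X ^ j)
  simpa using this

theorem reverse_charpoly_eq (M : Matrix κ κ K) :
    M.charpoly.reverse =
      (M.charpoly.roots.map fun l => 1 - Polynomial.C l * Polynomial.X).prod := by
  conv_lhs => rw [charpoly_eq_prod_roots M]
  induction M.charpoly.roots using Multiset.induction_on with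
  | empty => simpa using Polynomial.reverse_C (1 : K)
  | cons l s ih =>
    rw [Multiset.map_cons, Multiset.prod_cons, Polynomial.reverse_mul_of_domain, ih,
      Multiset.map_cons, Multiset.prod_cons]
    congr 1
    have h1 : (Polynomial.X : Polynomial K).reverse = 1 := by
      have := Polynomial.reverse_X_mul (Polynomial.C (1 : K))
      rwa [Polynomial.reverse_C, Polynomial.C_1, mul_one] at this
    rw [sub_eq_add_neg, ← Polynomial.C_neg, Polynomial.reverse_add_C, h1]
    simp [sub_eq_add_neg]

end Roots

/-! ### Logarithmic derivatives of Euler factors -/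

section LogDeriv

open PowerSeries

variable {K : Type*} [Field K]

/-- `X F' = F T`. -/
def HasLogDeriv (F T : PowerSeries K) : Prop := X * derivative K F = F * T

theorem HasLogDeriv.mul {F F' T T' : PowerSeries K} (h : HasLogDeriv F T) (h' : HasLogDeriv F' T') :
    HasLogDeriv (F * F') (T + T') := by
  unfold HasLogDeriv at *
  rw [Derivation.leibniz]
  simp only [smul_eq_mul]
  linear_combination F' * h + F * h'

theorem hasLogDeriv_one : HasLogDeriv (1 : PowerSeries K) 0 := by
  simp [HasLogDeriv, Derivation.map_one_eq_zero]

theorem HasLogDeriv.prod {ι : Type*} (s : Finset ι) {F T : ι → PowerSeries K}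
    (h : ∀ i ∈ s, HasLogDeriv (F i) (T i)) : HasLogDeriv (∏ i ∈ s, F i) (∑ i ∈ s, T i) := by
  classical
  induction s using Finset.induction_on with
  | empty => simpa using hasLogDeriv_one
  | insert i s hi ih =>
    rw [Finset.sum_insert hi, Finset.prod_insert hi]
    exact (h i (Finset.mem_insert_self i s)).mul
      (ih fun j hj => h j (Finset.mem_insert_of_mem hj))

/-- The logarithmic derivative is `d l T^d / (1 - l T^d)`, a geometric series. Both identities are
checked after multiplication by `1 - l T^d`. -/
theorem hasLogDeriv_inv {d : ℕ} (hd : d ≠ 0) (l : K) :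
    HasLogDeriv (1 - C l * X ^ d)⁻¹ (mk fun j => if j ≠ 0 ∧ d ∣ j then d * l ^ (j / d) else 0) := by
  set g : PowerSeries K := 1 - C l * X ^ d with hg
  have hg0 : constantCoeff g ≠ 0 := by simp [hg, hd]
  have h1 : g⁻¹ * g = 1 := PowerSeries.inv_mul_cancel _ hg0
  have h2 : X * derivative K g = - (C (d * l) * X ^ d) := by
    obtain ⟨d, rfl⟩ := Nat.exists_eq_succ_of_ne_zero hd
    rw [hg, map_sub, Derivation.map_one_eq_zero, Derivation.leibniz, derivative_C, derivative_pow,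
      derivative_X]
    simp only [smul_eq_mul, Nat.succ_eq_add_one, map_mul, map_natCast, Nat.add_sub_cancel]
    ring
  have h3 : (mk fun j => if j ≠ 0 ∧ d ∣ j then (d : K) * l ^ (j / d) else 0) * g =
      C (d * l) * X ^ d := by
    ext j
    rw [hg, mul_sub, mul_one, ← mul_assoc, mul_comm _ (C l), mul_assoc, map_sub, coeff_C_mul,
      coeff_mk, coeff_mul_X_pow', coeff_C_mul, coeff_X_pow]
    rcases lt_trichotomy j d with h | rfl | h
    · rw [if_neg, if_neg h.not_ge, if_neg h.ne]
      · ring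
      · rintro ⟨h0, h1⟩
        exact h.not_ge (Nat.le_of_dvd (Nat.pos_of_ne_zero h0) h1)
    · rw [if_pos ⟨hd, dvd_rfl⟩, if_pos le_rfl, if_pos rfl, Nat.div_self (Nat.pos_of_ne_zero hd)]
      simp
    · obtain ⟨k, rfl⟩ := Nat.exists_eq_add_of_le h.le
      have hk : k ≠ 0 := by omega
      rw [if_pos h.le, if_neg h.ne', Nat.add_sub_cancel_left, coeff_mk,
        Nat.add_div_left k (Nat.pos_of_ne_zero hd), pow_succ]
      by_cases hdk : d ∣ k
      · rw [if_pos ⟨by omega, dvd_add dvd_rfl hdk⟩, if_pos ⟨hk, hdk⟩]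
        ring
      · rw [if_neg fun h => hdk ((Nat.dvd_add_right dvd_rfl).1 h.2), if_neg fun h => hdk h.2]
        ring
  have h4 : derivative K (g⁻¹) * g + g⁻¹ * derivative K g = 0 := by
    have := congrArg (derivative K) h1
    rw [Derivation.leibniz, Derivation.map_one_eq_zero] at this
    simp only [smul_eq_mul] at this
    linear_combination this
  have hgne : g ≠ 0 := by rintro h; simp [h] at hg0
  unfold HasLogDeriv
  apply mul_right_cancel₀ hgne
  linear_combination X * h4 - g⁻¹ * h2 - g⁻¹ * h3

/-- The factor is the product of `1 / (1 - l T^d)` over the eigenvalues `l`, and the power sums of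
the eigenvalues are traces of powers. -/
theorem hasLogDeriv_reverse_charpoly [IsAlgClosed K] {κ : Type*} [Fintype κ] [DecidableEq κ]
    (M : Matrix κ κ K) {d : ℕ} (hd : d ≠ 0) :
    HasLogDeriv ((Polynomial.expand K d M.charpoly.reverse : Polynomial K) : PowerSeries K)⁻¹
      (mk fun j => if j ≠ 0 ∧ d ∣ j then d * (M ^ (j / d)).trace else 0) := by
  simp only [trace_pow_eq]
  rw [reverse_charpoly_eq]
  induction M.charpoly.roots using Multiset.induction_on with
  | empty =>
    convert hasLogDeriv_one (K := K) using 1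
    · simp
    · ext j
      simp
  | cons l s ih =>
    have := (hasLogDeriv_inv hd l).mul ih
    convert this using 1
    · rw [← PowerSeries.mul_inv_rev, mul_comm]
      simp
    · ext j
      simp only [Multiset.map_cons, Multiset.sum_cons, map_add, coeff_mk]
      split_ifs
      · ring
      · simp

theorem HasLogDeriv.coeff {F T : PowerSeries K} (h : HasLogDeriv F T) (m : ℕ) :
    (m : K) * PowerSeries.coeff m F = ∑ x ∈ Finset.HasAntidiagonal.antidiagonal m,
      PowerSeries.coeff x.1 F * PowerSeries.coeff x.2 T := by
  rw [← PowerSeries.coeff_mul, ← h]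
  cases m with
  | zero => simp
  | succ m =>
    rw [coeff_succ_X_mul, coeff_derivative]
    push_cast
    ring

end LogDeriv

/-! ### Matrices of iterated `σ`-linear maps -/

section FibreMatrix

variable {A S : Type*} [CommRing A] [CommRing S] {M : Type*} [AddCommGroup M] [Module A M]
  {κ : Type*} [Fintype κ] [DecidableEq κ]

/-- `C · σ(C) ⋯ σ^{m-1}(C)`. -/
def iterMatrix (σ : A →+* A) (C : Matrix κ κ A) : ℕ → Matrix κ κ A
  | 0 => 1
  | m + 1 => C * (iterMatrix σ C m).map σ

variable {σ : A →+* A} {C : Matrix κ κ A}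

theorem iterMatrix_add (a b : ℕ) :
    iterMatrix σ C (a + b) = iterMatrix σ C a * (iterMatrix σ C b).map σ^[a] := by
  induction a with
  | zero => simp [iterMatrix]
  | succ a ih =>
    rw [Nat.add_right_comm, iterMatrix, ih, iterMatrix, Matrix.map_mul, Matrix.mul_assoc,
      Matrix.map_map, Function.iterate_succ']

theorem iterMatrix_one : iterMatrix σ C 1 = C := by simp [iterMatrix]

variable {x : A →+* S}

theorem map_map_iterate {m : ℕ} (hx : ∀ a, x (σ^[m] a) = x a) (D : Matrix κ κ A) :
    (D.map σ^[m]).map x = D.map x := by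
  ext i j
  exact hx _

theorem iterMatrix_mul_map {m : ℕ} (hx : ∀ a, x (σ^[m] a) = x a) (e : ℕ) :
    (iterMatrix σ C (e * m)).map x = ((iterMatrix σ C m).map x) ^ e := by
  induction e with
  | zero => simp [iterMatrix]
  | succ e ih =>
    rw [Nat.succ_mul, add_comm, iterMatrix_add, Matrix.map_mul, map_map_iterate hx, ih, pow_succ']

/-- Applying `σ` to `C σ(C) ⋯ σ^(m-1)(C)` moves the first factor to the end when evaluated at `x`,
because `x ∘ σ^m = x`; the trace is invariant under cyclic permutation. -/
theorem trace_iterMatrix_comp {m : ℕ} (hx : ∀ a, x (σ^[m] a) = x a) :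
    ((iterMatrix σ C m).map (x.comp σ)).trace = ((iterMatrix σ C m).map x).trace := by
  cases m with
  | zero => simp [iterMatrix]
  | succ m =>
    have h1 : (iterMatrix σ C (m + 1)).map (x.comp σ) =
        ((iterMatrix σ C m).map (x.comp σ)) * C.map x := by
      rw [iterMatrix_add, iterMatrix_one, Matrix.map_mul]
      congr 1
      ext i j
      change x (σ (σ^[m] _)) = _
      rw [← Function.iterate_succ_apply' (f := σ), hx]
      rfl
    rw [h1, Matrix.trace_mul_comm, iterMatrix, Matrix.map_mul, Matrix.map_map]
    rfl

theorem map_iterMatrix {B : Type*} [CommRing B] {σ₁ : B →+* B} (g : A →+* B)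
    (hg : ∀ a, σ₁ (g a) = g (σ a)) (m : ℕ) :
    (iterMatrix σ C m).map g = iterMatrix σ₁ (C.map g) m := by
  induction m with
  | zero => simp [iterMatrix]
  | succ m ih =>
    rw [iterMatrix, iterMatrix, ← ih, Matrix.map_mul, Matrix.map_map, Matrix.map_map]
    congr 2
    ext a
    exact (hg a).symm

theorem iterMatrix_unit (Φ : A) (m : ℕ) :
    iterMatrix σ (Matrix.of fun _ _ : Unit => Φ) m =
      Matrix.of fun _ _ => ∏ j ∈ Finset.range m, σ^[j] Φ := by
  induction m with
  | zero => ext; simp [iterMatrix]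
  | succ m ih =>
    ext i j
    rw [iterMatrix, ih, Finset.prod_range_succ']
    simp [Matrix.mul_apply, mul_comm, ← Function.iterate_succ_apply' (f := σ)]

theorem iterate_basis (φ : M →ₛₗ[σ] M) (b : Module.Basis κ A M)
    (hC : ∀ i j, C i j = b.repr (φ (b j)) i) (m : ℕ) (j : κ) :
    φ^[m] (b j) = ∑ i, iterMatrix σ C m i j • b i := by
  induction m with
  | zero => simp [iterMatrix, Matrix.one_apply]
  | succ m ih =>
    have hφ : ∀ l, φ (b l) = ∑ i, C i l • b i := fun l => by simp only [hC, b.sum_repr]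
    rw [Function.iterate_succ_apply', ih, map_sum]
    simp only [map_smulₛₗ, hφ, Finset.smul_sum, iterMatrix, Matrix.mul_apply, Finset.sum_smul]
    rw [Finset.sum_comm]
    refine Finset.sum_congr rfl fun i _ => Finset.sum_congr rfl fun l _ => ?_
    rw [smul_smul, mul_comm]
    rfl

/-- The basis of the fibre given by a basis. -/
def fibreBasis (x : A →+* S) (b : Module.Basis κ A M) : Module.Basis κ S (Fibre x M) :=
  letI := x.toAlgebra
  Algebra.TensorProduct.basis S b

theorem toMatrix_fibrePow (φ : M →ₛₗ[σ] M) (b : Module.Basis κ A M)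
    (hC : ∀ i j, C i j = b.repr (φ (b j)) i) (m : ℕ) (hx : ∀ a, x (σ^[m] a) = x a) :
    LinearMap.toMatrix (fibreBasis x b) (fibreBasis x b) (fibrePow x φ m hx) =
      (iterMatrix σ C m).map x := by
  letI := x.toAlgebra
  ext i j
  rw [LinearMap.toMatrix_apply]
  have h1 : fibreBasis x b j = (1 ⊗ₜ[A] b j : S ⊗[A] M) := Algebra.TensorProduct.basis_apply b j
  have h2 : fibrePow x φ m hx (fibreBasis x b j) = (1 ⊗ₜ[A] φ^[m] (b j) : S ⊗[A] M) := by
    rw [h1]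
    change LinearMap.liftBaseChange (R := A) (M := M) (N := S ⊗[A] M) S _ (1 ⊗ₜ[A] b j) = _
    rw [LinearMap.liftBaseChange_tmul, one_smul]
    rfl
  rw [h2]
  change (Algebra.TensorProduct.basis S b).repr _ i = _
  rw [Algebra.TensorProduct.basis_repr_tmul, iterate_basis φ b hC]
  simp [Finsupp.single_apply]
  rfl

theorem ofMatrix_repr (i j : κ) : C i j = (Pi.basisFun A κ).repr
    (ofMatrix σ C (Pi.basisFun A κ j)) i := by
  simp [ofMatrix, Matrix.mulVec, dotProduct, Pi.single_apply, apply_ite σ]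

end FibreMatrix

/-! ### Euler factors as reversed characteristic polynomials -/

section EulerFactors

open scoped Kronecker

variable {R : Type*} [CommRing R] [IsDomain R] [IsLocalRing R]
  {A : Type*} [CommRing A] [Algebra R A] {σ : A →ₐ[R] A}

/-- A Teichmüller lifting as a geometric point. -/
def TeichmullerLift.geom {P : ClosedPoint R A} (t : TeichmullerLift σ P) : A →ₐ[R] KBar R :=
  (Unramified R P.degree).val.comp t.toHom

theorem TeichmullerLift.geom_fixed {P : ClosedPoint R A} (t : TeichmullerLift σ P) (k : ℕ) (a : A) :
    (t.geom : A →+* KBar R) ((σ : A →+* A)^[k * P.degree] a) = (t.geom : A →+* KBar R) a :=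
  congrArg Subtype.val
    (apply_iterate_mul (t.toHom : A →+* Unramified R P.degree) (σ := (σ : A →+* A)) t.fixed k a)

theorem detOneSub_eq {d : ℕ} {V : Type*} [AddCommGroup V] [Module (Unramified R d) V]
    [Module.Free (Unramified R d) V] [Module.Finite (Unramified R d) V]
    {κ : Type*} [Fintype κ] [DecidableEq κ] (b : Module.Basis κ (Unramified R d) V)
    (f : V →ₗ[Unramified R d] V) :
    detOneSub f = ((LinearMap.toMatrix b b f).map
      (algebraMap (Unramified R d) (KBar R))).charpoly.reverse := by
  rw [detOneSub, ← LinearMap.charpoly_toMatrix f b, Matrix.charpoly_map, Polynomial.reverse,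
    Polynomial.reverse, Polynomial.reflect_map,
    Polynomial.natDegree_map_eq_of_injective (FaithfulSMul.algebraMap_injective _ _)]

theorem map_kronecker {S K : Type*} [CommRing S] [CommRing K] (g : S →+* K) {κ κ' : Type*}
    (D : Matrix κ' κ' S) (C : Matrix κ κ S) : (D ⊗ₖ C).map g = D.map g ⊗ₖ C.map g := by
  ext i j
  simp

theorem detOneSub_map {d : ℕ} {V W : Type*} [AddCommGroup V] [Module (Unramified R d) V]
    [Module.Free (Unramified R d) V] [Module.Finite (Unramified R d) V]
    [AddCommGroup W] [Module (Unramified R d) W]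
    [Module.Free (Unramified R d) W] [Module.Finite (Unramified R d) W]
    {κ κ' : Type*} [Fintype κ] [DecidableEq κ] [Fintype κ'] [DecidableEq κ']
    (b : Module.Basis κ (Unramified R d) V) (c : Module.Basis κ' (Unramified R d) W)
    (f : V →ₗ[Unramified R d] V) (g : W →ₗ[Unramified R d] W) :
    detOneSub (TensorProduct.map g f) =
      ((LinearMap.toMatrix c c g).map (algebraMap (Unramified R d) (KBar R)) ⊗ₖ
        (LinearMap.toMatrix b b f).map (algebraMap (Unramified R d) (KBar R))).charpoly.reverse := by
  rw [detOneSub_eq (c.tensorProduct b), TensorProduct.toMatrix_map, map_kronecker]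

theorem detOneSub_map₃ {d : ℕ} {V W X : Type*} [AddCommGroup V] [Module (Unramified R d) V]
    [Module.Free (Unramified R d) V] [Module.Finite (Unramified R d) V]
    [AddCommGroup W] [Module (Unramified R d) W]
    [Module.Free (Unramified R d) W] [Module.Finite (Unramified R d) W]
    [AddCommGroup X] [Module (Unramified R d) X]
    [Module.Free (Unramified R d) X] [Module.Finite (Unramified R d) X]
    {κ κ' κ'' : Type*} [Fintype κ] [DecidableEq κ] [Fintype κ'] [DecidableEq κ']
    [Fintype κ''] [DecidableEq κ'']
    (b : Module.Basis κ (Unramified R d) V) (c : Module.Basis κ' (Unramified R d) W)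
    (e : Module.Basis κ'' (Unramified R d) X)
    (f : V →ₗ[Unramified R d] V) (g : W →ₗ[Unramified R d] W) (h : X →ₗ[Unramified R d] X) :
    detOneSub (TensorProduct.map (TensorProduct.map g f) h) =
      ((LinearMap.toMatrix c c g).map (algebraMap (Unramified R d) (KBar R)) ⊗ₖ
        (LinearMap.toMatrix b b f).map (algebraMap (Unramified R d) (KBar R)) ⊗ₖ
        (LinearMap.toMatrix e e h).map (algebraMap (Unramified R d) (KBar R))).charpoly.reverse := by
  rw [detOneSub_map e (c.tensorProduct b), TensorProduct.toMatrix_map, map_kronecker]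

variable {M N L : Type*} [AddCommGroup M] [Module A M] [Module.Free A M] [Module.Finite A M]
  [AddCommGroup N] [Module A N] [Module.Free A N] [Module.Finite A N]
  [AddCommGroup L] [Module A L] [Module.Free A L] [Module.Finite A L]
  {κ κ' κ'' : Type*} [Fintype κ] [DecidableEq κ] [Fintype κ'] [DecidableEq κ']
  [Fintype κ''] [DecidableEq κ'']
  {φ : M →ₛₗ[(σ : A →+* A)] M} {ψ : N →ₛₗ[(σ : A →+* A)] N} {χ : L →ₛₗ[(σ : A →+* A)] L}
  {b : Module.Basis κ A M} {C : Matrix κ κ A} (hC : ∀ i j, C i j = b.repr (φ (b j)) i)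
  {c : Module.Basis κ' A N} {D : Matrix κ' κ' A} (hD : ∀ i j, D i j = c.repr (ψ (c j)) i)
  {e : Module.Basis κ'' A L} {E : Matrix κ'' κ'' A} (hE : ∀ i j, E i j = e.repr (χ (e j)) i)
  {P : ClosedPoint R A} (t : TeichmullerLift σ P)

/-- The matrix of `φ^m` at a geometric point. -/
def matrixAt (σ : A →ₐ[R] A) {κ : Type*} [Fintype κ] [DecidableEq κ] (C : Matrix κ κ A) (m : ℕ)
    (y : A →ₐ[R] KBar R) : Matrix κ κ (KBar R) :=
  (iterMatrix (σ : A →+* A) C m).map (y : A →+* KBar R)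

/-- The basis of the fibre at a Teichmüller lifting. -/
def TeichmullerLift.basis {κ : Type*} (b : Module.Basis κ A M) :
    Module.Basis κ (Unramified R P.degree) (Fibre (t.toHom : A →+* Unramified R P.degree) M) :=
  fibreBasis (t.toHom : A →+* Unramified R P.degree) b

include hC in
theorem toMatrix_frob (k : ℕ) :
    (LinearMap.toMatrix (t.basis b) (t.basis b) (t.frob φ k)).map
      (algebraMap (Unramified R P.degree) (KBar R)) = matrixAt σ C (k * P.degree) t.geom := by
  have h := toMatrix_fibrePow (x := (t.toHom : A →+* Unramified R P.degree)) (σ := (σ : A →+* A))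
    φ b hC (k * P.degree) (apply_iterate_mul _ t.fixed k)
  refine (congrArg (fun X : Matrix κ κ (Unramified R P.degree) =>
    X.map (algebraMap (Unramified R P.degree) (KBar R))) h).trans ?_
  rw [Matrix.map_map]
  rfl

include hC in
theorem detOneSub_frob (k : ℕ) :
    detOneSub (t.frob φ k) = (matrixAt σ C (k * P.degree) t.geom).charpoly.reverse := by
  rw [← toMatrix_frob hC]
  exact detOneSub_eq _ _

include hC hD in
theorem detOneSub_tensor (k l : ℕ) :
    detOneSub (TensorProduct.map (t.frob ψ l) (t.frob φ k)) =
      (matrixAt σ D (l * P.degree) t.geom ⊗ₖ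
        matrixAt σ C (k * P.degree) t.geom).charpoly.reverse := by
  rw [← toMatrix_frob hC, ← toMatrix_frob hD]
  exact detOneSub_map _ _ _ _

include hC hD hE in
theorem detOneSub_tensor₃ (k l i : ℕ) :
    detOneSub (TensorProduct.map (TensorProduct.map (t.frob ψ l) (t.frob φ k)) (t.frob χ i)) =
      (matrixAt σ D (l * P.degree) t.geom ⊗ₖ matrixAt σ C (k * P.degree) t.geom ⊗ₖ
        matrixAt σ E (i * P.degree) t.geom).charpoly.reverse := by
  rw [← toMatrix_frob hC, ← toMatrix_frob hD, ← toMatrix_frob hE]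
  exact detOneSub_map₃ _ _ _ _ _ _

/-- Used to read traces of powers of the Frobenius at a closed point of degree `d` as contributions
of fixed points of `σ^(d i)`. -/
theorem matrixAt_pow (k i : ℕ) :
    matrixAt σ C (k * P.degree) t.geom ^ i = matrixAt σ C (k * (P.degree * i)) t.geom := by
  rw [matrixAt, matrixAt, ← iterMatrix_mul_map (t.geom_fixed k)]
  congr 2
  ring

theorem kronecker_pow {K : Type*} [CommRing K] (D : Matrix κ' κ' K) (C : Matrix κ κ K) (i : ℕ) :
    (D ⊗ₖ C) ^ i = (D ^ i) ⊗ₖ (C ^ i) := by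
  induction i with
  | zero => simp
  | succ i ih => rw [pow_succ, ih, pow_succ, pow_succ, Matrix.mul_kronecker_mul]

end EulerFactors

/-! ### Newton's recursion for Euler products -/

section EulerProduct

universe u

variable {R : Type u} [CommRing R] [IsDomain R] [IsDiscreteValuationRing R]
  [IsAdicComplete (maximalIdeal R) R] [Finite (ResidueField R)] [CharZero R]
  {A : Type*} [CommRing A] [Algebra R A] {σ : A →ₐ[R] A}

/-- A fixed point as a geometric point. -/
def FixedPoint.geom {m : ℕ} (x : FixedPoint σ m) : A →ₐ[R] KBar R :=
  (Unramified R m).val.comp x.1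

theorem FixedPoint.geom_fixed {m : ℕ} (x : FixedPoint σ m) (k : ℕ) (a : A) :
    (x.geom : A →+* KBar R) ((σ : A →+* A)^[k * m] a) = (x.geom : A →+* KBar R) a :=
  congrArg Subtype.val
    (apply_iterate_mul (x.1 : A →+* Unramified R m) (σ := (σ : A →+* A)) x.2 k a)

theorem FixedPoint.geom_apply {m : ℕ} (x : FixedPoint σ m) (a : A) :
   x.geom a = (x.1 a : KBar R) := rfl
theorem TeichmullerLift.geom_apply {P : ClosedPoint R A} (t : TeichmullerLift σ P)  (a : A) :
   t.geom a = (t.toHom a : KBar R) := rfl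
theorem TeichmullerLift.fixedPoint_apply {P : ClosedPoint R A} (t : TeichmullerLift σ P) {m : ℕ}
    (h : P.degree ∣ m) (a : A) :
   (t.fixedPoint h).1 a = Subalgebra.inclusion (unramified_le h) (t.toHom a) := rfl
theorem TeichmullerLift.coe_fixedPoint_apply {P : ClosedPoint R A} (t : TeichmullerLift σ P) {m : ℕ}
    (h : P.degree ∣ m) (a : A) :
   ((t.fixedPoint h).1 a : KBar R) = (t.toHom a : KBar R) := by
  rw [TeichmullerLift.fixedPoint_apply, Subalgebra.coe_inclusion]
theorem TeichmullerLift.geom_fixedPoint {P : ClosedPoint R A} (t : TeichmullerLift σ P) {m : ℕ}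
    (h : P.degree ∣ m) : (t.fixedPoint h).geom = t.geom := by
  refine AlgHom.ext fun a => ?_
  rw [FixedPoint.geom_apply, TeichmullerLift.geom_apply, TeichmullerLift.coe_fixedPoint_apply]

theorem FixedPoint.shift_succ {m : ℕ} (x : FixedPoint σ m) (i : ℕ) :
    x.shift (i + 1) = (x.shift i).shift 1 := by
  apply Subtype.ext
  ext a
  simp only [FixedPoint.shift, pow_succ, pow_zero, one_mul]
  rfl

variable {κ : Type*} [Fintype κ] [DecidableEq κ]

/-- The fixed points over one closed point form a `σ`-orbit, so they all contribute equally to a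
point sum. -/
theorem trace_matrixAt_shift (C : Matrix κ κ A) {m : ℕ} (x : FixedPoint σ m) (k i : ℕ) :
    (matrixAt σ C (k * m) (x.shift i).geom).trace = (matrixAt σ C (k * m) x.geom).trace := by
  induction i with
  | zero => rfl
  | succ i ih =>
    rw [FixedPoint.shift_succ, ← ih]
    exact trace_iterMatrix_comp ((x.shift i).geom_fixed k)

variable {κ' κ'' : Type*} [Fintype κ'] [DecidableEq κ'] [Fintype κ''] [DecidableEq κ'']

/-- A power series is determined by its constant coefficient and its logarithmic derivative. -/
theorem eq_of_recursion {K : Type*} [Field K] [CharZero K] {F F' : PowerSeries K} {s : ℕ → K}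
    (h0 : PowerSeries.coeff 0 F = PowerSeries.coeff 0 F') (hs : s 0 = 0)
    (hF : ∀ m : ℕ, (m : K) * PowerSeries.coeff m F =
      ∑ x ∈ Finset.HasAntidiagonal.antidiagonal m, PowerSeries.coeff x.1 F * s x.2)
    (hF' : ∀ m : ℕ, (m : K) * PowerSeries.coeff m F' =
      ∑ x ∈ Finset.HasAntidiagonal.antidiagonal m, PowerSeries.coeff x.1 F' * s x.2) : F = F' := by
  ext m
  induction m using Nat.strong_induction_on with
  | _ m ih =>
    rcases Nat.eq_zero_or_pos m with rfl | hm
    · exact h0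
    · have hm' : (m : K) ≠ 0 := Nat.cast_ne_zero.2 hm.ne'
      apply mul_left_cancel₀ hm'
      rw [hF, hF']
      refine Finset.sum_congr rfl fun x hx => ?_
      rw [Finset.HasAntidiagonal.mem_antidiagonal] at hx
      rcases Nat.eq_zero_or_pos x.2 with h2 | h2
      · rw [h2, hs, mul_zero, mul_zero]
      · rw [ih x.1 (by omega)]

theorem rescale_recursion {K : Type*} [Field K] {F : PowerSeries K} {s : ℕ → K} (c : K)
    (hF : ∀ m : ℕ, (m : K) * PowerSeries.coeff m F =
      ∑ x ∈ Finset.HasAntidiagonal.antidiagonal m, PowerSeries.coeff x.1 F * s x.2) (m : ℕ) :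
    (m : K) * PowerSeries.coeff m (PowerSeries.rescale c F) =
      ∑ x ∈ Finset.HasAntidiagonal.antidiagonal m,
        PowerSeries.coeff x.1 (PowerSeries.rescale c F) * (c ^ x.2 * s x.2) := by
  rw [PowerSeries.coeff_rescale, mul_left_comm, hF, Finset.mul_sum]
  refine Finset.sum_congr rfl fun x hx => ?_
  rw [Finset.HasAntidiagonal.mem_antidiagonal] at hx
  rw [PowerSeries.coeff_rescale, ← hx, pow_add]
  ring

/-- Factors congruent to `1` modulo `T^(m+1)` do not affect coefficients up to `m`; this makes the
Euler product agree with its finite subproducts. -/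
theorem coeff_prod_eq_of_forall {K ι : Type*} [Field K] {s : Finset ι} {F : ι → PowerSeries K}
    {m : ℕ} (h : ∀ i ∈ s, ∀ j ≤ m, PowerSeries.coeff j (F i) = PowerSeries.coeff j 1)
    (G : PowerSeries K) {j : ℕ} (hj : j ≤ m) :
    PowerSeries.coeff j (G * ∏ i ∈ s, F i) = PowerSeries.coeff j G := by
  have h1 : ∀ i ∈ s, PowerSeries.X ^ (m + 1) ∣ F i - 1 := fun i hi => by
    rw [PowerSeries.X_pow_dvd_iff]
    intro l hl
    rw [map_sub, h i hi l (by omega), sub_self]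
  have h2 : PowerSeries.X ^ (m + 1) ∣ (∏ i ∈ s, F i) - 1 := by
    classical
    induction s using Finset.induction_on with
    | empty => simp
    | insert i s hi ih =>
      rw [Finset.prod_insert hi]
      have := dvd_add ((h1 i (Finset.mem_insert_self i s)).mul_right (∏ i ∈ s, F i))
        (ih (fun i hi => h i (Finset.mem_insert_of_mem hi))
          fun i hi => h1 i (Finset.mem_insert_of_mem hi))
      convert this using 1
      ring
  have h3 := (PowerSeries.X_pow_dvd_iff.1 (h2.mul_left G)) j (by omega)
  rw [mul_sub, mul_one, map_sub, sub_eq_zero] at h3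
  exact h3

/-- The sum of `τ` over the fixed points of `σ^j` lying over `Z`. -/
def pointSum (Z : Set (ClosedPoint R A)) (τ : ∀ j, FixedPoint σ j → KBar R) (j : ℕ) : KBar R :=
  -- A logarithmic derivative `T F' / F` has no constant term, so the value at `0` must be `0`.
  if hj : j = 0 then 0 else
    haveI : NeZero j := ⟨hj⟩
    ∑ᶠ y ∈ {y : FixedPoint σ j | closedPoint (residuePoint y.1) ∈ Z}, τ j y

theorem pointSum_zero (Z : Set (ClosedPoint R A)) (τ : ∀ j, FixedPoint σ j → KBar R) :
    pointSum Z τ 0 = 0 := by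
  rw [pointSum, dif_pos rfl]

open scoped Classical in
theorem pointSum_eq (Z : Set (ClosedPoint R A)) (τ : ∀ j, FixedPoint σ j → KBar R) (j : ℕ)
    [NeZero j] [Fintype (FixedPoint σ j)] :
    pointSum Z τ j = ∑ y : FixedPoint σ j with closedPoint (residuePoint y.1) ∈ Z, τ j y := by
  rw [pointSum, dif_neg (NeZero.ne j)]
  rw [← finsum_mem_coe_finset]
  simp

theorem constantCoeff_eulerFactor (M : Matrix κ κ (KBar R)) {d : ℕ} (hd : d ≠ 0) :
    PowerSeries.constantCoeff ((Polynomial.expand (KBar R) d M.charpoly.reverse :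
      Polynomial (KBar R)) : PowerSeries (KBar R))⁻¹ = 1 := by
  rw [PowerSeries.constantCoeff_inv, Polynomial.constantCoeff_coe, 
    Polynomial.coeff_zero_eq_eval_zero, Polynomial.expand_eval, zero_pow hd,
    ← Polynomial.coeff_zero_eq_eval_zero, Polynomial.coeff_zero_reverse, M.charpoly_monic, inv_one]

/-- The logarithmic derivative has no terms below degree `d`, so in characteristic zero the
coefficients of degree `0 < j < d` vanish. -/
theorem coeff_eulerFactor_of_lt (M : Matrix κ κ (KBar R)) {d : ℕ} (hd : d ≠ 0) {j : ℕ}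
    (hj : j < d) :
    PowerSeries.coeff j ((Polynomial.expand (KBar R) d M.charpoly.reverse :
      Polynomial (KBar R)) : PowerSeries (KBar R))⁻¹ = PowerSeries.coeff j 1 := by
  rcases Nat.eq_zero_or_pos j with rfl | h0
  · rw [PowerSeries.coeff_zero_eq_constantCoeff_apply, constantCoeff_eulerFactor M hd]
    simp
  · have h1 := (hasLogDeriv_reverse_charpoly M hd).coeff j
    rw [Finset.sum_eq_zero] at h1
    · rw [PowerSeries.coeff_one, if_neg h0.ne']
      exact (mul_eq_zero.1 h1).resolve_left (Nat.cast_ne_zero.2 h0.ne')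
    · intro x hx
      rw [Finset.HasAntidiagonal.mem_antidiagonal] at hx
      rw [PowerSeries.coeff_mk, if_neg, mul_zero]
      rintro ⟨h2, h3⟩
      have := Nat.le_of_dvd (Nat.pos_of_ne_zero h2) h3
      omega

/-- Newton's recursion for the coefficients of an Euler product. -/
theorem eulerProduct_recursion (h : HasTeichmullerLifts R A σ) (Z : Set (ClosedPoint R A))
    (D : ∀ P : ClosedPoint R A, TeichmullerLift σ P → Polynomial (KBar R))
    (M : ∀ P : ClosedPoint R A, TeichmullerLift σ P → Matrix κ κ (KBar R))
    (hDM : ∀ P t, D P t = (M P t).charpoly.reverse)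
    (τ : ∀ j, FixedPoint σ j → KBar R) (hτ : ∀ j x i, τ j (FixedPoint.shift x i) = τ j x)
    (hτM : ∀ P (t : TeichmullerLift σ P) (i : ℕ),
      τ (P.degree * i) (t.fixedPoint (dvd_mul_right _ _)) = (M P t ^ i).trace) :
    PowerSeries.coeff 0 (eulerProduct Z D) = 1 ∧
    ∀ m : ℕ, (m : KBar R) * PowerSeries.coeff m (eulerProduct Z D) =
      ∑ x ∈ Finset.HasAntidiagonal.antidiagonal m,
        PowerSeries.coeff x.1 (eulerProduct Z D) * pointSum Z τ x.2 := by
  classical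
  let t : ∀ P : ClosedPoint R A, TeichmullerLift σ P := fun P => (nonempty_teichmullerLift h P).some
  have hdeg : ∀ P : ClosedPoint R A, P.degree ≠ 0 := fun P => (degree_pos h.finiteType P).ne'
  let E : ClosedPoint R A → PowerSeries (KBar R) := fun P =>
    ((Polynomial.expand (KBar R) P.degree (M P (t P)).charpoly.reverse :
      Polynomial (KBar R)) : PowerSeries (KBar R))⁻¹
  have hE : ∀ P, eulerFactor (D P) = E P := fun P => by
    rw [eulerFactor, dif_pos (nonempty_teichmullerLift h P), hDM]
  have hfin : ∀ m, {P : ClosedPoint R A | P ∈ Z ∧ P.degree ≤ m}.Finite := fun m =>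
    (finite_degree_le h m).subset fun P hP => hP.2
  let T : ℕ → Finset (ClosedPoint R A) := fun m => (hfin m).toFinset
  have hT : ∀ m P, P ∈ T m ↔ P ∈ Z ∧ P.degree ≤ m := fun m P => (hfin m).mem_toFinset
  let F : ℕ → PowerSeries (KBar R) := fun m => ∏ P ∈ T m, E P
  have hF : ∀ m, PowerSeries.coeff m (eulerProduct Z D) = PowerSeries.coeff m (F m) := fun m => by
    rw [eulerProduct, PowerSeries.coeff_mk, finprod_mem_eq_finite_toFinset_prod _ (hfin m)]
    simp only [hE]
    rfl
  -- The points of degree above `j` omitted from the smaller product do not change the coefficient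
  -- of `T^j`, so a single product over degrees up to `m` serves the whole recursion at `m`.
  have hFle : ∀ m j, j ≤ m → PowerSeries.coeff j (eulerProduct Z D) = PowerSeries.coeff j (F m) := by
    intro m j hj
    have hsub : T j ⊆ T m := fun P hP => (hT m P).2
      ⟨((hT j P).1 hP).1, ((hT j P).1 hP).2.trans hj⟩
    rw [hF]
    simp only [F]
    rw [← Finset.prod_sdiff hsub, mul_comm]
    refine (coeff_prod_eq_of_forall (m := j) (fun P hP l hl => ?_) _ le_rfl).symm
    rw [Finset.mem_sdiff] at hP
    have h1 : j < P.degree := by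
      by_contra! h2
      exact hP.2 ((hT j P).2 ⟨((hT m P).1 hP.1).1, h2⟩)
    exact coeff_eulerFactor_of_lt _ (hdeg P) (hl.trans_lt h1)
  constructor
  · rw [hF]
    simp only [F]
    rw [PowerSeries.coeff_zero_eq_constantCoeff_apply, map_prod]
    exact Finset.prod_eq_one fun P _ => constantCoeff_eulerFactor _ (hdeg P)
  · intro m
    have h1 := (HasLogDeriv.prod (T m) fun P _ =>
      hasLogDeriv_reverse_charpoly (M P (t P)) (hdeg P)).coeff m
    rw [hF, h1]
    refine Finset.sum_congr rfl fun x hx => ?_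
    rw [Finset.HasAntidiagonal.mem_antidiagonal] at hx
    rw [hFle m x.1 (by omega)]
    congr 1
    simp only [map_sum, PowerSeries.coeff_mk]
    rcases Nat.eq_zero_or_pos x.2 with h2 | h2
    · rw [h2, pointSum_zero]
      simp
    · haveI : NeZero x.2 := ⟨h2.ne'⟩
      haveI := finite_fixedPoint h x.2
      letI := Fintype.ofFinite (FixedPoint σ x.2)
      -- A closed point of degree `d` dividing `j` carries `d` fixed points of `σ^j`, all with the
      -- same trace; this is the factor `d` in the logarithmic derivative of its Euler factor.
      rw [pointSum_eq, sum_fixedPoint_eq h (M := m) (by omega) (τ x.2) (hτ x.2) Z t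
        (fun P => (M P (t P) ^ (x.2 / P.degree)).trace) ?_ (T m) (hT m)]
      · refine Finset.sum_congr rfl fun P _ => ?_
        simp only [h2.ne', ne_eq, not_false_eq_true, true_and]
      · intro P hP
        generalize x.2 = j at hP
        obtain ⟨i, rfl⟩ := hP
        rw [hτM, Nat.mul_div_cancel_left _ (Nat.pos_of_ne_zero (hdeg P))]

end EulerProduct

/-! ### Newton's recursion for the L-functions -/

section Recursion

open scoped Kronecker

universe u

variable {R : Type u} [CommRing R] [IsDomain R] [IsDiscreteValuationRing R]
  [IsAdicComplete (maximalIdeal R) R] [Finite (ResidueField R)] [CharZero R]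
  {A : Type*} [CommRing A] [Algebra R A] {σ : A →ₐ[R] A}
  {M N L : Type*} [AddCommGroup M] [Module A M] [Module.Free A M] [Module.Finite A M]
  [AddCommGroup N] [Module A N] [Module.Free A N] [Module.Finite A N]
  [AddCommGroup L] [Module A L] [Module.Free A L] [Module.Finite A L]
  {κ κ' κ'' : Type*} [Fintype κ] [DecidableEq κ] [Fintype κ'] [DecidableEq κ']
  [Fintype κ''] [DecidableEq κ'']
  {φ : M →ₛₗ[(σ : A →+* A)] M} {ψ : N →ₛₗ[(σ : A →+* A)] N} {χ : L →ₛₗ[(σ : A →+* A)] L}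
  {b : Module.Basis κ A M} {C : Matrix κ κ A} (hC : ∀ i j, C i j = b.repr (φ (b j)) i)
  {c : Module.Basis κ' A N} {D : Matrix κ' κ' A} (hD : ∀ i j, D i j = c.repr (ψ (c j)) i)
  {e : Module.Basis κ'' A L} {E : Matrix κ'' κ'' A} (hE : ∀ i j, E i j = e.repr (χ (e j)) i)

/-- `F` has constant coefficient `1`, and satisfies Newton's recursion `T F' = F ∑ s_j T^j`. -/
def NewtonRecursion {K : Type*} [Field K] (F : PowerSeries K) (s : ℕ → K) : Prop :=
  PowerSeries.coeff 0 F = 1 ∧ ∀ m : ℕ, (m : K) * PowerSeries.coeff m F =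
    ∑ x ∈ Finset.HasAntidiagonal.antidiagonal m, PowerSeries.coeff x.1 F * s x.2

include hC in
theorem newtonRecursion_LFunOn (h : HasTeichmullerLifts R A σ) (Z : Set (ClosedPoint R A)) :
    NewtonRecursion (LFunOn Z φ)
      (pointSum (σ := σ) Z fun j x => (matrixAt σ C (1 * j) x.geom).trace) :=
  eulerProduct_recursion h Z _ (fun P t => matrixAt σ C (1 * P.degree) t.geom)
    (fun P t => detOneSub_frob hC t 1) _ (fun j x i => trace_matrixAt_shift C x 1 i)
    fun P t i => by simp only [matrixAt_pow, TeichmullerLift.geom_fixedPoint]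

include hC hD in
theorem newtonRecursion_LFunTensor (h : HasTeichmullerLifts R A σ) (k : ℕ) :
    NewtonRecursion (LFunTensor ψ φ k)
      (pointSum (σ := σ) Set.univ fun j x =>
        (matrixAt σ D (1 * j) x.geom).trace * (matrixAt σ C (k * j) x.geom).trace) := by
  refine eulerProduct_recursion h _ _ (fun P t =>
    matrixAt σ D (1 * P.degree) t.geom ⊗ₖ matrixAt σ C (k * P.degree) t.geom)
    (fun P t => detOneSub_tensor hC hD t k 1) _ ?_ ?_
  · intro j x i
    simp only [trace_matrixAt_shift]
  · intro P t i
    simp only [kronecker_pow, matrixAt_pow, TeichmullerLift.geom_fixedPoint, Matrix.trace_kronecker]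

include hC hD hE in
theorem newtonRecursion_LFunTensor₃ (h : HasTeichmullerLifts R A σ) (k : ℕ) :
    NewtonRecursion (LFunTensor₃ ψ φ k χ)
      (pointSum (σ := σ) Set.univ fun j x =>
        (matrixAt σ D (1 * j) x.geom).trace * (matrixAt σ C (k * j) x.geom).trace *
          (matrixAt σ E (1 * j) x.geom).trace) := by
  refine eulerProduct_recursion h _ _ (fun P t =>
    matrixAt σ D (1 * P.degree) t.geom ⊗ₖ matrixAt σ C (k * P.degree) t.geom ⊗ₖ
      matrixAt σ E (1 * P.degree) t.geom)
    (fun P t => detOneSub_tensor₃ hC hD hE t k 1 1) _ ?_ ?_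
  · intro j x i
    simp only [trace_matrixAt_shift]
  · intro P t i
    simp only [kronecker_pow, matrixAt_pow, TeichmullerLift.geom_fixedPoint, Matrix.trace_kronecker]

theorem newtonRecursion_ofMatrix (h : HasTeichmullerLifts R A σ) (C : Matrix κ κ A)
    (D : Matrix κ' κ' A) (E : Matrix κ'' κ'' A) (k : ℕ) :
    NewtonRecursion (LFunTensor₃ (ofMatrix (σ : A →+* A) D) (ofMatrix (σ : A →+* A) C) k
        (ofMatrix (σ : A →+* A) E))
      (pointSum (σ := σ) Set.univ fun j x =>
        (matrixAt σ D (1 * j) x.geom).trace * (matrixAt σ C (k * j) x.geom).trace *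
          (matrixAt σ E (1 * j) x.geom).trace) :=
  newtonRecursion_LFunTensor₃ (b := Pi.basisFun A κ) (c := Pi.basisFun A κ')
    (e := Pi.basisFun A κ'') (C := C) (D := D) (E := E) ofMatrix_repr ofMatrix_repr ofMatrix_repr
    h k

end Recursion

/-! ### Comparison of point sums -/

section Comparison

universe u

variable {R : Type u} [CommRing R] [IsDomain R] [IsDiscreteValuationRing R]
  [IsAdicComplete (maximalIdeal R) R] [Finite (ResidueField R)] [CharZero R]

theorem matrixAt_map {A B : Type*} [CommRing A] [Algebra R A] [CommRing B] [Algebra R B]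
    {σ : A →ₐ[R] A} {σ₁ : B →ₐ[R] B} (g : A →ₐ[R] B) (hg : ∀ a, σ₁ (g a) = g (σ a))
    {κ : Type*} [Fintype κ] [DecidableEq κ] (C : Matrix κ κ A) (m : ℕ) (y : B →ₐ[R] KBar R) :
    matrixAt σ₁ (C.map g) m y = matrixAt σ C m (y.comp g) := by
  have h := map_iterMatrix (σ := (σ : A →+* A)) (σ₁ := (σ₁ : B →+* B)) (C := C)
    (g : A →+* B) hg m
  rw [matrixAt, matrixAt]
  refine (congrArg (fun X : Matrix κ κ B => X.map (y : B →+* KBar R)) h.symm).trans ?_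
  rw [Matrix.map_map]
  rfl

theorem trace_matrixAt_unit {A : Type*} [CommRing A] [Algebra R A] {σ : A →ₐ[R] A} (Φ : A) (m : ℕ)
    (y : A →ₐ[R] KBar R) :
    (matrixAt σ (Matrix.of fun _ _ : Unit => Φ) m y).trace =
      ∏ j ∈ Finset.range m, y (σ^[j] Φ) := by
  rw [matrixAt, iterMatrix_unit]
  simp [Matrix.trace]

theorem trace_matrixAt_geom {A : Type*} [CommRing A] [Algebra R A] {σ : A →ₐ[R] A}
    {κ : Type*} [Fintype κ] [DecidableEq κ] (C : Matrix κ κ A) (m : ℕ) {j : ℕ}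
    (x : FixedPoint σ j) :
    (matrixAt σ C m x.geom).trace = algebraMap (Unramified R j) (KBar R)
      ((iterMatrix (σ : A →+* A) C m).map x.1).trace := by
  rw [matrixAt, Matrix.trace, Matrix.trace, map_sum]
  rfl

theorem eq_rescale_of_recursion {F F' : PowerSeries (KBar R)} {s s' : ℕ → KBar R} {c : KBar R}
    (hF : NewtonRecursion F s) (hF' : NewtonRecursion F' s')
    (h0 : s 0 = 0) (hs : ∀ j, s j = c ^ j * s' j) : F = PowerSeries.rescale c F' := by
  refine eq_of_recursion (s := s) ?_ h0 hF.2 fun m => ?_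
  · rw [hF.1, PowerSeries.coeff_rescale, hF'.1, pow_zero, one_mul]
  · simp only [hs]
    exact rescale_recursion c hF'.2 m

section Quotient

variable {ι : Type*} {A : Type*} [CommRing A] [Algebra R A]
  {μ : Overconvergent R ι →ₐ[R] A} (hμ : Function.Surjective μ) {σ : A →ₐ[R] A}
  {σ₀ : Overconvergent R ι →ₐ[R] Overconvergent R ι} (hσ₀ : IsFrobeniusLift σ₀)
  (hcomm : ∀ a, μ (σ₀ a) = σ (μ a))

variable (μ) in
/-- The closed points of `𝔸^n` on the closed subscheme cut out by `ker μ`. -/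
abbrev closedPointsOn : Set (ClosedPoint R (Overconvergent R ι)) :=
  {P | ∀ g ∈ RingHom.ker μ, (1 : ResidueField R) ⊗ₜ[R] g ∈ P.asIdeal}

theorem closedPoint_mem_closedPointsOn_iff {m : ℕ} [NeZero m]
    (x : Overconvergent R ι →ₐ[R] UnramifiedResidue R m) :
    closedPoint x ∈ closedPointsOn μ ↔ ∀ g ∈ RingHom.ker μ, x g = 0 :=
  forall₂_congr fun g _ => mem_closedPoint x g

/-- Composition of fixed points with `μ`. -/
def FixedPoint.comp {m : ℕ} (x : FixedPoint σ m) : FixedPoint σ₀ m :=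
  ⟨x.1.comp μ, fun a => by
    rw [AlgHom.comp_apply, apply_iterate_of_comm hcomm, x.2, AlgHom.comp_apply]⟩

include hμ hσ₀ in
-- Composition with `μ` is a bijection onto the fixed points over the closed subscheme: injective
-- since `μ` is surjective, surjective by `exists_fixedPoint_factor`, where flatness enters.
theorem pointSum_comp [Module.Flat R A] (τ : ∀ j, FixedPoint σ j → KBar R) (τ₀ : ∀ j, FixedPoint σ₀ j → KBar R)
    (hτ : ∀ j x, τ j x = τ₀ j (x.comp hcomm)) (j : ℕ) :
    pointSum Set.univ τ j = pointSum (closedPointsOn μ) τ₀ j := by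
  unfold pointSum
  split_ifs with hj
  · rfl
  · haveI : NeZero j := ⟨hj⟩
    refine finsum_mem_eq_of_bijOn (FixedPoint.comp hcomm) ⟨?_, ?_, ?_⟩ fun x _ => hτ j x
    · intro x _
      refine (closedPoint_mem_closedPointsOn_iff _).2 fun g hg => ?_
      change toResidue R j (x.1 (μ g)) = 0
      rw [RingHom.mem_ker.1 hg, map_zero, map_zero]
    · intro x _ y _ hxy
      refine Subtype.ext (AlgHom.ext fun a => ?_)
      obtain ⟨b, rfl⟩ := hμ a
      exact congrArg (fun f : FixedPoint σ₀ j => f.1 b) hxy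
    · intro y hy
      obtain ⟨x, hx⟩ := exists_fixedPoint_factor hμ hcomm hσ₀ y fun i hi =>
        (closedPoint_mem_closedPointsOn_iff _).1 hy i hi
      exact ⟨x, by simp, Subtype.ext hx⟩

end Quotient

variable {p : ℕ} [Fact p.Prime] [CharP (ResidueField R) p] {πs : R}
  (hπs : πs ^ (p - 1) = -(p : R))

include hπs in
-- Image in `KBar R` of `sum_splitting`. The values `τ₀` are required to come from `R_j` through
-- `F`, where the character sum takes place; a fixed point lies over the closed subscheme exactly
-- when the generators `f_i` vanish at its reduction.
theorem pointSum_splitting {ι : Type*} [Finite ι] {A : Type*} [CommRing A] [Algebra R A]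
    {μ : Overconvergent R ι →ₐ[R] A} {s a : ℕ} (ha : Nat.card (ResidueField R) = p ^ a)
    {σ₀ : Overconvergent R ι →ₐ[R] Overconvergent R ι} (hσ₀ : IsFrobeniusLift σ₀)
    {σ₁ : Overconvergent R (ι ⊕ Fin s) →ₐ[R] Overconvergent R (ι ⊕ Fin s)}
    (hσ₁ : IsFrobeniusLift σ₁)
    (hσ₁σ₀ : ∀ a, σ₁ (inclX R ι (Fin s) a) = inclX R ι (Fin s) (σ₀ a))
    {f : Fin s → Overconvergent R ι} (hf : Ideal.span (Set.range f) = RingHom.ker μ)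
    {W : Overconvergent R (ι ⊕ Fin s)} {G : Overconvergent R (ι ⊕ Fin s)}
    (hG : G = ∑ i, Overconvergent.X (Sum.inr i) * inclX R ι (Fin s) (f i))
    (hW : W - ∑ i ∈ Finset.range a, G ^ p ^ i ∈
      (maximalIdeal R).map (algebraMap R (Overconvergent R (ι ⊕ Fin s))))
    (hexp : IsScaledExp hπs (G - σ₁ G) ((1 + πs • W) ^ p))
    (F : ∀ j, FixedPoint σ₀ j → Unramified R j) (τ₀ : ∀ j, FixedPoint σ₀ j → KBar R)
    (hτ₀ : ∀ j x, τ₀ j x = algebraMap (Unramified R j) (KBar R) (F j x))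
    (τ₁ : ∀ j, FixedPoint σ₁ j → KBar R)
    (hτ₁ : ∀ j z, τ₁ j z = τ₀ j (z.restrict hσ₁σ₀) *
      ∏ i ∈ Finset.range j, z.geom (σ₁^[i] (1 + πs • W))) (j : ℕ) :
    pointSum (closedPointsOn μ) τ₀ j =
      (((Nat.card (ResidueField R) : KBar R) ^ s)⁻¹) ^ j * pointSum Set.univ τ₁ j := by
  classical
  rcases eq_or_ne j 0 with rfl | hj
  · rw [pointSum_zero, pointSum_zero, mul_zero]
  haveI : NeZero j := ⟨hj⟩
  haveI := finite_fixedPoint (hasTeichmullerLifts_overconvergent hσ₀) j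
  haveI := finite_fixedPoint (hasTeichmullerLifts_overconvergent hσ₁) j
  letI := Fintype.ofFinite (FixedPoint σ₀ j)
  letI := Fintype.ofFinite (FixedPoint σ₁ j)
  have hq : (Nat.card (ResidueField R) : KBar R) ≠ 0 := Nat.cast_ne_zero.2 Nat.card_pos.ne'
  have h1 := congrArg (algebraMap (Unramified R j) (KBar R))
    (sum_splitting hπs ha hσ₀ hσ₁ hσ₁σ₀ f hG hW hexp (F j))
  rw [map_mul, map_pow, map_natCast, map_sum, map_sum] at h1
  have h2 : pointSum Set.univ τ₁ j = ∑ z : FixedPoint σ₁ j, algebraMap (Unramified R j) (KBar R)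
      (F j (z.restrict hσ₁σ₀) * ∏ i ∈ Finset.range j, z.1 (σ₁^[i] (1 + πs • W))) := by
    rw [pointSum_eq]
    simp only [Set.mem_univ, Finset.filter_true]
    refine Finset.sum_congr rfl fun z _ => ?_
    rw [hτ₁, hτ₀, map_mul, map_prod]
    rfl
  have h3 : pointSum (closedPointsOn μ) τ₀ j =
      ∑ x : FixedPoint σ₀ j with ∀ i, residuePoint x.1 (f i) = 0,
        algebraMap (Unramified R j) (KBar R) (F j x) := by
    rw [pointSum_eq]
    refine Finset.sum_congr (Finset.filter_congr fun x _ => ?_) fun x _ => hτ₀ j x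
    rw [closedPoint_mem_closedPointsOn_iff, ← hf]
    constructor
    · exact fun h i => h _ (Ideal.subset_span ⟨i, rfl⟩)
    · intro h g hg
      have hle : Ideal.span (Set.range f) ≤ RingHom.ker (residuePoint x.1) := by
        rw [Ideal.span_le]
        rintro _ ⟨i, rfl⟩
        exact h i
      exact hle hg
  rw [h3, h2, h1, inv_pow, ← pow_mul, inv_mul_cancel_left₀ (pow_ne_zero _ hq)]

end Comparison

end SigmaMod

end

/-! ### The two identities of L-functions -/

theorem lemma9p3
    -- the complete discrete valuation ring `R`, and `π*` with `(π*)^(p-1) = -p`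
    {R : Type*} [CommRing R] [IsDomain R] [IsDiscreteValuationRing R] [CharZero R]
    [IsAdicComplete (maximalIdeal R) R] [Finite (ResidueField R)]
    (p : ℕ) [Fact p.Prime] [CharP (ResidueField R) p]
    (πs : R) (hπs : πs ^ (p - 1) = -(p : R))
    -- the flat quotient `A` of `R[X_1, ..., X_n]†` and its Frobenius lifting `σ`
    {n : ℕ} {A : Type*} [CommRing A] [Algebra R A] [Module.Flat R A]
    (μ : Overconvergent R (Fin n) →ₐ[R] A) (hμ : Function.Surjective μ)
    (σ : A →ₐ[R] A) (hσ : IsFrobeniusLift σ)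
    -- the overconvergent `σ`-modules `(M, φ)` and `(N, ψ)` over `A`, with bases
    {M N : Type*} [AddCommGroup M] [Module A M] [Module.Free A M] [Module.Finite A M]
    [AddCommGroup N] [Module A N] [Module.Free A N] [Module.Finite A N]
    (φ : M →ₛₗ[(σ : A →+* A)] M) (ψ : N →ₛₗ[(σ : A →+* A)] N)
    {r t : ℕ} (b : Module.Basis (Fin r) A M) (c : Module.Basis (Fin t) A N)
    -- the lifting `σ₀` of `σ` to `R[X]†`, and lifted Frobenius matrices `C₀` and `D₀`
    (σ₀ : Overconvergent R (Fin n) →ₐ[R] Overconvergent R (Fin n))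
    (hσ₀ : IsFrobeniusLift σ₀) (hσ₀μ : ∀ a, μ (σ₀ a) = σ (μ a))
    (C₀ : Matrix (Fin r) (Fin r) (Overconvergent R (Fin n)))
    (hC₀ : ∀ i j, μ (C₀ i j) = b.repr (φ (b j)) i)
    (D₀ : Matrix (Fin t) (Fin t) (Overconvergent R (Fin n)))
    (hD₀ : ∀ i j, μ (D₀ i j) = c.repr (ψ (c j)) i)
    -- generators `f_1, ..., f_s` of `I = ker μ`
    {s : ℕ} (f : Fin s → Overconvergent R (Fin n))
    (hf : Ideal.span (Set.range f) = RingHom.ker μ)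
    -- an extension `σ₁` of `σ₀` to a Frobenius lifting of `R[X, Y]†`
    (σ₁ : Overconvergent R (Fin n ⊕ Fin s) →ₐ[R] Overconvergent R (Fin n ⊕ Fin s))
    (hσ₁ : IsFrobeniusLift σ₁)
    (hσ₁σ₀ : ∀ a, σ₁ (inclX R (Fin n) (Fin s) a) = inclX R (Fin n) (Fin s) (σ₀ a))
    -- `G = Y_1 f_1(X) + ... + Y_s f_s(X)`
    (G : Overconvergent R (Fin n ⊕ Fin s))
    (hG : G = ∑ i, Overconvergent.X (Sum.inr i) * inclX R (Fin n) (Fin s) (f i)) :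
    -- `Φ = exp(π* (G - G^σ))` is an element of `R[X, Y]†`, and
    ∃ Φ : Overconvergent R (Fin n ⊕ Fin s),
      IsExp πs ((G - σ₁ G : Overconvergent R (Fin n ⊕ Fin s)) : MvPowerSeries (Fin n ⊕ Fin s) R)
        (Φ : MvPowerSeries (Fin n ⊕ Fin s) R) ∧
      -- `L(φ₀ / X, T) = L(φ₀ ⊗ Φ / 𝔸^(n+s), T / q^s)`
      LFunOn {P : ClosedPoint R (Overconvergent R (Fin n)) |
            ∀ g ∈ RingHom.ker μ, (1 : ResidueField R) ⊗ₜ[R] g ∈ P.asIdeal}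
          (ofMatrix (σ₀ : Overconvergent R (Fin n) →+* Overconvergent R (Fin n)) C₀) =
        PowerSeries.rescale (((Nat.card (ResidueField R) : KBar R) ^ s)⁻¹)
          (LFunTensor
            (ofMatrix (σ₁ : Overconvergent R (Fin n ⊕ Fin s) →+* Overconvergent R (Fin n ⊕ Fin s))
              (C₀.map (inclX R (Fin n) (Fin s))))
            (ofMatrix (σ₁ : Overconvergent R (Fin n ⊕ Fin s) →+* Overconvergent R (Fin n ⊕ Fin s))
              (Matrix.of fun _ _ : Unit => Φ)) 1) ∧
      -- `L(ψ ⊗ φ^k, T) = L(ψ₀ ⊗ φ₀^k ⊗ Φ / 𝔸^(n+s), T / q^s)` for all `k ≥ 1`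
      ∀ k : ℕ, 0 < k →
        LFunTensor ψ φ k =
          PowerSeries.rescale (((Nat.card (ResidueField R) : KBar R) ^ s)⁻¹)
            (LFunTensor₃
              (ofMatrix
                (σ₁ : Overconvergent R (Fin n ⊕ Fin s) →+* Overconvergent R (Fin n ⊕ Fin s))
                (D₀.map (inclX R (Fin n) (Fin s))))
              (ofMatrix
                (σ₁ : Overconvergent R (Fin n ⊕ Fin s) →+* Overconvergent R (Fin n ⊕ Fin s))
                (C₀.map (inclX R (Fin n) (Fin s)))) k
              (ofMatrix
                (σ₁ : Overconvergent R (Fin n ⊕ Fin s) →+* Overconvergent R (Fin n ⊕ Fin s))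
                (Matrix.of fun _ _ : Unit => Φ))) := by
  classical
  letI := Fintype.ofFinite (ResidueField R)
  obtain ⟨a, -, ha⟩ := FiniteField.card (ResidueField R) p
  rw [← Nat.card_eq_fintype_card] at ha
  -- Every term of `G` contains some `Y_i`. Without a constant term in `G`, the solution of the
  -- Artin–Schreier equation modulo `𝔪` is unambiguous.
  have hG0 : MvPowerSeries.constantCoeff (G : MvPowerSeries (Fin n ⊕ Fin s) R) = 0 := by
    rw [hG]
    simp [Overconvergent.X]
  obtain ⟨W, hexp, hW, hpow⟩ := exists_splitting hπs σ₁ hσ₁ ha G hG0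
  have hscaled : IsScaledExp hπs (G - σ₁ G) ((1 + πs • W) ^ p) := fun n => by
    rw [← Ideal.map_pow]
    exact hpow n
  have hA := hasTeichmullerLifts_of_surjective hμ hσ₀ hσ₀μ hσ
  have hA₀ := hasTeichmullerLifts_overconvergent hσ₀
  have hA₁ := hasTeichmullerLifts_overconvergent hσ₁
  -- The extended modules `φ₀`, `ψ₀` are pulled back from `𝔸^n`, so their fibres depend only on the
  -- projection of the point; only `Φ` varies along the fibre.
  have hrestrict : ∀ {κ : Type} [Fintype κ] [DecidableEq κ]
      (C : Matrix κ κ (Overconvergent R (Fin n))) (m j : ℕ) (z : FixedPoint σ₁ j),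
      matrixAt σ₁ (C.map (inclX R (Fin n) (Fin s))) m z.geom =
        matrixAt σ₀ C m (z.restrict hσ₁σ₀).geom := fun C m j z =>
    matrixAt_map (inclX R (Fin n) (Fin s)) hσ₁σ₀ C m z.geom
  refine ⟨1 + πs • W, hexp, ?_, fun k _ => ?_⟩
  -- Here `φ₀` occupies the first tensor slot and `Φ` the second, with exponent `1`.
  · refine eq_rescale_of_recursion (newtonRecursion_LFunOn ofMatrix_repr hA₀ _)
      (newtonRecursion_LFunTensor ofMatrix_repr ofMatrix_repr hA₁ 1) (pointSum_zero _ _) ?_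
    refine pointSum_splitting hπs ha hσ₀ hσ₁ hσ₁σ₀ hf hG hW hscaled _ _
      (fun j x => trace_matrixAt_geom C₀ (1 * j) x) _ fun j z => ?_
    simp only [hrestrict, trace_matrixAt_unit, one_mul]
  · let τ : ∀ j, FixedPoint σ j → KBar R := fun j x =>
      (matrixAt σ (D₀.map μ) (1 * j) x.geom).trace * (matrixAt σ (C₀.map μ) (k * j) x.geom).trace
    let τ₀ : ∀ j, FixedPoint σ₀ j → KBar R := fun j x =>
      (matrixAt σ₀ D₀ (1 * j) x.geom).trace * (matrixAt σ₀ C₀ (k * j) x.geom).trace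
    have hτ : ∀ j x, τ j x = τ₀ j (x.comp hσ₀μ) := fun j x =>
      congrArg₂ (fun X Y => Matrix.trace X * Matrix.trace Y)
        (matrixAt_map μ (fun a => (hσ₀μ a).symm) D₀ (1 * j) x.geom)
        (matrixAt_map μ (fun a => (hσ₀μ a).symm) C₀ (k * j) x.geom)
    refine eq_rescale_of_recursion (newtonRecursion_LFunTensor hC₀ hD₀ hA k)
      (newtonRecursion_ofMatrix hA₁ _ _ _ k)
      (pointSum_zero _ _) fun j => ?_
    -- The sum over `A` becomes one over the points of `𝔸^n` on `X`, which brings the second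
    -- identity to the same comparison as the first, with the product of the traces of `ψ₀` and
    -- `φ₀^k` as summand.
    refine (pointSum_comp hμ hσ₀ hσ₀μ τ τ₀ hτ j).trans ?_
    refine pointSum_splitting hπs ha hσ₀ hσ₁ hσ₁σ₀ hf hG hW hscaled
      (fun j x => ((iterMatrix (σ₀ : Overconvergent R (Fin n) →+* _) D₀ (1 * j)).map x.1).trace *
        ((iterMatrix (σ₀ : Overconvergent R (Fin n) →+* _) C₀ (k * j)).map x.1).trace) τ₀ (fun j x => ?_) _ (fun j z => ?_) j
    · simp only [τ₀, trace_matrixAt_geom, map_mul]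
    · simp only [τ₀, hrestrict, trace_matrixAt_unit, one_mul]
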